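/- Let $\boldsymbol\omega=(\omega_1,\omega_2,\ldots)$ be a nondecreasing sequence of positive numbers tending to $+\infty$, and let $(n_k)_{k\ge 1}$ be a sequence of distinct positive integers (not assumed to be increasing) satisfying the following Condition $\mathbf{A}_{\boldsymbol\omega}$: there is an $N_0$ such that for every $N\ge N_0$ the equation $$a_1 n_{k_1}+\cdots+a_r n_{k_r}=0,\qquad 2\le r\le \omega_N,\quad 0<|a_1|,\ldots,|a_r|\le N^{\omega_N},$$ with different indices $k_1,\ldots,k_r$ and nonzero integer coefficients $a_1,\ldots,a_r$, has only such solutions where all $n_{k_j}$ belong to the $N$ smallest elements of the sequence $(n_k)_{k\ge 1}$. Then for every measurable $f:\mathbb{R}\to\mathbb{R}$ with $f(x+1)=f(x)$ for all $x$, $\int_0^1 f(x)\,dx=0$ and of bounded variation on $[0,1]$, we have $$N^{-1/2}\sum_{k=1}^N f(n_k x)\ \stackrel{\mathcal D}{\longrightarrow}\ \mathcal N(0,\|f\|^2)\qquad (N\to\infty)$$ with respect to the probability space $[0,1]$ equipped with Lebesgue measure, where $\|f\|=\left(\int_0^1 f(x)^2\,dx\right)^{1/2}$ (and $\mathcal N(0,0)$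 is the unit mass at $0$). If moreover there are $\alpha>0$ and $k_0$ such that $\omega_k\ge(\log k)^\alpha$ for all $k\ge k_0$, then for every such $f$ we also have $$\limsup_{N\to\infty}\frac{\sum_{k=1}^N f(n_kx)}{(2N\log\log N)^{1/2}}=\|f\|\qquad\text{for almost every } x.$$ Both conclusions remain valid if $(n_k)_{k\ge1}$ is replaced by $(n_{\sigma(k)})_{k\ge 1}$, for any permutation $\sigma$ of the positive integers. -/

import Mathlib

open MeasureTheory ProbabilityTheory Filter Set

/-- `m` is one of the `N` smallest elements of the sequence `n 1, n 2, …` of natural numbers: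
it is an element of the sequence and fewer than `N` elements of the sequence are smaller. -/
def IsAmongSmallest (n : ℕ → ℕ) (N m : ℕ) : Prop :=
  m ∈ n '' Ici 1 ∧ (n '' Ici 1 ∩ Iio m).ncard < N

/-- Condition `A_ω` for the sequence `n 1, n 2, …`: for all large `N`, every solution of
`∑ a k * n k = 0`, over a set `S` of `r` different positive indices with `2 ≤ r ≤ ω N` and with
integer coefficients `0 < |a k| ≤ N ^ ω N`, involves only the `N` smallest elements. -/
def ConditionA (ω : ℕ → ℝ) (n : ℕ → ℕ) : Prop :=
  ∃ N₀ : ℕ, ∀ N : ℕ, 1 ≤ N → N₀ ≤ N →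
    ∀ (S : Finset ℕ) (a : ℕ → ℤ),
      (∀ k ∈ S, 1 ≤ k) → 2 ≤ S.card → (S.card : ℝ) ≤ ω N →
      (∀ k ∈ S, 0 < |a k| ∧ ((|a k| : ℤ) : ℝ) ≤ (N : ℝ) ^ ω N) →
      ∑ k ∈ S, a k * (n k : ℤ) = 0 →
      ∀ k ∈ S, IsAmongSmallest n N (n k)

/-- `f` is measurable, 1-periodic, of mean zero, and of bounded variation over a period. -/
structure IsAdmissible (f : ℝ → ℝ) : Prop where
  measurable : Measurable f
  periodic : ∀ x, f (x + 1) = f x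
  integral_eq_zero : ∫ x in (0 : ℝ)..1, f x = 0
  boundedVariation : BoundedVariationOn f (Icc 0 1)

/-- The `L²(0, 1)` norm of `f`. -/
noncomputable def l2Norm (f : ℝ → ℝ) : ℝ := √(∫ x in (0 : ℝ)..1, f x ^ 2)

/-- The central limit theorem for `f (n k x)`: on `[0, 1]` with Lebesgue measure,
`N ^ (-1/2) * ∑_{k = 1}^N f (n k x)` converges in distribution to the (possibly degenerate)
normal law with mean `0` and variance `‖f‖ ^ 2`. -/
def SatisfiesCLT (f : ℝ → ℝ) (n : ℕ → ℕ) : Prop :=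
  TendstoInDistribution
    (fun (N : ℕ) (x : unitInterval) ↦ (√(N : ℝ))⁻¹ * ∑ k ∈ Finset.Icc 1 N, f ((n k : ℝ) * (x : ℝ)))
    atTop (id : ℝ → ℝ) (fun _ ↦ (volume : Measure unitInterval)) (gaussianReal 0 (l2Norm f ^ 2).toNNReal)

/-- The law of the iterated logarithm for `f (n k x)`, the upper limit being taken in the
extended reals. -/
def SatisfiesLIL (f : ℝ → ℝ) (n : ℕ → ℕ) : Prop :=
  ∀ᵐ x : ℝ, limsup (fun N : ℕ ↦
      (((∑ k ∈ Finset.Icc 1 N, f ((n k : ℝ) * x)) /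
        √(2 * (N : ℝ) * Real.log (Real.log (N : ℝ))) : ℝ) : EReal)) atTop
    = ((l2Norm f : ℝ) : EReal)

/-! The principle is that a sum of `f (n i * x)` over indices without short integer relations has
the same low-order moments as a sum of independent copies. Condition A at level `M` says that, once
the indices of the `M` smallest elements are discarded, no relation survives with at most `ω M`
terms and coefficients up to `M ^ ω M`. For sums up to `2 ^ κ` one takes `M = 2 ^ (κ / 8)`: the
discarded terms are too few to matter against the square root of the length, and what remains
(`dyadicBulk`) is dissociated with coefficients up to `2 ^ (8 κ)`. The condition only sees the set
of values, so it passes to every permutation (`ConditionA.comp`).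

A function of bounded variation is within `C / √D` in `L¹` of a trigonometric polynomial of degree
`D`, bounded by the same constant (`IsAdmissible.exists_trigPoly_approx`). With `D = 2 ^ (6 κ)` the
total replacement error over `2 ^ κ` terms is summable in `κ`. For a polynomial, expanding a power
of the sum into characters and applying dissociation shows that moments up to the permitted order
equal exactly those of independent uniform variables (`Dissociated.integral_weightedSum_pow`). The
exponential moments of the independent model then bound the even moments. Cutting the exponential
series at order `2 m` on both sides gives a quantitative Gaussian approximation of characteristic
functions (`Dissociated.norm_charFun_sub_le`).

For the central limit theorem a fixed large order suffices, so `ω → ∞` is enough, and Lévy's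
continuity theorem concludes. For the iterated logarithm, moments of order a constant times `log κ`
are needed at scale `2 ^ κ`; the growth of `ω` supplies them (`LogDissociated`).

Upper bound: Markov's inequality at order `2 ⌊log k⌋` has almost the Gaussian tail when the
exponential moment keeps the true variance. It is applied on a grid of boundedly many points in `[2
^ k, 2 ^ (k + 1)]`, dyadic chaining controls the gaps, and Borel–Cantelli finishes.

Lower bound: normalised sums over the blocks `(2 ^ (s (k - 1)), 2 ^ (s k)]`, `K < k ≤ 2 K`, are
pairwise almost independent Gaussians, with characteristic functions correct to `K ^ (-3)` for
frequencies of order `√(log K)`. Trigonometric bumps centred at `(1 - ε) √(2 log K)` use only those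
frequencies and have Gaussian mean at least a constant times `K ^ (-(1 - ε))`. Chebyshev's
inequality then makes some block sum large, outside probability `O(K ^ (-ε))`, which is summable
along `K = 2 ^ i`. The upper bound controls the part of the sum before the block, and keeps the
block sums within the central period of the bump. -/

open scoped Topology

/-! ### Dissociated index sets and Condition A -/

/-- Among the `n i`, `i ∈ I`, there is no nontrivial integer relation with at most `r` nonzero
coefficients, all of absolute value at most `Q`. -/
def Dissociated (n : ℕ → ℕ) (I : Finset ℕ) (r Q : ℕ) : Prop :=
  ∀ a : ℕ → ℤ, (∀ i ∈ I, |a i| ≤ Q) → (I.filter fun i ↦ a i ≠ 0).card ≤ r →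
    ∑ i ∈ I, a i * (n i : ℤ) = 0 → ∀ i ∈ I, a i = 0

lemma Dissociated.mono {n : ℕ → ℕ} {I J : Finset ℕ} {r r' Q Q' : ℕ} (h : Dissociated n I r Q)
    (hJ : J ⊆ I) (hr : r' ≤ r) (hQ : Q' ≤ Q) : Dissociated n J r' Q' := by
  intro a ha hc hs i hi
  have h1 := h (fun i ↦ if i ∈ J then a i else 0) ?_ ?_ ?_ i (hJ hi)
  · simpa [hi] using h1
  · intro i _
    by_cases hiJ : i ∈ J
    · simpa [hiJ] using (ha i hiJ).trans (by exact_mod_cast hQ)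
    · simp [hiJ]
  · refine le_trans (Finset.card_le_card ?_) (hc.trans hr)
    intro i hi
    simp only [Finset.mem_filter, ne_eq, ite_eq_right_iff, Classical.not_imp] at hi ⊢
    exact hi.2
  · refine (Finset.sum_subset hJ fun i _ hi ↦ by simp [hi]).symm.trans (Eq.trans ?_ hs)
    exact Finset.sum_congr rfl fun i hi ↦ by simp [hi]

open Classical in
/-- The indices in `[1, L]` whose elements are not among the `M` smallest ones. -/
noncomputable def bulk (n : ℕ → ℕ) (M L : ℕ) : Finset ℕ :=
  (Finset.Icc 1 L).filter fun i ↦ ¬ IsAmongSmallest n M (n i)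

lemma bulk_subset (n : ℕ → ℕ) (M L : ℕ) : bulk n M L ⊆ Finset.Icc 1 L := by
  classical exact Finset.filter_subset _ _

/-- The number of elements of the sequence below `n i` is a strictly increasing function of `n i`,
and it is less than `M` on the discarded indices; it therefore injects them into `range M`. -/
lemma card_sdiff_bulk_le {n : ℕ → ℕ} (hn : Set.InjOn n (Set.Ici 1)) (M L : ℕ) :
    (Finset.Icc 1 L \ bulk n M L).card ≤ M := by
  classical
  have hmem : ∀ i ∈ Finset.Icc 1 L \ bulk n M L, 1 ≤ i ∧ IsAmongSmallest n M (n i) := by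
    intro i hi
    simp only [bulk, Finset.mem_sdiff, Finset.mem_Icc, Finset.mem_filter, not_and, not_not] at hi
    exact ⟨hi.1.1, hi.2 hi.1⟩
  have hlt : ∀ i j : ℕ, 1 ≤ i → n i < n j →
      (n '' Ici 1 ∩ Iio (n i)).ncard < (n '' Ici 1 ∩ Iio (n j)).ncard := by
    intro i j hi hij
    refine Set.ncard_lt_ncard ?_ ((Set.finite_Iio _).inter_of_right _)
    refine ⟨fun x hx ↦ ⟨hx.1, lt_trans hx.2 hij⟩, fun h ↦ ?_⟩
    exact lt_irrefl (n i) (h ⟨⟨i, hi, rfl⟩, hij⟩).2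
  have := Finset.card_le_card_of_injOn (s := Finset.Icc 1 L \ bulk n M L) (t := Finset.range M)
    (fun i ↦ (n '' Ici 1 ∩ Iio (n i)).ncard) (fun i hi ↦ by simpa using (hmem i hi).2.2) ?_
  · simpa using this
  · intro i hi j hj hij
    have hi' := hmem i hi
    have hj' := hmem j hj
    rcases lt_trichotomy (n i) (n j) with h | h | h
    · exact absurd hij (hlt i j hi'.1 h).ne
    · exact hn hi'.1 hj'.1 h
    · exact absurd hij (hlt j i hj'.1 h).ne'

/-- A nontrivial relation would be supported on bulk indices, where Condition A forbids it.
Condition A speaks only of at least two terms; a one-term relation is impossible because the `n k`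
are positive. -/
lemma ConditionA.dissociated_bulk {ω : ℕ → ℝ} {n : ℕ → ℕ} (hA : ConditionA ω n)
    (hn_pos : ∀ k, 1 ≤ k → 0 < n k) :
    ∃ N₀ : ℕ, ∀ M, N₀ ≤ M → ∀ L r Q : ℕ, (r : ℝ) ≤ ω M → (Q : ℝ) ≤ (M : ℝ) ^ ω M →
      Dissociated n (bulk n M L) r Q := by
  classical
  obtain ⟨N₀, h⟩ := hA
  refine ⟨max N₀ 1, fun M hM L r Q hr hQ a ha hc hs ↦ ?_⟩
  by_contra! hne
  obtain ⟨i, hi, hai⟩ := hne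
  set S := (bulk n M L).filter fun i ↦ a i ≠ 0 with hS
  have hsum : ∑ k ∈ S, a k * (n k : ℤ) = 0 := by
    rw [hS, Finset.sum_filter_of_ne, hs]
    intro x _ hx h0
    simp [h0] at hx
  have hiS : i ∈ S := by simp [hS, hi, hai]
  have hS1 : ∀ k ∈ S, 1 ≤ k := fun k hk ↦
    (Finset.mem_Icc.1 (bulk_subset n M L (Finset.mem_filter.1 hk).1)).1
  rcases Nat.lt_or_ge S.card 2 with hlt | hge
  · have : S = {i} := by
      have h1 : S.card ≤ 1 := by omega
      exact Finset.eq_singleton_iff_unique_mem.2 ⟨hiS, fun x hx ↦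
        Finset.card_le_one.1 h1 x hx i hiS⟩
    rw [this, Finset.sum_singleton] at hsum
    have := hn_pos i (hS1 i hiS)
    rcases mul_eq_zero.1 hsum with h0 | h0
    · exact hai h0
    · have : n i = 0 := by exact_mod_cast h0
      omega
  · have := h M (le_trans (le_max_right _ _) hM) (le_trans (le_max_left _ _) hM) S a hS1 hge
      (le_trans (by exact_mod_cast hc) hr) (fun k hk ↦ ?_) hsum i hiS
    · exact (Finset.mem_filter.1 hi).2 this
    · rw [hS, Finset.mem_filter] at hk
      exact ⟨abs_pos.2 hk.2, le_trans (by exact_mod_cast ha k hk.1) hQ⟩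

/-- The main part of the initial segment `[1, 2 ^ κ]`. -/
noncomputable def dyadicBulk (n : ℕ → ℕ) (κ : ℕ) : Finset ℕ := bulk n (2 ^ (κ / 8)) (2 ^ κ)

lemma tendsto_two_pow_div : Tendsto (fun κ : ℕ ↦ 2 ^ (κ / 8)) atTop (atTop : Filter ℕ) :=
  (tendsto_pow_atTop_atTop_of_one_lt (by norm_num)).comp (Nat.tendsto_div_const_atTop (by norm_num))

lemma ConditionA.dissociated_dyadicBulk {ω : ℕ → ℝ} {n : ℕ → ℕ} (hA : ConditionA ω n)
    (hn_pos : ∀ k, 1 ≤ k → 0 < n k) (hω_lim : Tendsto ω atTop atTop) (r : ℕ → ℕ)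
    (hr : ∀ᶠ κ in atTop, (r κ : ℝ) ≤ ω (2 ^ (κ / 8))) :
    ∀ᶠ κ in atTop, Dissociated n (dyadicBulk n κ) (r κ) (2 ^ (8 * κ)) := by
  obtain ⟨N₀, h⟩ := hA.dissociated_bulk hn_pos
  -- For `κ ≥ 8` one has `κ ≤ 16 ⌊κ / 8⌋`, so `ω ≥ 128 = 8 * 16` makes the exponent `⌊κ / 8⌋ ω` at
  -- least `8 κ`.
  have hω := (hω_lim.comp tendsto_two_pow_div).eventually_ge_atTop 128
  filter_upwards [hr, tendsto_two_pow_div.eventually_ge_atTop N₀, hω, eventually_ge_atTop 8] with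
    κ h1 h2 h3 h4
  refine h _ h2 _ _ _ h1 ?_
  simp only [Function.comp_apply] at h3
  have h5 : (8 * κ : ℝ) ≤ (κ / 8 : ℕ) * ω (2 ^ (κ / 8)) := by
    have h6 : κ ≤ 16 * (κ / 8) := by omega
    have h7 : (κ : ℝ) ≤ 16 * (κ / 8 : ℕ) := by exact_mod_cast h6
    nlinarith [Nat.cast_nonneg (α := ℝ) (κ / 8)]
  push_cast
  rw [← Real.rpow_natCast, ← Real.rpow_natCast, ← Real.rpow_mul (by norm_num)]
  refine Real.rpow_le_rpow_of_exponent_le (by norm_num) ?_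
  exact_mod_cast h5

lemma isAmongSmallest_comp {n σ : ℕ → ℕ} (hσ : Set.BijOn σ (Set.Ici 1) (Set.Ici 1)) (N m : ℕ) :
    IsAmongSmallest (n ∘ σ) N m ↔ IsAmongSmallest n N m := by
  simp only [IsAmongSmallest, Set.image_comp, hσ.image_eq]

/-- Being among the `N` smallest depends only on the set of values. A relation for `n ∘ σ` on `S` is
a relation for `n` on `σ '' S`, with coefficients carried over by the inverse of `σ` on `S`. -/
lemma ConditionA.comp {ω : ℕ → ℝ} {n σ : ℕ → ℕ} (hA : ConditionA ω n)
    (hσ : Set.BijOn σ (Set.Ici 1) (Set.Ici 1)) : ConditionA ω (n ∘ σ) := by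
  classical
  obtain ⟨N₀, h⟩ := hA
  refine ⟨N₀, fun N hN1 hN S a hS h2 hc ha hs k hk ↦ ?_⟩
  have hinj : Set.InjOn σ (S : Set ℕ) := hσ.injOn.mono fun x hx ↦ hS x hx
  have hinv : ∀ k ∈ S, Function.invFunOn σ (S : Set ℕ) (σ k) = k := fun k hk ↦
    hinj.leftInvOn_invFunOn hk
  have key := h N hN1 hN (S.image σ) (fun j ↦ a (Function.invFunOn σ (S : Set ℕ) j)) ?_ ?_ ?_ ?_ ?_
    (σ k) (Finset.mem_image_of_mem _ hk)
  · exact (isAmongSmallest_comp hσ _ _).2 key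
  · simp only [Finset.forall_mem_image]
    exact fun x hx ↦ hσ.mapsTo (hS x hx)
  · rwa [Finset.card_image_of_injOn hinj]
  · rwa [Finset.card_image_of_injOn hinj]
  · simp only [Finset.forall_mem_image]
    intro x hx
    rw [hinv x hx]
    exact ha x hx
  · rw [Finset.sum_image hinj, ← hs]
    exact Finset.sum_congr rfl fun x hx ↦ by rw [hinv x hx]; rfl

/-- The logarithm of `2 ^ (κ / 8)` is of order `κ`, and any positive power of `κ` dominates `A * log
κ`. This is the only place where the growth hypothesis on `ω` is used. -/
lemma eventually_mul_log_le_of_log_rpow_le {ω : ℕ → ℝ} {α : ℝ} (hα : 0 < α) {k₀ : ℕ}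
    (h : ∀ k : ℕ, 1 ≤ k → k₀ ≤ k → Real.log (k : ℝ) ^ α ≤ ω k) (A : ℝ) :
    ∀ᶠ κ : ℕ in atTop, A * Real.log κ ≤ ω (2 ^ (κ / 8)) := by
  have hlim : Tendsto (fun κ : ℕ ↦ ((κ / 8 : ℕ) : ℝ) * Real.log 2) atTop atTop :=
    (tendsto_natCast_atTop_atTop.comp (Nat.tendsto_div_const_atTop (by norm_num))).atTop_mul_const
      (Real.log_pos (by norm_num))
  -- The factor `2` in the constant pays for the comparison `log κ ≤ 2 log (⌊κ / 8⌋ log 2)` that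
  -- follows.
  have hlo := (isLittleO_log_rpow_atTop hα).bound (c := (2 * (|A| + 1))⁻¹) (by positivity)
  have h16 : ∀ᶠ κ : ℕ in atTop, Real.log κ ≤ 2 * Real.log (((κ / 8 : ℕ) : ℝ) * Real.log 2) := by
    filter_upwards [eventually_ge_atTop 4000] with κ hκ
    have h1 : κ ≤ 9 * (κ / 8) := by omega
    have h2 : (κ : ℝ) ≤ 9 * (κ / 8 : ℕ) := by exact_mod_cast h1
    have h3 : (500 : ℝ) ≤ (κ / 8 : ℕ) := by
      have : 500 ≤ κ / 8 := by omega
      exact_mod_cast this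
    have h4 := Real.log_two_gt_d9
    rw [← Real.log_rpow (by positivity)]
    refine Real.log_le_log (by positivity) (h2.trans ?_)
    rw [Real.rpow_two, mul_pow]
    have : (1/4 : ℝ) ≤ Real.log 2 ^ 2 := by nlinarith
    nlinarith
  filter_upwards [hlim.eventually hlo, h16, tendsto_two_pow_div.eventually_ge_atTop k₀,
    hlim.eventually_ge_atTop 1] with κ h1 h2 h3 h5
  refine le_trans ?_ (h _ Nat.one_le_two_pow h3)
  push_cast
  rw [Real.log_pow]
  have hl := Real.log_nonneg h5
  rw [Real.norm_of_nonneg hl, Real.norm_of_nonneg (by positivity), inv_mul_eq_div,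
    le_div_iff₀ (by positivity)] at h1
  have h0 : 0 ≤ Real.log (κ : ℝ) := Real.log_natCast_nonneg κ
  nlinarith [le_abs_self A, abs_nonneg A]

/-! ### Characters, trigonometric polynomials and factorisation of moments -/

/-- Lebesgue measure on the unit interval, as a measure on the real line. -/
noncomputable def unitMeasure : Measure ℝ := volume.restrict (Ioc 0 1)

instance : IsProbabilityMeasure unitMeasure := ⟨by simp [unitMeasure]⟩

lemma integral_unitMeasure {E : Type*} [NormedAddCommGroup E] [NormedSpace ℝ E] (f : ℝ → E) :
    ∫ x, f x ∂unitMeasure = ∫ x in (0 : ℝ)..1, f x := by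
  rw [unitMeasure, intervalIntegral.integral_of_le zero_le_one]

/-- The character `x ↦ exp (2 π i m x)`. -/
noncomputable def expChar (m : ℤ) (x : ℝ) : ℂ := Complex.exp (2 * Real.pi * Complex.I * m * x)

lemma expChar_zero : expChar 0 = 1 := by
  ext x
  simp [expChar]

lemma expChar_add (m m' : ℤ) : expChar (m + m') = expChar m * expChar m' := by
  ext x
  simp only [expChar, Pi.mul_apply, ← Complex.exp_add]
  congr 1
  push_cast
  ring

lemma expChar_mul_natCast (m : ℤ) (k : ℕ) (x : ℝ) :
    expChar m ((k : ℝ) * x) = expChar (m * k) x := by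
  simp only [expChar]
  congr 1
  push_cast
  ring

lemma expChar_sum {ι : Type*} (s : Finset ι) (m : ι → ℤ) (x : ℝ) :
    expChar (∑ i ∈ s, m i) x = ∏ i ∈ s, expChar (m i) x := by
  simp only [expChar, ← Complex.exp_sum]
  congr 1
  push_cast
  rw [Finset.mul_sum, Finset.sum_mul]

lemma continuous_expChar (m : ℤ) : Continuous (expChar m) := by
  unfold expChar
  fun_prop

lemma integral_expChar (m : ℤ) : ∫ x, expChar m x ∂unitMeasure = if m = 0 then 1 else 0 := by
  split_ifs with hm
  · simp [hm, expChar_zero]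
  · rw [integral_unitMeasure]
    simp only [expChar]
    have hc : (2 * Real.pi * Complex.I * m : ℂ) ≠ 0 := by
      simp [Complex.I_ne_zero, Real.pi_ne_zero, hm]
    rw [integral_exp_mul_complex hc]
    have : Complex.exp (2 * Real.pi * Complex.I * m) = 1 := by
      rw [Complex.exp_eq_one_iff]
      exact ⟨m, by ring⟩
    simp [this]

/-- Trigonometric polynomials of degree at most `D`. -/
noncomputable def trigPoly (D : ℕ) : Submodule ℂ (ℝ → ℂ) :=
  Submodule.span ℂ (expChar '' {m | |m| ≤ (D : ℤ)})

lemma expChar_mem_trigPoly {D : ℕ} {m : ℤ} (h : |m| ≤ D) : expChar m ∈ trigPoly D :=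
  Submodule.subset_span ⟨m, h, rfl⟩

lemma trigPoly_mono {D E : ℕ} (h : D ≤ E) : trigPoly D ≤ trigPoly E := by
  refine Submodule.span_mono (Set.image_mono fun m hm ↦ ?_)
  have hm' : |m| ≤ (D : ℤ) := hm
  exact hm'.trans (by exact_mod_cast h)

lemma mul_mem_trigPoly {D E : ℕ} {g h : ℝ → ℂ} (hg : g ∈ trigPoly D) (hh : h ∈ trigPoly E) :
    g * h ∈ trigPoly (D + E) := by
  have := Submodule.mul_mem_mul hg hh
  rw [trigPoly, trigPoly, Submodule.span_mul_span] at this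
  refine Submodule.span_mono ?_ this
  rintro _ ⟨_, ⟨m, hm, rfl⟩, _, ⟨m', hm', rfl⟩, rfl⟩
  refine ⟨m + m', ?_, expChar_add m m'⟩
  refine (abs_add_le m m').trans ?_
  push_cast
  exact add_le_add hm hm'

lemma one_mem_trigPoly (D : ℕ) : (1 : ℝ → ℂ) ∈ trigPoly D := by
  rw [← expChar_zero]
  exact expChar_mem_trigPoly (by simp)

lemma pow_mem_trigPoly {D : ℕ} {g : ℝ → ℂ} (hg : g ∈ trigPoly D) (k : ℕ) :
    g ^ k ∈ trigPoly (k * D) := by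
  induction k with
  | zero => simpa using one_mem_trigPoly 0
  | succ k ih =>
    rw [pow_succ, Nat.succ_mul]
    exact mul_mem_trigPoly ih hg

lemma exists_coeff_of_mem_trigPoly {D : ℕ} {g : ℝ → ℂ} (hg : g ∈ trigPoly D) :
    ∃ c : ℤ → ℂ, ∀ x, g x = ∑ m ∈ Finset.Icc (-(D : ℤ)) D, c m * expChar m x := by
  induction hg using Submodule.span_induction with
  | mem g hg =>
    obtain ⟨m, hm, rfl⟩ := hg
    refine ⟨fun k ↦ if k = m then 1 else 0, fun x ↦ ?_⟩
    have : m ∈ Finset.Icc (-(D : ℤ)) D := Finset.mem_Icc.2 (abs_le.1 hm)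
    simp [ite_mul, Finset.sum_ite_eq', -Finset.mem_Icc, this]
  | zero => exact ⟨0, by simp⟩
  | add g h _ _ ihg ihh =>
    obtain ⟨c, hc⟩ := ihg
    obtain ⟨d, hd⟩ := ihh
    exact ⟨c + d, fun x ↦ by simp [hc, hd, add_mul, Finset.sum_add_distrib]⟩
  | smul a g _ ih =>
    obtain ⟨c, hc⟩ := ih
    exact ⟨a • c, fun x ↦ by simp [hc, Finset.mul_sum, mul_assoc]⟩

lemma continuous_of_mem_trigPoly {D : ℕ} {g : ℝ → ℂ} (hg : g ∈ trigPoly D) : Continuous g := by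
  obtain ⟨c, hc⟩ := exists_coeff_of_mem_trigPoly hg
  rw [show g = _ from funext hc]
  exact continuous_finsetSum _ fun m _ ↦ continuous_const.mul (continuous_expChar m)

lemma integrable_unitMeasure_of_continuous {E : Type*} [NormedAddCommGroup E] {g : ℝ → E}
    (hg : Continuous g) : Integrable g unitMeasure :=
  (hg.integrableOn_Icc (a := 0) (b := 1)).mono_set Ioc_subset_Icc_self

lemma integral_sum_coeff (D : ℕ) (c : ℤ → ℂ) :
    ∫ x, ∑ m ∈ Finset.Icc (-(D : ℤ)) D, c m * expChar m x ∂unitMeasure = c 0 := by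
  rw [integral_finsetSum _ fun m _ ↦ integrable_unitMeasure_of_continuous (by
    have := continuous_expChar m
    fun_prop)]
  simp_rw [integral_const_mul, integral_expChar]
  simp

/-- Expand the product into characters of frequency `∑ φ i * n i`. Only frequency zero has a nonzero
integral, and dissociation leaves `φ = 0` alone, which contributes the product of the constant
coefficients, that is, of the means. -/
lemma Dissociated.integral_prod_of_card_le {n : ℕ → ℕ} {I : Finset ℕ} {r Q : ℕ}
    (h : Dissociated n I r Q) (hI : I.card ≤ r) (q : ℕ → ℝ → ℂ) (hq : ∀ i ∈ I, q i ∈ trigPoly Q) :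
    ∫ x, ∏ i ∈ I, q i ((n i : ℝ) * x) ∂unitMeasure = ∏ i ∈ I, ∫ x, q i x ∂unitMeasure := by
  classical
  choose! c hc using fun i (hi : i ∈ I) ↦ exists_coeff_of_mem_trigPoly (hq i hi)
  have h1 : ∀ x : ℝ, ∏ i ∈ I, q i ((n i : ℝ) * x) =
      ∑ φ ∈ I.pi fun _ ↦ Finset.Icc (-(Q : ℤ)) Q,
        (∏ i ∈ I.attach, c i (φ i i.2)) * expChar (∑ i ∈ I.attach, φ i i.2 * (n i : ℤ)) x := by
    intro x
    rw [Finset.prod_congr rfl fun i hi ↦ hc i hi _, Finset.prod_sum]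
    refine Finset.sum_congr rfl fun φ _ ↦ ?_
    rw [Finset.prod_mul_distrib, expChar_sum]
    simp only [expChar_mul_natCast]
  have h2 : ∀ φ ∈ I.pi fun _ ↦ Finset.Icc (-(Q : ℤ)) Q,
      ∑ i ∈ I.attach, φ i i.2 * (n i : ℤ) = 0 ↔ φ = fun _ _ ↦ 0 := by
    intro φ hφ
    constructor
    · intro hs
      have := h (fun i ↦ if hi : i ∈ I then φ i hi else 0) ?_
        ((Finset.card_filter_le _ _).trans hI) ?_
      · funext i hi
        simpa [hi] using this i hi
      · intro i hi
        have := Finset.mem_Icc.1 (Finset.mem_pi.1 hφ i hi)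
        simpa [hi] using abs_le.2 this
      · rw [← hs, ← Finset.sum_attach]
        exact Finset.sum_congr rfl fun i _ ↦ by simp
    · rintro rfl
      simp
  have h0 : (fun _ _ ↦ 0 : ∀ i ∈ I, ℤ) ∈ I.pi fun _ ↦ Finset.Icc (-(Q : ℤ)) Q := by
    simp
  simp_rw [h1]
  rw [integral_finsetSum _ fun φ _ ↦ integrable_unitMeasure_of_continuous (by
    have := continuous_expChar (∑ i ∈ I.attach, φ i i.2 * (n i : ℤ))
    fun_prop)]
  simp_rw [integral_const_mul, integral_expChar]
  rw [Finset.sum_eq_single_of_mem _ h0]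
  · simp only [zero_mul, Finset.sum_const_zero, if_true, mul_one]
    rw [Finset.prod_attach I fun i ↦ c i 0]
    refine Finset.prod_congr rfl fun i hi ↦ ?_
    simp_rw [hc i hi]
    rw [integral_sum_coeff]
  · intro φ hφ hne
    rw [if_neg fun h ↦ hne ((h2 φ hφ).1 h), mul_zero]

/-- Factors equal to `1` do not count towards the order, so `I` may be arbitrarily large as long as
at most `r` factors are nontrivial. -/
lemma Dissociated.integral_prod {n : ℕ → ℕ} {I : Finset ℕ} {r Q : ℕ}
    (h : Dissociated n I r Q) (q : ℕ → ℝ → ℂ) (hq : ∀ i ∈ I, q i ∈ trigPoly Q) (S : Finset ℕ)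
    (hS : S.card ≤ r) (hqS : ∀ i ∈ I, i ∉ S → q i = 1) :
    ∫ x, ∏ i ∈ I, q i ((n i : ℝ) * x) ∂unitMeasure = ∏ i ∈ I, ∫ x, q i x ∂unitMeasure := by
  classical
  have h1 : ∀ x : ℝ, ∏ i ∈ I ∩ S, q i ((n i : ℝ) * x) = ∏ i ∈ I, q i ((n i : ℝ) * x) := by
    refine fun x ↦ Finset.prod_subset Finset.inter_subset_left fun i hi hi' ↦ ?_
    rw [hqS i hi fun h ↦ hi' (Finset.mem_inter.2 ⟨hi, h⟩)]
    rfl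
  have h2 : ∏ i ∈ I ∩ S, ∫ x, q i x ∂unitMeasure = ∏ i ∈ I, ∫ x, q i x ∂unitMeasure := by
    refine Finset.prod_subset Finset.inter_subset_left fun i hi hi' ↦ ?_
    rw [hqS i hi fun h ↦ hi' (Finset.mem_inter.2 ⟨hi, h⟩)]
    simp
  simp_rw [← h1, ← h2]
  exact (h.mono Finset.inter_subset_left le_rfl le_rfl).integral_prod_of_card_le
    ((Finset.card_le_card Finset.inter_subset_right).trans hS) q
    fun i hi ↦ hq i (Finset.mem_inter.1 hi).1

/-- The joint law of independent uniform variables indexed by `I`. -/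
noncomputable def cubeMeasure (I : Finset ℕ) : Measure (I → ℝ) := Measure.pi fun _ ↦ unitMeasure

instance (I : Finset ℕ) : IsProbabilityMeasure (cubeMeasure I) := by
  unfold cubeMeasure
  infer_instance

/-- The weighted sum `∑ w i * p (n i * x)`. -/
noncomputable def weightedSum (n : ℕ → ℕ) (I : Finset ℕ) (w : ℕ → ℝ) (p : ℝ → ℝ) (x : ℝ) : ℝ :=
  ∑ i ∈ I, w i * p ((n i : ℝ) * x)

/-- The weighted sum `∑ w i * p (u i)` on the cube. -/
noncomputable def cubeSum (I : Finset ℕ) (w : ℕ → ℝ) (p : ℝ → ℝ) (u : I → ℝ) : ℝ :=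
  ∑ i : I, w i * p (u i)

lemma continuous_weightedSum (n : ℕ → ℕ) (I : Finset ℕ) (w : ℕ → ℝ) {p : ℝ → ℝ}
    (hp : Continuous p) : Continuous (weightedSum n I w p) := by
  unfold weightedSum
  fun_prop

lemma continuous_cubeSum (I : Finset ℕ) (w : ℕ → ℝ) {p : ℝ → ℝ} (hp : Continuous p) :
    Continuous (cubeSum I w p) := by
  unfold cubeSum
  fun_prop

lemma integrable_of_continuous_of_bound {α : Type*} [TopologicalSpace α] [MeasurableSpace α]
    [OpensMeasurableSpace α] {E : Type*} [NormedAddCommGroup E] [SecondCountableTopology E]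
    [MeasurableSpace E] [BorelSpace E]
    {μ : Measure α} [IsFiniteMeasure μ] {g : α → E} (hg : Continuous g) (C : ℝ)
    (h : ∀ x, ‖g x‖ ≤ C) : Integrable g μ :=
  Integrable.of_bound hg.measurable.aestronglyMeasurable C (Eventually.of_forall h)

lemma abs_cubeSum_le (I : Finset ℕ) (w : ℕ → ℝ) {p : ℝ → ℝ} {B : ℝ}
    (hB : ∀ x, |p x| ≤ B) (u : I → ℝ) : |cubeSum I w p u| ≤ ∑ i ∈ I, |w i| * B := by
  rw [← Finset.sum_coe_sort]
  refine (Finset.abs_sum_le_sum_abs _ _).trans (Finset.sum_le_sum fun i _ ↦ ?_)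
  rw [abs_mul]
  exact mul_le_mul_of_nonneg_left (hB _) (abs_nonneg _)

/-- By the multinomial theorem the power is a sum of monomials, each involving at most `m` different
indices through powers of `p` of degree at most `m * D`. Every monomial factorises on the circle by
dissociation and on the cube by independence, with the same factors. -/
lemma Dissociated.integral_weightedSum_pow {n : ℕ → ℕ} {I : Finset ℕ} {r Q D m : ℕ}
    (h : Dissociated n I r Q) (w : ℕ → ℝ) {p : ℝ → ℝ} (hp : (fun x ↦ (p x : ℂ)) ∈ trigPoly D)
    (hm : m ≤ r) (hQ : m * D ≤ Q) :
    ∫ x, weightedSum n I w p x ^ m ∂unitMeasure = ∫ u, cubeSum I w p u ^ m ∂cubeMeasure I := by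
  classical
  have hpc : Continuous p := by
    have := Complex.continuous_re.comp (continuous_of_mem_trigPoly hp)
    exact this
  have hpc' : Continuous fun x ↦ (p x : ℂ) := continuous_of_mem_trigPoly hp
  obtain ⟨B, hB⟩ : ∃ B, ∀ x, |p x| ≤ B := by
    obtain ⟨c, hc⟩ := exists_coeff_of_mem_trigPoly hp
    refine ⟨∑ m ∈ Finset.Icc (-(D : ℤ)) D, ‖c m‖, fun x ↦ ?_⟩
    rw [← Real.norm_eq_abs, ← Complex.norm_real, hc]
    refine (norm_sum_le _ _).trans (Finset.sum_le_sum fun m _ ↦ ?_)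
    rw [norm_mul, expChar, show (2 * Real.pi * Complex.I * m * x : ℂ) =
      ((2 * Real.pi * m * x : ℝ) : ℂ) * Complex.I by push_cast; ring, Complex.norm_exp_ofReal_mul_I,
      mul_one]
  have hL : ∀ x : ℝ, ((weightedSum n I w p x ^ m : ℝ) : ℂ) =
      ∑ k ∈ I.piAntidiag m, ((Nat.multinomial I k * ∏ i ∈ I, w i ^ k i : ℝ) : ℂ) *
        ∏ i ∈ I, (fun y ↦ (p y : ℂ) ^ k i) ((n i : ℝ) * x) := by
    intro x
    rw [weightedSum, Finset.sum_pow_eq_sum_piAntidiag]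
    push_cast
    refine Finset.sum_congr rfl fun k _ ↦ ?_
    rw [mul_assoc, ← Finset.prod_mul_distrib]
    simp_rw [mul_pow]
  have hR : ∀ u : I → ℝ, ((cubeSum I w p u ^ m : ℝ) : ℂ) =
      ∑ k ∈ I.piAntidiag m, ((Nat.multinomial I k * ∏ i ∈ I, w i ^ k i : ℝ) : ℂ) *
        ∏ i : I, (fun y ↦ (p y : ℂ) ^ k i) (u i) := by
    intro u
    have : cubeSum I w p u = ∑ i ∈ I, w i * p (if hi : i ∈ I then u ⟨i, hi⟩ else 0) := by
      rw [← Finset.sum_coe_sort, cubeSum]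
      exact Finset.sum_congr rfl fun i _ ↦ by simp
    rw [this, Finset.sum_pow_eq_sum_piAntidiag]
    push_cast
    refine Finset.sum_congr rfl fun k _ ↦ ?_
    rw [mul_assoc]
    congr 1
    have h1 : ∏ i : I, (p (u i) : ℂ) ^ k i =
        ∏ i ∈ I, (p (if hi : i ∈ I then u ⟨i, hi⟩ else 0) : ℂ) ^ k i := by
      rw [← Finset.prod_coe_sort I fun i ↦ (p (if hi : i ∈ I then u ⟨i, hi⟩ else 0) : ℂ) ^ k i]
      exact Finset.prod_congr rfl fun i _ ↦ by simp
    rw [h1, ← Finset.prod_mul_distrib]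
    simp_rw [mul_pow]
  apply Complex.ofReal_injective
  rw [← integral_complex_ofReal, ← integral_complex_ofReal]
  simp_rw [hL, hR]
  rw [integral_finsetSum, integral_finsetSum]
  · refine Finset.sum_congr rfl fun k hk ↦ ?_
    obtain ⟨hk1, hk2⟩ := Finset.mem_piAntidiag.1 hk
    have hkm : ∀ i ∈ I, k i ≤ m := fun i hi ↦ by
      rw [← hk1]
      exact Finset.single_le_sum (f := k) (fun _ _ ↦ Nat.zero_le _) hi
    rw [integral_const_mul, integral_const_mul]
    congr 1
    rw [h.integral_prod (fun i y ↦ (p y : ℂ) ^ k i) ?_ (I.filter fun i ↦ k i ≠ 0) ?_ ?_]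
    · rw [cubeMeasure, integral_fintype_prod_eq_prod (fun (i : I) (y : ℝ) ↦ (p y : ℂ) ^ k i),
        ← Finset.prod_coe_sort]
    · intro i hi
      refine trigPoly_mono ?_ (pow_mem_trigPoly hp (k i))
      exact (Nat.mul_le_mul_right D (hkm i hi)).trans hQ
    · refine le_trans ?_ hm
      rw [← hk1, Finset.card_eq_sum_ones, ← Finset.sum_filter_ne_zero (s := I) (f := k)]
      exact Finset.sum_le_sum fun i hi ↦ Nat.one_le_iff_ne_zero.2 (Finset.mem_filter.1 hi).2
    · intro i hi hi'
      have : k i = 0 := by simpa [hi] using hi'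
      funext y
      simp [this]
  · intro k _
    refine integrable_of_continuous_of_bound (by fun_prop)
      (‖((Nat.multinomial I k * ∏ i ∈ I, w i ^ k i : ℝ) : ℂ)‖ * ∏ i : I, B ^ k i) fun u ↦ ?_
    rw [norm_mul, norm_prod]
    refine mul_le_mul_of_nonneg_left (Finset.prod_le_prod (fun _ _ ↦ norm_nonneg _) fun i _ ↦ ?_)
      (norm_nonneg _)
    rw [norm_pow, Complex.norm_real]
    exact pow_le_pow_left₀ (norm_nonneg _) (hB _) _
  · intro k _
    exact integrable_unitMeasure_of_continuous (by fun_prop)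

/-! ### Approximation of functions of bounded variation by trigonometric polynomials -/

/-- Lebesgue measure on `(-1/2, 1/2]`. -/
noncomputable def centeredMeasure : Measure ℝ := volume.restrict (Ioc (-1 / 2) (1 / 2))

instance : IsProbabilityMeasure centeredMeasure := ⟨by
  simp only [centeredMeasure, Measure.restrict_apply_univ, Real.volume_Ioc]
  norm_num⟩

lemma integral_centeredMeasure {E : Type*} [NormedAddCommGroup E] [NormedSpace ℝ E] (f : ℝ → E) :
    ∫ x, f x ∂centeredMeasure = ∫ x in (-1 / 2 : ℝ)..(1 / 2), f x := by
  rw [centeredMeasure, intervalIntegral.integral_of_le (by norm_num)]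

lemma integral_unitMeasure_eq_shift {E : Type*} [NormedAddCommGroup E] [NormedSpace ℝ E] {f : ℝ → E}
    (hf : Function.Periodic f 1) (x : ℝ) :
    ∫ y, f y ∂unitMeasure = ∫ t, f (x + t) ∂centeredMeasure := by
  rw [integral_unitMeasure, integral_centeredMeasure, intervalIntegral.integral_comp_add_left]
  have := hf.intervalIntegral_add_eq 0 (x + (-1 / 2))
  rw [zero_add] at this
  rw [this]
  congr 1
  ring

/-- The integral of the kernel `t ↦ cos (π t) ^ (2 l)` over a period. -/
noncomputable def cosMass (l : ℕ) : ℝ := ∫ t, Real.cos (Real.pi * t) ^ (2 * l) ∂centeredMeasure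

lemma integrable_centeredMeasure_of_continuous {g : ℝ → ℝ} (hg : Continuous g) :
    Integrable g centeredMeasure :=
  (hg.integrableOn_Icc (a := -1 / 2) (b := 1 / 2)).mono_set Ioc_subset_Icc_self

lemma cosMass_pos (l : ℕ) : 0 < cosMass l := by
  rw [cosMass, integral_centeredMeasure]
  refine intervalIntegral.integral_pos (by norm_num) (by fun_prop) (fun x _ ↦ ?_)
    ⟨0, by norm_num, by simp⟩
  exact Even.pow_nonneg (even_two_mul l) _

lemma cosMass_eq (l : ℕ) : cosMass l =
    Real.pi⁻¹ * ∫ t in (-(Real.pi / 2))..(Real.pi / 2), Real.cos t ^ (2 * l) := by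
  rw [cosMass, integral_centeredMeasure,
    intervalIntegral.integral_comp_mul_left (fun t ↦ Real.cos t ^ (2 * l)) Real.pi_ne_zero,
    smul_eq_mul]
  congr 2 <;> ring

lemma cosMass_succ (l : ℕ) : cosMass (l + 1) = (2 * l + 1) / (2 * l + 2) * cosMass l := by
  rw [cosMass_eq, cosMass_eq, mul_add, mul_one, integral_cos_pow]
  simp
  ring

lemma integral_sin_sq_mul_cos_pow (l : ℕ) :
    ∫ t, Real.sin (Real.pi * t) ^ 2 * Real.cos (Real.pi * t) ^ (2 * l) ∂centeredMeasure =
      cosMass l / (2 * l + 2) := by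
  have h : ∀ t : ℝ, Real.sin (Real.pi * t) ^ 2 * Real.cos (Real.pi * t) ^ (2 * l) =
      Real.cos (Real.pi * t) ^ (2 * l) - Real.cos (Real.pi * t) ^ (2 * (l + 1)) := by
    intro t
    rw [Real.sin_sq]
    ring
  simp_rw [h]
  rw [integral_sub (integrable_centeredMeasure_of_continuous (by fun_prop))
    (integrable_centeredMeasure_of_continuous (by fun_prop))]
  change cosMass l - cosMass (l + 1) = _
  rw [cosMass_succ]
  field_simp
  ring

lemma ae_centeredMeasure_abs_le : ∀ᵐ t ∂centeredMeasure, |t| ≤ 1 / 2 := by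
  filter_upwards [ae_restrict_mem measurableSet_Ioc] with t ht
  exact abs_le.2 ⟨by linarith [ht.1], ht.2⟩

/-- The first absolute moment of the kernel is reduced to a second moment by `|t| ≤ √l / 2 * t ^ 2 +
1 / (2 √l)`. Since `2 |t| ≤ |sin (π t)|` on the half period, the second moment is controlled by `∫
sin² cos^(2l)`, which is explicit. -/
lemma integral_abs_mul_cos_pow_le {l : ℕ} (hl : 1 ≤ l) :
    ∫ t, |t| * Real.cos (Real.pi * t) ^ (2 * l) ∂centeredMeasure ≤ cosMass l / √l := by
  have hs : 0 < √(l : ℝ) := Real.sqrt_pos.2 (by exact_mod_cast hl)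
  have hss : √(l : ℝ) * √l = l := Real.mul_self_sqrt (Nat.cast_nonneg l)
  have h1 : ∫ t, |t| * Real.cos (Real.pi * t) ^ (2 * l) ∂centeredMeasure ≤
      ∫ t, (√l / 8 * (Real.sin (Real.pi * t) ^ 2 * Real.cos (Real.pi * t) ^ (2 * l)) +
        (2 * √l)⁻¹ * Real.cos (Real.pi * t) ^ (2 * l)) ∂centeredMeasure := by
    refine integral_mono_ae (integrable_centeredMeasure_of_continuous (by fun_prop))
      (integrable_centeredMeasure_of_continuous (by fun_prop)) ?_
    filter_upwards [ae_centeredMeasure_abs_le] with t ht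
    have hc : 0 ≤ Real.cos (Real.pi * t) ^ (2 * l) := Even.pow_nonneg (even_two_mul l) _
    have hsin : 2 * |t| ≤ |Real.sin (Real.pi * t)| := by
      have := Real.mul_abs_le_abs_sin (x := Real.pi * t) (by
        rw [abs_mul, abs_of_pos Real.pi_pos]; nlinarith [Real.pi_pos])
      rw [abs_mul, abs_of_pos Real.pi_pos] at this
      calc 2 * |t| = 2 / Real.pi * (Real.pi * |t|) := by field_simp
        _ ≤ _ := this
    have hsq : 4 * |t| ^ 2 ≤ Real.sin (Real.pi * t) ^ 2 := by
      rw [← sq_abs (Real.sin _)]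
      nlinarith [abs_nonneg t]
    have : |t| ≤ √l / 8 * Real.sin (Real.pi * t) ^ 2 + (2 * √l)⁻¹ := by
      have h2 : |t| ≤ √l / 2 * |t| ^ 2 + (2 * √l)⁻¹ := by
        have : √l / 2 * |t| ^ 2 + (2 * √l)⁻¹ - |t| = (√l * |t| - 1) ^ 2 / (2 * √l) := by
          field_simp
          ring
        have : 0 ≤ (√l * |t| - 1) ^ 2 / (2 * √l) := by positivity
        linarith
      nlinarith
    calc |t| * Real.cos (Real.pi * t) ^ (2 * l)
        ≤ (√l / 8 * Real.sin (Real.pi * t) ^ 2 + (2 * √l)⁻¹) * Real.cos (Real.pi * t) ^ (2 * l) :=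
          mul_le_mul_of_nonneg_right this hc
      _ = _ := by ring
  refine h1.trans ?_
  rw [integral_add (integrable_centeredMeasure_of_continuous (by fun_prop))
    (integrable_centeredMeasure_of_continuous (by fun_prop)), integral_const_mul,
    integral_const_mul, integral_sin_sq_mul_cos_pow]
  change √l / 8 * (cosMass l / (2 * l + 2)) + (2 * √l)⁻¹ * cosMass l ≤ _
  have hpos := cosMass_pos l
  have h3 : √(l : ℝ) / 8 * (cosMass l / (2 * l + 2)) ≤ (2 * √l)⁻¹ * cosMass l := by
    have : √(l : ℝ) / 8 / (2 * l + 2) ≤ (2 * √l)⁻¹ := by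
      rw [div_div, ← one_div, div_le_div_iff₀ (by positivity) (by positivity)]
      nlinarith
    calc _ = √(l : ℝ) / 8 / (2 * l + 2) * cosMass l := by ring
      _ ≤ _ := mul_le_mul_of_nonneg_right this hpos.le
  calc _ ≤ (2 * √l)⁻¹ * cosMass l + (2 * √l)⁻¹ * cosMass l := by linarith
    _ = _ := by field_simp; ring

/-- For monotone `P` the difference has constant sign, so the absolute value can be dropped. The two
integrals then cancel except on two end intervals of length `|t|`. -/
lemma MonotoneOn.integral_abs_shift_sub_le {P : ℝ → ℝ} (hP : MonotoneOn P (Icc (-1) 2)) {t : ℝ}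
    (ht : |t| ≤ 1 / 2) :
    ∫ x, |P (x + t) - P x| ∂unitMeasure ≤ |t| * (P 2 - P (-1)) := by
  obtain ⟨ht1, ht2⟩ := abs_le.1 ht
  have hint : ∀ a b : ℝ, a ∈ Icc (-1 : ℝ) 2 → b ∈ Icc (-1 : ℝ) 2 → IntervalIntegrable P volume a b :=
    fun a b ha hb ↦ (hP.mono (ordConnected_Icc.uIcc_subset ha hb)).intervalIntegrable
  have hshift : ∫ x in (0 : ℝ)..1, P (x + t) = ∫ x in t..(1 + t), P x := by
    rw [intervalIntegral.integral_comp_add_right, zero_add]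
  have hint' : IntervalIntegrable (fun x ↦ P (x + t)) volume 0 1 := by
    have := (hint t (1 + t) ⟨by linarith, by linarith⟩ ⟨by linarith, by linarith⟩).comp_add_right t
    simpa using this
  have h01 : IntervalIntegrable P volume 0 1 := hint 0 1 (by norm_num) (by norm_num)
  have hkey : ∫ x in (0 : ℝ)..1, (P (x + t) - P x) =
      (∫ x in (1 : ℝ)..(1 + t), P x) - ∫ x in (0 : ℝ)..t, P x := by
    rw [intervalIntegral.integral_sub hint' h01, hshift]
    have e1 := intervalIntegral.integral_add_adjacent_intervals
      (hint 0 t (by norm_num) ⟨by linarith, by linarith⟩)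
      (hint t (1 + t) ⟨by linarith, by linarith⟩ ⟨by linarith, by linarith⟩)
    have e2 := intervalIntegral.integral_add_adjacent_intervals h01
      (hint 1 (1 + t) (by norm_num) ⟨by linarith, by linarith⟩)
    linarith
  have hub : ∀ x ∈ Icc (-1 : ℝ) 2, P x ≤ P 2 := fun x hx ↦ hP hx (by norm_num) hx.2
  have hlb : ∀ x ∈ Icc (-1 : ℝ) 2, P (-1) ≤ P x := fun x hx ↦ hP (by norm_num) hx hx.1
  have hbd : ∀ a b : ℝ, a ≤ b → a ∈ Icc (-1 : ℝ) 2 → b ∈ Icc (-1 : ℝ) 2 →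
      (b - a) * P (-1) ≤ ∫ x in a..b, P x ∧ ∫ x in a..b, P x ≤ (b - a) * P 2 := by
    intro a b hab ha hb
    constructor
    · have := intervalIntegral.integral_mono_on hab intervalIntegrable_const (hint a b ha hb)
        fun x hx ↦ hlb x ⟨ha.1.trans hx.1, hx.2.trans hb.2⟩
      simpa using this
    · have := intervalIntegral.integral_mono_on hab (hint a b ha hb) intervalIntegrable_const
        fun x hx ↦ hub x ⟨ha.1.trans hx.1, hx.2.trans hb.2⟩
      simpa using this
  rw [integral_unitMeasure]
  rcases le_total 0 t with h0 | h0
  · have : ∫ x in (0 : ℝ)..1, |P (x + t) - P x| = ∫ x in (0 : ℝ)..1, (P (x + t) - P x) := by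
      refine intervalIntegral.integral_congr fun x hx ↦ abs_of_nonneg ?_
      rw [uIcc_of_le zero_le_one] at hx
      exact sub_nonneg.2 (hP ⟨by linarith [hx.1], by linarith [hx.2]⟩
        ⟨by linarith [hx.1], by linarith [hx.2]⟩ (by linarith))
    rw [this, hkey, abs_of_nonneg h0]
    have b1 := (hbd 1 (1 + t) (by linarith) (by norm_num) ⟨by linarith, by linarith⟩).2
    have b2 := (hbd 0 t h0 (by norm_num) ⟨by linarith, by linarith⟩).1
    linarith
  · have : ∫ x in (0 : ℝ)..1, |P (x + t) - P x| = -∫ x in (0 : ℝ)..1, (P (x + t) - P x) := by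
      rw [← intervalIntegral.integral_neg]
      refine intervalIntegral.integral_congr fun x hx ↦ abs_of_nonpos ?_
      rw [uIcc_of_le zero_le_one] at hx
      exact sub_nonpos.2 (hP ⟨by linarith [hx.1], by linarith [hx.2]⟩
        ⟨by linarith [hx.1], by linarith [hx.2]⟩ (by linarith))
    rw [this, hkey, abs_of_nonpos h0, intervalIntegral.integral_symm (1 + t) 1,
      intervalIntegral.integral_symm t 0]
    have b1 := (hbd (1 + t) 1 (by linarith) ⟨by linarith, by linarith⟩ (by norm_num)).2
    have b2 := (hbd t 0 h0 ⟨by linarith, by linarith⟩ (by norm_num)).1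
    linarith

namespace IsAdmissible

variable {f : ℝ → ℝ}

lemma periodic_one (hf : IsAdmissible f) : Function.Periodic f 1 := hf.periodic

lemma eVariationOn_shift (hf : IsAdmissible f) (k : ℤ) :
    eVariationOn f (Icc (k : ℝ) (k + 1)) = eVariationOn f (Icc 0 1) := by
  have h1 : f ∘ (fun x : ℝ ↦ x + k) = f := by
    funext x
    have := hf.periodic_one.int_mul k x
    simpa using this
  have := eVariationOn.comp_eq_of_monotoneOn f (t := Icc 0 1) (fun x : ℝ ↦ x + k)
    (fun x _ y _ hxy ↦ by simpa using hxy)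
  rw [h1, Set.image_add_const_Icc] at this
  rw [this, zero_add, add_comm]

/-- Shifts by `|t| ≤ 1 / 2` leave the unit interval, so a neighbourhood of it is needed; periodicity
gives three copies of the variation on `[0, 1]`. -/
lemma boundedVariationOn_Icc (hf : IsAdmissible f) : BoundedVariationOn f (Icc (-1) 2) := by
  have h := hf.boundedVariation
  have e1 := eVariationOn.Icc_add_Icc f (s := univ) (a := (-1 : ℝ)) (b := 0) (c := 1)
    (by norm_num) (by norm_num) (mem_univ _)
  have e2 := eVariationOn.Icc_add_Icc f (s := univ) (a := (-1 : ℝ)) (b := 1) (c := 2)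
    (by norm_num) (by norm_num) (mem_univ _)
  simp only [univ_inter] at e1 e2
  have s1 := hf.eVariationOn_shift (-1)
  have s2 := hf.eVariationOn_shift 1
  norm_num at s1 s2
  rw [BoundedVariationOn, ← e2, ← e1, s1, s2]
  exact ENNReal.add_ne_top.2 ⟨ENNReal.add_ne_top.2 ⟨h, h⟩, h⟩

lemma exists_bound (hf : IsAdmissible f) : ∃ B, 0 < B ∧ ∀ x, |f x| ≤ B := by
  refine ⟨|f 0| + (eVariationOn f (Icc 0 1)).toReal + 1, by positivity, fun x ↦ ?_⟩
  have h1 : f x = f (Int.fract x) := by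
    have := hf.periodic_one.sub_int_mul_eq (x := x) ⌊x⌋
    rw [mul_one] at this
    exact this.symm
  have h2 := hf.boundedVariation.dist_le (x := Int.fract x) (y := 0)
    ⟨Int.fract_nonneg x, (Int.fract_lt_one x).le⟩ (by norm_num)
  rw [h1]
  rw [Real.dist_eq] at h2
  have h3 := abs_sub_abs_le_abs_sub (f (Int.fract x)) (f 0)
  linarith

lemma integrable_of_measurable_of_bound {μ : Measure ℝ} [IsFiniteMeasure μ] {g : ℝ → ℝ}
    (hg : Measurable g) {B : ℝ} (hB : ∀ x, |g x| ≤ B) : Integrable g μ :=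
  Integrable.of_bound hg.aestronglyMeasurable B (Eventually.of_forall hB)

/-- Bounded variation gives an `L¹` Lipschitz modulus of continuity: apply the monotone case to both
parts of the Jordan decomposition. -/
lemma exists_shift_bound (hf : IsAdmissible f) :
    ∃ V, 0 < V ∧ ∀ t : ℝ, |t| ≤ 1 / 2 → ∫ x, |f (x + t) - f x| ∂unitMeasure ≤ V * |t| := by
  obtain ⟨p, q, hp, hq, hpq⟩ :=
    hf.boundedVariationOn_Icc.locallyBoundedVariationOn.exists_monotoneOn_sub_monotoneOn
  have hp2 : p (-1) ≤ p 2 := hp (by norm_num) (by norm_num) (by norm_num)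
  have hq2 : q (-1) ≤ q 2 := hq (by norm_num) (by norm_num) (by norm_num)
  -- The summand `1` only serves to make the constant strictly positive.
  refine ⟨(p 2 - p (-1)) + (q 2 - q (-1)) + 1, by linarith, fun t ht ↦ ?_⟩
  obtain ⟨ht1, ht2⟩ := abs_le.1 ht
  have hint : ∀ P : ℝ → ℝ, MonotoneOn P (Icc (-1) 2) →
      Integrable (fun x ↦ |P (x + t) - P x|) unitMeasure := by
    intro P hP
    refine Integrable.abs (Integrable.sub ?_ ?_)
    · have h : IntervalIntegrable P volume t (1 + t) := (hP.mono (ordConnected_Icc.uIcc_subset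
        ⟨by linarith, by linarith⟩ ⟨by linarith, by linarith⟩)).intervalIntegrable
      have := h.comp_add_right t
      simp only [sub_self, add_sub_cancel_right] at this
      exact (intervalIntegrable_iff_integrableOn_Ioc_of_le zero_le_one).1 this
    · have h : IntervalIntegrable P volume 0 1 := (hP.mono (ordConnected_Icc.uIcc_subset
        (by norm_num) (by norm_num))).intervalIntegrable
      exact (intervalIntegrable_iff_integrableOn_Ioc_of_le zero_le_one).1 h
  obtain ⟨B, -, hB⟩ := hf.exists_bound
  have hfm := hf.measurable
  calc ∫ x, |f (x + t) - f x| ∂unitMeasure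
      ≤ ∫ x, (|p (x + t) - p x| + |q (x + t) - q x|) ∂unitMeasure := by
        refine integral_mono (integrable_of_measurable_of_bound (B := 2 * B) (by fun_prop)
          fun x ↦ ?_) ((hint p hp).add (hint q hq)) fun x ↦ ?_
        · rw [abs_abs]
          have := abs_sub (f (x + t)) (f x)
          linarith [hB x, hB (x + t)]
        · simp only [hpq, Pi.sub_apply]
          have := abs_sub (p (x + t) - p x) (q (x + t) - q x)
          calc _ = |p (x + t) - p x - (q (x + t) - q x)| := by congr 1; ring
            _ ≤ _ := this
    _ = ∫ x, |p (x + t) - p x| ∂unitMeasure + ∫ x, |q (x + t) - q x| ∂unitMeasure :=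
        integral_add (hint p hp) (hint q hq)
    _ ≤ |t| * (p 2 - p (-1)) + |t| * (q 2 - q (-1)) :=
        add_le_add (hp.integral_abs_shift_sub_le ht) (hq.integral_abs_shift_sub_le ht)
    _ ≤ _ := by nlinarith [abs_nonneg t]

end IsAdmissible

/-- Convolution of `f` with the normalised kernel `cos (π t) ^ (2 l)`. -/
noncomputable def cosMean (f : ℝ → ℝ) (l : ℕ) (x : ℝ) : ℝ :=
  (cosMass l)⁻¹ * ∫ y, f y * Real.cos (Real.pi * (x - y)) ^ (2 * l) ∂unitMeasure

lemma cos_pow_mem_trigPoly (l : ℕ) :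
    (fun x : ℝ ↦ ((Real.cos (Real.pi * x) ^ (2 * l) : ℝ) : ℂ)) ∈ trigPoly l := by
  have h1 : (fun x : ℝ ↦ ((Real.cos (Real.pi * x) ^ 2 : ℝ) : ℂ)) =
      (1 / 2 : ℂ) • 1 + (1 / 4 : ℂ) • expChar 1 + (1 / 4 : ℂ) • expChar (-1) := by
    funext x
    simp only [Pi.add_apply, Pi.smul_apply, Pi.one_apply, smul_eq_mul, expChar]
    push_cast
    rw [Complex.cos, div_pow, add_sq, ← Complex.exp_nat_mul, ← Complex.exp_nat_mul,
      mul_assoc 2 (Complex.exp _), ← Complex.exp_add]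
    have a1 : (2 : ℕ) * (Real.pi * x * Complex.I) = 2 * Real.pi * Complex.I * 1 * x := by
      push_cast; ring
    have a2 : (2 : ℕ) * (-(Real.pi * x : ℂ) * Complex.I) = 2 * Real.pi * Complex.I * -1 * x := by
      push_cast; ring
    have a3 : (Real.pi * x * Complex.I + -(Real.pi * x : ℂ) * Complex.I) = 0 := by ring
    rw [a1, a2, a3, Complex.exp_zero]
    ring
  have h2 : (fun x : ℝ ↦ ((Real.cos (Real.pi * x) ^ 2 : ℝ) : ℂ)) ∈ trigPoly 1 := by
    rw [h1]
    exact Submodule.add_mem _ (Submodule.add_mem _ (Submodule.smul_mem _ _ (one_mem_trigPoly 1))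
      (Submodule.smul_mem _ _ (expChar_mem_trigPoly (by norm_num))))
      (Submodule.smul_mem _ _ (expChar_mem_trigPoly (by norm_num)))
  have h3 := pow_mem_trigPoly h2 l
  rw [mul_one] at h3
  convert h3 using 1
  funext x
  simp [pow_mul]

lemma expChar_sub (m : ℤ) (x y : ℝ) : expChar m (x - y) = expChar m x * expChar m (-y) := by
  simp only [expChar, ← Complex.exp_add]
  congr 1
  push_cast
  ring

lemma norm_expChar (m : ℤ) (x : ℝ) : ‖expChar m x‖ = 1 := by
  rw [expChar, show (2 * Real.pi * Complex.I * m * x : ℂ) =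
    ((2 * Real.pi * m * x : ℝ) : ℂ) * Complex.I by push_cast; ring, Complex.norm_exp_ofReal_mul_I]

/-- Convolving with a trigonometric polynomial multiplies Fourier coefficients, so the degree is
that of the kernel, and the zero coefficient vanishes because `f` has mean zero. -/
lemma exists_coeff_cosMean {f : ℝ → ℝ} (hf : IsAdmissible f) (l : ℕ) :
    ∃ c : ℤ → ℂ, c 0 = 0 ∧
      ∀ x, (cosMean f l x : ℂ) = ∑ m ∈ Finset.Icc (-(l : ℤ)) l, c m * expChar m x := by
  obtain ⟨c, hc⟩ := exists_coeff_of_mem_trigPoly (cos_pow_mem_trigPoly l)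
  obtain ⟨B, hB0, hB⟩ := hf.exists_bound
  have hfm := hf.measurable
  refine ⟨fun m ↦ (cosMass l : ℂ)⁻¹ * (c m * ∫ y, (f y : ℂ) * expChar m (-y) ∂unitMeasure), ?_,
    fun x ↦ ?_⟩
  · have : ∫ y, (f y : ℂ) ∂unitMeasure = 0 := by
      rw [integral_complex_ofReal, integral_unitMeasure, hf.integral_eq_zero, Complex.ofReal_zero]
    simp [expChar_zero, this]
  · rw [cosMean]
    push_cast
    rw [← integral_complex_ofReal]
    simp_rw [mul_assoc, ← Finset.mul_sum]
    congr 1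
    have : ∀ y : ℝ, ((f y * Real.cos (Real.pi * (x - y)) ^ (2 * l) : ℝ) : ℂ) =
        ∑ m ∈ Finset.Icc (-(l : ℤ)) l, c m * ((f y : ℂ) * expChar m (-y) * expChar m x) := by
      intro y
      rw [Complex.ofReal_mul, hc (x - y), Finset.mul_sum]
      refine Finset.sum_congr rfl fun m _ ↦ ?_
      rw [expChar_sub]
      ring
    simp_rw [this]
    rw [integral_finsetSum]
    · simp_rw [integral_const_mul, integral_mul_const]
    · intro m _
      have hm := (continuous_expChar m).measurable
      refine Integrable.of_bound (by fun_prop) (‖c m‖ * B) (Eventually.of_forall fun y ↦ ?_)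
      simp only [norm_mul, norm_expChar, mul_one, Complex.norm_real]
      exact mul_le_mul_of_nonneg_left (hB y) (norm_nonneg _)

/-- The exponent `2 * l` is even, so the kernel has period `1` although `cos (π t)` only changes
sign under `t ↦ t + 1`. -/
lemma cosMean_eq_shift {f : ℝ → ℝ} (hf : IsAdmissible f) (l : ℕ) (x : ℝ) :
    cosMean f l x =
      (cosMass l)⁻¹ * ∫ t, f (x + t) * Real.cos (Real.pi * t) ^ (2 * l) ∂centeredMeasure := by
  rw [cosMean, integral_unitMeasure_eq_shift _ x]
  · congr 2
    funext t
    rw [show x - (x + t) = -t by ring, mul_neg, Real.cos_neg]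
  · intro y
    simp only
    rw [hf.periodic, show Real.pi * (x - (y + 1)) = Real.pi * (x - y) - Real.pi by ring,
      Real.cos_sub_pi, pow_mul, neg_sq, ← pow_mul]

/-- The kernel is nonnegative of mass one, so averaging keeps the bound `B`. By Fubini the `L¹`
error is at most the mean of the shift modulus `V * |t|` against the kernel, hence at most `V / √D`.
-/
theorem IsAdmissible.exists_trigPoly_approx {f : ℝ → ℝ} (hf : IsAdmissible f) :
    ∃ B C : ℝ, 0 < B ∧ 0 < C ∧ (∀ x, |f x| ≤ B) ∧ ∀ D : ℕ, 1 ≤ D → ∃ p : ℝ → ℝ,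
      (fun x ↦ (p x : ℂ)) ∈ trigPoly D ∧ (∀ x, |p x| ≤ B) ∧ ∫ x, p x ∂unitMeasure = 0 ∧
      ∫ x, |f x - p x| ∂unitMeasure ≤ C / √D := by
  obtain ⟨B, hB0, hB⟩ := hf.exists_bound
  obtain ⟨V, hV0, hV⟩ := hf.exists_shift_bound
  have hfm := hf.measurable
  have hcos : ∀ (l : ℕ) (t : ℝ), 0 ≤ Real.cos (Real.pi * t) ^ (2 * l) :=
    fun l t ↦ Even.pow_nonneg (even_two_mul l) _
  have hcos1 : ∀ (l : ℕ) (t : ℝ), Real.cos (Real.pi * t) ^ (2 * l) ≤ 1 := fun l t ↦ by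
    rw [pow_mul]
    exact pow_le_one₀ (sq_nonneg _) (Real.cos_sq_le_one _)
  refine ⟨B, V, hB0, hV0, hB, fun D hD ↦ ⟨cosMean f D, ?_, fun x ↦ ?_, ?_, ?_⟩⟩
  · obtain ⟨c, -, hc⟩ := exists_coeff_cosMean hf D
    rw [show (fun x ↦ (cosMean f D x : ℂ)) = ∑ m ∈ Finset.Icc (-(D : ℤ)) D, c m • expChar m by
      funext x; simp [hc]]
    refine Submodule.sum_mem _ fun m hm ↦ Submodule.smul_mem _ _ (expChar_mem_trigPoly ?_)
    exact abs_le.2 (Finset.mem_Icc.1 hm)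
  · rw [cosMean_eq_shift hf, abs_mul, abs_of_pos (inv_pos.2 (cosMass_pos D)),
      inv_mul_le_iff₀ (cosMass_pos D), cosMass, mul_comm _ B, ← integral_const_mul]
    refine (abs_integral_le_integral_abs).trans (integral_mono ?_ ?_ fun t ↦ ?_)
    · refine integrable_of_measurable_of_bound (B := B) (by fun_prop) fun t ↦ ?_
      rw [abs_abs, abs_mul, abs_of_nonneg (hcos D t)]
      nlinarith [hB (x + t), hcos D t, hcos1 D t, abs_nonneg (f (x + t))]
    · exact integrable_centeredMeasure_of_continuous (by fun_prop)
    · simp only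
      rw [abs_mul, abs_of_nonneg (hcos D t)]
      exact mul_le_mul_of_nonneg_right (hB _) (hcos D t)
  · obtain ⟨c, hc0, hc⟩ := exists_coeff_cosMean hf D
    apply Complex.ofReal_injective
    rw [← integral_complex_ofReal]
    simp_rw [hc]
    rw [integral_sum_coeff, hc0, Complex.ofReal_zero]
  · have hk := cosMass_pos D
    have hdiff : ∀ x, |f x - cosMean f D x| ≤
        (cosMass D)⁻¹ * ∫ t, |f (x + t) - f x| * Real.cos (Real.pi * t) ^ (2 * D)
          ∂centeredMeasure := by
      intro x
      have : f x - cosMean f D x = (cosMass D)⁻¹ *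
          ∫ t, (f x - f (x + t)) * Real.cos (Real.pi * t) ^ (2 * D) ∂centeredMeasure := by
        simp_rw [sub_mul]
        rw [integral_sub, mul_sub, cosMean_eq_shift hf, integral_const_mul]
        · change _ = (cosMass D)⁻¹ * (f x * cosMass D) - _
          rw [mul_comm (f x), inv_mul_cancel_left₀ hk.ne']
        · exact integrable_centeredMeasure_of_continuous (by fun_prop)
        · refine integrable_of_measurable_of_bound (B := B) (by fun_prop) fun t ↦ ?_
          rw [abs_mul, abs_of_nonneg (hcos D t)]
          nlinarith [hB (x + t), hcos D t, hcos1 D t, abs_nonneg (f (x + t))]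
      rw [this, abs_mul, abs_of_pos (inv_pos.2 hk)]
      refine mul_le_mul_of_nonneg_left ((abs_integral_le_integral_abs).trans (le_of_eq ?_))
        (inv_pos.2 hk).le
      congr 1
      funext t
      rw [abs_mul, abs_of_nonneg (hcos D t), abs_sub_comm]
    have hbd : ∀ x t, |(|f (x + t) - f x| * Real.cos (Real.pi * t) ^ (2 * D))| ≤ 2 * B := by
      intro x t
      rw [abs_mul, abs_abs, abs_of_nonneg (hcos D t)]
      have := abs_sub (f (x + t)) (f x)
      nlinarith [hB x, hB (x + t), hcos D t, hcos1 D t, abs_nonneg (f (x + t) - f x)]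
    have hprod : Integrable (Function.uncurry fun x t ↦
        |f (x + t) - f x| * Real.cos (Real.pi * t) ^ (2 * D)) (unitMeasure.prod centeredMeasure) := by
      refine Integrable.of_bound (Measurable.aestronglyMeasurable ?_) (2 * B)
        (Eventually.of_forall fun z ↦ hbd z.1 z.2)
      simp only [Function.uncurry_def]
      fun_prop
    calc ∫ x, |f x - cosMean f D x| ∂unitMeasure
        ≤ ∫ x, (cosMass D)⁻¹ * ∫ t, |f (x + t) - f x| * Real.cos (Real.pi * t) ^ (2 * D)
          ∂centeredMeasure ∂unitMeasure :=
          integral_mono_of_nonneg (Eventually.of_forall fun _ ↦ abs_nonneg _)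
            (hprod.integral_prod_left.const_mul _) (Eventually.of_forall hdiff)
      _ = (cosMass D)⁻¹ * ∫ t, (∫ x, |f (x + t) - f x| ∂unitMeasure) *
          Real.cos (Real.pi * t) ^ (2 * D) ∂centeredMeasure := by
          rw [integral_const_mul, integral_integral_swap hprod]
          simp_rw [integral_mul_const]
      _ ≤ (cosMass D)⁻¹ * ∫ t, V * (|t| * Real.cos (Real.pi * t) ^ (2 * D)) ∂centeredMeasure := by
          refine mul_le_mul_of_nonneg_left ?_ (inv_pos.2 hk).le
          refine integral_mono_of_nonneg (Eventually.of_forall fun t ↦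
            mul_nonneg (integral_nonneg fun _ ↦ abs_nonneg _) (hcos D t))
            (integrable_centeredMeasure_of_continuous (by fun_prop)) ?_
          filter_upwards [ae_centeredMeasure_abs_le] with t ht
          rw [← mul_assoc]
          exact mul_le_mul_of_nonneg_right (hV t ht) (hcos D t)
      _ ≤ (cosMass D)⁻¹ * (V * (cosMass D / √D)) := by
          rw [integral_const_mul]
          exact mul_le_mul_of_nonneg_left (mul_le_mul_of_nonneg_left
            (integral_abs_mul_cos_pow_le hD) hV0.le) (inv_pos.2 hk).le
      _ = V / √D := by field_simp

/-! ### Taylor remainders and one-variable estimates -/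

lemma hasDerivAt_sum_pow_div_factorial (k : ℕ) (y : ℝ) :
    HasDerivAt (fun y : ℝ ↦ ∑ j ∈ Finset.range (k + 1),
        ((y : ℂ) * Complex.I) ^ j / (j.factorial : ℂ))
      (Complex.I * ∑ j ∈ Finset.range k, ((y : ℂ) * Complex.I) ^ j / (j.factorial : ℂ)) y := by
  have hb : HasDerivAt (fun y : ℝ ↦ (y : ℂ) * Complex.I) Complex.I y := by
    simpa using (Complex.ofRealCLM.hasDerivAt (x := y)).mul_const Complex.I
  induction k with
  | zero => simpa using hasDerivAt_const y (1 : ℂ)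
  | succ k ih =>
    simp_rw [Finset.sum_range_succ _ (k + 1)]
    rw [Finset.sum_range_succ, mul_add]
    refine ih.add ?_
    refine ((hb.pow (k + 1)).div_const ((k + 1).factorial : ℂ)).congr_deriv ?_
    rw [Nat.factorial_succ]
    have : (k.factorial : ℂ) ≠ 0 := by exact_mod_cast k.factorial_ne_zero
    have : (k + 1 : ℂ) ≠ 0 := by exact_mod_cast k.succ_ne_zero
    push_cast
    field_simp

/-- The derivative of each remainder is `I` times the preceding one, so the bound follows by
induction through comparison of derivatives. The modulus of `exp (i y)` being one, no exponential
factor appears. -/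
lemma norm_exp_mul_I_sub_sum_le_of_nonneg (k : ℕ) {y : ℝ} (hy : 0 ≤ y) :
    ‖Complex.exp (y * Complex.I) -
      ∑ j ∈ Finset.range k, ((y : ℂ) * Complex.I) ^ j / (j.factorial : ℂ)‖ ≤
        y ^ k / k.factorial := by
  induction k generalizing y with
  | zero => simp [Complex.norm_exp_ofReal_mul_I]
  | succ k ih =>
    have hb : ∀ y : ℝ, HasDerivAt (fun y : ℝ ↦ (y : ℂ) * Complex.I) Complex.I y := fun y ↦ by
      simpa using (Complex.ofRealCLM.hasDerivAt (x := y)).mul_const Complex.I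
    have hd : ∀ y : ℝ, HasDerivAt (fun y : ℝ ↦ Complex.exp (y * Complex.I) -
        ∑ j ∈ Finset.range (k + 1), ((y : ℂ) * Complex.I) ^ j / (j.factorial : ℂ))
        (Complex.I * (Complex.exp (y * Complex.I) -
          ∑ j ∈ Finset.range k, ((y : ℂ) * Complex.I) ^ j / (j.factorial : ℂ))) y := by
      intro y
      rw [mul_sub, mul_comm Complex.I (Complex.exp _)]
      exact (hb y).cexp.sub (hasDerivAt_sum_pow_div_factorial k y)
    have hB : ∀ y : ℝ, HasDerivAt (fun y : ℝ ↦ y ^ (k + 1) / ((k + 1).factorial : ℝ))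
        (y ^ k / (k.factorial : ℝ)) y := by
      intro y
      refine ((hasDerivAt_pow (k + 1) y).div_const ((k + 1).factorial : ℝ)).congr_deriv ?_
      rw [Nat.factorial_succ]
      have : (k.factorial : ℝ) ≠ 0 := by exact_mod_cast k.factorial_ne_zero
      have : (k + 1 : ℝ) ≠ 0 := by exact_mod_cast k.succ_ne_zero
      push_cast
      field_simp
    refine image_norm_le_of_norm_deriv_right_le_deriv_boundary (a := 0) (b := y)
      (fun z _ ↦ (hd z).continuousAt.continuousWithinAt)
      (fun z _ ↦ (hd z).hasDerivWithinAt) ?_ hB (fun z hz ↦ ?_) ⟨hy, le_rfl⟩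
    · rw [Finset.sum_range_succ']
      simp
    · rw [norm_mul, Complex.norm_I, one_mul]
      exact ih hz.1

lemma norm_exp_mul_I_sub_sum_le (k : ℕ) (y : ℝ) :
    ‖Complex.exp (y * Complex.I) -
      ∑ j ∈ Finset.range k, ((y : ℂ) * Complex.I) ^ j / (j.factorial : ℂ)‖ ≤
        |y| ^ k / k.factorial := by
  rcases le_total 0 y with h | h
  · rw [abs_of_nonneg h]
    exact norm_exp_mul_I_sub_sum_le_of_nonneg k h
  · rw [abs_of_nonpos h]
    refine le_trans (le_of_eq ?_) (norm_exp_mul_I_sub_sum_le_of_nonneg k (neg_nonneg.2 h))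
    rw [← Complex.norm_conj, map_sub, ← Complex.exp_conj, map_sum]
    simp [map_div₀]

lemma norm_prod_sub_prod_le {ι : Type*} (s : Finset ι) (a b : ι → ℂ) (ha : ∀ i ∈ s, ‖a i‖ ≤ 1)
    (hb : ∀ i ∈ s, ‖b i‖ ≤ 1) : ‖∏ i ∈ s, a i - ∏ i ∈ s, b i‖ ≤ ∑ i ∈ s, ‖a i - b i‖ := by
  classical
  induction s using Finset.induction_on with
  | empty => simp
  | insert i s hi ih =>
    rw [Finset.prod_insert hi, Finset.prod_insert hi, Finset.sum_insert hi]
    have h1 : ‖∏ j ∈ s, b j‖ ≤ 1 := by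
      rw [norm_prod]
      exact Finset.prod_le_one (fun _ _ ↦ norm_nonneg _)
        fun j hj ↦ hb j (Finset.mem_insert_of_mem hj)
    have h2 := ih (fun j hj ↦ ha j (Finset.mem_insert_of_mem hj))
      fun j hj ↦ hb j (Finset.mem_insert_of_mem hj)
    calc _ = ‖a i * (∏ j ∈ s, a j - ∏ j ∈ s, b j) + (a i - b i) * ∏ j ∈ s, b j‖ := by
          congr 1; ring
      _ ≤ ‖a i‖ * ‖∏ j ∈ s, a j - ∏ j ∈ s, b j‖ + ‖a i - b i‖ * ‖∏ j ∈ s, b j‖ := by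
          refine (norm_add_le _ _).trans ?_
          rw [norm_mul, norm_mul]
      _ ≤ 1 * ∑ j ∈ s, ‖a j - b j‖ + ‖a i - b i‖ * 1 := by
          gcongr
          exact ha i (Finset.mem_insert_self i s)
      _ = _ := by ring

/-- A real trigonometric polynomial of degree at most `D` and mean zero, bounded by `B`. -/
structure IsBoundedTrig (p : ℝ → ℝ) (D : ℕ) (B : ℝ) : Prop where
  mem_trigPoly : (fun x ↦ (p x : ℂ)) ∈ trigPoly D
  abs_le : ∀ x, |p x| ≤ B
  integral_eq_zero : ∫ x, p x ∂unitMeasure = 0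

/-- The variance of `p` under the uniform distribution. -/
noncomputable def unitVariance (p : ℝ → ℝ) : ℝ := ∫ x, p x ^ 2 ∂unitMeasure

namespace IsBoundedTrig

variable {p : ℝ → ℝ} {D : ℕ} {B : ℝ}

lemma continuous (hp : IsBoundedTrig p D B) : Continuous p :=
  Complex.continuous_re.comp (continuous_of_mem_trigPoly hp.mem_trigPoly)

lemma nonneg_bound (hp : IsBoundedTrig p D B) : 0 ≤ B := (abs_nonneg _).trans (hp.abs_le 0)

lemma sq_le (hp : IsBoundedTrig p D B) (x : ℝ) : p x ^ 2 ≤ B ^ 2 := by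
  rw [← sq_abs]
  exact pow_le_pow_left₀ (abs_nonneg _) (hp.abs_le x) 2

lemma unitVariance_nonneg (p : ℝ → ℝ) : 0 ≤ unitVariance p := integral_nonneg fun _ ↦ sq_nonneg _

lemma unitVariance_le (hp : IsBoundedTrig p D B) : unitVariance p ≤ B ^ 2 := by
  have hc := hp.continuous
  have := integral_mono (μ := unitMeasure)
    (integrable_unitMeasure_of_continuous (g := fun x ↦ p x ^ 2) (by fun_prop))
    (integrable_const (B ^ 2)) hp.sq_le
  simpa [unitVariance] using this

/-- Hoeffding's lemma on `[-B, B]`. -/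
lemma integral_exp_le_subgaussian (hp : IsBoundedTrig p D B) (s : ℝ) :
    ∫ x, Real.exp (s * p x) ∂unitMeasure ≤ Real.exp (s ^ 2 * B ^ 2 / 2) := by
  have h := (hasSubgaussianMGF_of_mem_Icc_of_integral_eq_zero (μ := unitMeasure) (X := p)
    (a := -B) (b := B) hp.continuous.measurable.aemeasurable
    (Eventually.of_forall fun x ↦ _root_.abs_le.1 (hp.abs_le x)) hp.integral_eq_zero).mgf_le s
  refine h.trans (Real.exp_le_exp.2 (le_of_eq ?_))
  have : ‖B - -B‖ = 2 * B := by
    rw [Real.norm_of_nonneg] <;> linarith [hp.nonneg_bound]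
  push_cast
  rw [this]
  ring

/-- Taylor expansion to second order with the cubic remainder absorbed into the quadratic term. In
contrast to Hoeffding's bound, the true variance appears; the sharp constant in the law of the
iterated logarithm needs this. -/
lemma integral_exp_le_bernstein (hp : IsBoundedTrig p D B) {s : ℝ} (hs : |s| * B ≤ 1) :
    ∫ x, Real.exp (s * p x) ∂unitMeasure ≤
      Real.exp (s ^ 2 * unitVariance p * (1 + |s| * B) / 2) := by
  have hc := hp.continuous
  have hpt : ∀ x, Real.exp (s * p x) ≤ 1 + s * p x + s ^ 2 * (1 + |s| * B) / 2 * p x ^ 2 := by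
    intro x
    have h1 : |s * p x| ≤ |s| * B := by
      rw [abs_mul]
      exact mul_le_mul_of_nonneg_left (hp.abs_le x) (abs_nonneg _)
    have h2 := abs_sub_le_iff.1 (Real.exp_bound (h1.trans hs) (n := 3) (by norm_num))
    simp only [Finset.sum_range_succ, Finset.sum_range_zero] at h2
    norm_num [Nat.factorial] at h2
    have h3 : |s * p x| ^ 3 ≤ |s| * B * (s * p x) ^ 2 := by
      rw [pow_succ, sq_abs, mul_comm]
      exact mul_le_mul_of_nonneg_right h1 (sq_nonneg _)
    have h4 : 0 ≤ |s * p x| ^ 3 := by positivity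
    rw [← abs_mul] at h2
    nlinarith [h2.1]
  calc ∫ x, Real.exp (s * p x) ∂unitMeasure
      ≤ ∫ x, (1 + s * p x + s ^ 2 * (1 + |s| * B) / 2 * p x ^ 2) ∂unitMeasure :=
        integral_mono (integrable_unitMeasure_of_continuous (by fun_prop))
          (integrable_unitMeasure_of_continuous (by fun_prop)) hpt
    _ = s ^ 2 * unitVariance p * (1 + |s| * B) / 2 + 1 := by
        rw [integral_add (integrable_unitMeasure_of_continuous (by fun_prop))
          (integrable_unitMeasure_of_continuous (by fun_prop)),
          integral_add (integrable_unitMeasure_of_continuous (by fun_prop))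
          (integrable_unitMeasure_of_continuous (by fun_prop)), integral_const_mul,
          integral_const_mul, hp.integral_eq_zero]
        simp [unitVariance]
        ring
    _ ≤ _ := Real.add_one_le_exp _

/-- Both quantities are compared with `1 - s ^ 2 * unitVariance p / 2`. The characteristic function
differs from it by at most a sixth of `(|s| * B) ^ 3`, the Gaussian one by at most a quarter. -/
lemma norm_integral_exp_sub_le (hp : IsBoundedTrig p D B) {s : ℝ} (hs : |s| * B ≤ 1) :
    ‖∫ x, Complex.exp ((s * p x : ℝ) * Complex.I) ∂unitMeasure -
      (Real.exp (-(s ^ 2 * unitVariance p / 2)) : ℂ)‖ ≤ (|s| * B) ^ 3 := by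
  have hc := hp.continuous
  have hB := hp.nonneg_bound
  have hsB : 0 ≤ |s| * B := by positivity
  have h1 : ‖∫ x, Complex.exp ((s * p x : ℝ) * Complex.I) ∂unitMeasure -
      ((1 - s ^ 2 * unitVariance p / 2 : ℝ) : ℂ)‖ ≤ (|s| * B) ^ 3 / 6 := by
    have e1 : ((1 - s ^ 2 * unitVariance p / 2 : ℝ) : ℂ) = ∫ x, ∑ j ∈ Finset.range 3,
        (((s * p x : ℝ) : ℂ) * Complex.I) ^ j / (j.factorial : ℂ) ∂unitMeasure := by
      have : ∀ x, ∑ j ∈ Finset.range 3, (((s * p x : ℝ) : ℂ) * Complex.I) ^ j / (j.factorial : ℂ)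
          = 1 + (s * Complex.I) * (p x : ℝ) + (-(s ^ 2 / 2) : ℂ) * ((p x ^ 2 : ℝ) : ℂ) := by
        intro x
        simp only [Finset.sum_range_succ, Finset.sum_range_zero, Nat.factorial, mul_pow,
          Complex.I_sq]
        push_cast
        ring
      simp_rw [this]
      rw [integral_add (integrable_unitMeasure_of_continuous (by fun_prop))
          (integrable_unitMeasure_of_continuous (by fun_prop)),
          integral_add (integrable_unitMeasure_of_continuous (by fun_prop))
          (integrable_unitMeasure_of_continuous (by fun_prop)), integral_const_mul,
          integral_const_mul, integral_complex_ofReal, integral_complex_ofReal,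
          hp.integral_eq_zero]
      simp [unitVariance]
      ring
    rw [e1, ← integral_sub (integrable_unitMeasure_of_continuous (by fun_prop))
      (integrable_unitMeasure_of_continuous (by fun_prop))]
    refine (norm_integral_le_of_norm_le_const (C := (|s| * B) ^ 3 / 6)
      (Eventually.of_forall fun x ↦ ?_)).trans (by simp)
    refine (norm_exp_mul_I_sub_sum_le 3 (s * p x)).trans ?_
    rw [show ((3 : ℕ).factorial : ℝ) = 6 by norm_num [Nat.factorial], abs_mul]
    gcongr
    exact hp.abs_le x
  set v := s ^ 2 * unitVariance p / 2 with hv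
  have hv0 : 0 ≤ v := by
    have := unitVariance_nonneg p
    positivity
  have hv1 : v ≤ (|s| * B) ^ 2 / 2 := by
    have := hp.unitVariance_le
    rw [mul_pow, sq_abs]
    have := mul_le_mul_of_nonneg_left this (sq_nonneg s)
    linarith
  have hv2 : v ≤ 1 := by nlinarith
  have h2 : ‖((1 - v : ℝ) : ℂ) - (Real.exp (-v) : ℂ)‖ ≤ (|s| * B) ^ 3 / 4 := by
    rw [← Complex.ofReal_sub, Complex.norm_real, Real.norm_eq_abs, abs_sub_comm]
    have := Real.abs_exp_sub_one_sub_id_le (x := -v) (by rwa [abs_neg, abs_of_nonneg hv0])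
    calc |Real.exp (-v) - (1 - v)| = |Real.exp (-v) - 1 - -v| := by congr 1; ring
      _ ≤ (-v) ^ 2 := this
      _ = v ^ 2 := by ring
      _ ≤ ((|s| * B) ^ 2 / 2) ^ 2 := pow_le_pow_left₀ hv0 hv1 2
      _ = (|s| * B) ^ 3 * (|s| * B) / 4 := by ring
      _ ≤ (|s| * B) ^ 3 * 1 / 4 := by gcongr
      _ = _ := by ring
  refine (norm_sub_le_norm_sub_add_norm_sub _ _ _).trans ((add_le_add h1 h2).trans ?_)
  have : 0 ≤ (|s| * B) ^ 3 := by positivity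
  linarith

end IsBoundedTrig

/-! ### Moments and characteristic functions of dissociated sums -/

lemma integral_cubeMeasure_exp {I : Finset ℕ} (w : ℕ → ℝ) (p : ℝ → ℝ) (z : ℝ) :
    ∫ u, Real.exp (z * cubeSum I w p u) ∂cubeMeasure I =
      ∏ i ∈ I, ∫ x, Real.exp (z * w i * p x) ∂unitMeasure := by
  simp_rw [cubeSum, Finset.mul_sum, Real.exp_sum, ← mul_assoc]
  rw [cubeMeasure, integral_fintype_prod_eq_prod (fun (i : I) (y : ℝ) ↦ Real.exp (z * w i * p y)),
    ← Finset.prod_coe_sort I]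

lemma integral_cubeMeasure_cexp {I : Finset ℕ} (w : ℕ → ℝ) (p : ℝ → ℝ) :
    ∫ u, Complex.exp (cubeSum I w p u * Complex.I) ∂cubeMeasure I =
      ∏ i ∈ I, ∫ x, Complex.exp ((w i * p x : ℝ) * Complex.I) ∂unitMeasure := by
  simp_rw [cubeSum, Complex.ofReal_sum, Finset.sum_mul, Complex.exp_sum]
  rw [cubeMeasure, integral_fintype_prod_eq_prod
      (fun (i : I) (y : ℝ) ↦ Complex.exp ((w i * p y : ℝ) * Complex.I)),
    ← Finset.prod_coe_sort I]

/-- Exponential moments are not accessible on the circle, where only moments of bounded order are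
known. The even moment is therefore first carried to the cube, where `y ^ (2 m) ≤ (2 m)! / z ^ (2 m)
* (exp (z y) + exp (-z y))` and the exponential moments factorise. -/
lemma Dissociated.integral_weightedSum_pow_le {n : ℕ → ℕ} {I : Finset ℕ} {r Q D m : ℕ}
    (h : Dissociated n I r Q) (w : ℕ → ℝ) {p : ℝ → ℝ} {B : ℝ} (hp : IsBoundedTrig p D B)
    (hr : 2 * m ≤ r) (hQ : 2 * m * D ≤ Q) {z : ℝ} (hz : 0 < z) (g : ℕ → ℝ)
    (hg : ∀ i ∈ I, ∀ s : ℝ, |s| = z * |w i| → ∫ x, Real.exp (s * p x) ∂unitMeasure ≤ Real.exp (g i)) :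
    ∫ x, weightedSum n I w p x ^ (2 * m) ∂unitMeasure ≤
      2 * (2 * m).factorial / z ^ (2 * m) * Real.exp (∑ i ∈ I, g i) := by
  have hc := hp.continuous
  have hcs := continuous_cubeSum I w hc
  have hbd := abs_cubeSum_le I w hp.abs_le
  set A := ∑ i ∈ I, |w i| * B
  rw [h.integral_weightedSum_pow w hp.mem_trigPoly hr hQ]
  have hexp : ∀ z : ℝ, Integrable (fun u ↦ Real.exp (z * cubeSum I w p u)) (cubeMeasure I) := by
    intro z
    refine integrable_of_continuous_of_bound (by fun_prop) (Real.exp (|z| * A)) fun u ↦ ?_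
    rw [Real.norm_of_nonneg (Real.exp_pos _).le]
    refine Real.exp_le_exp.2 ((le_abs_self _).trans ?_)
    rw [abs_mul]
    exact mul_le_mul_of_nonneg_left (hbd u) (abs_nonneg _)
  have hpt : ∀ u, cubeSum I w p u ^ (2 * m) ≤ (2 * m).factorial / z ^ (2 * m) *
      (Real.exp (z * cubeSum I w p u) + Real.exp (-z * cubeSum I w p u)) := by
    intro u
    have h1 := Real.pow_div_factorial_le_exp _ (abs_nonneg (z * cubeSum I w p u)) (2 * m)
    rw [(even_two_mul m).pow_abs, mul_pow, div_le_iff₀ (by positivity)] at h1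
    rw [div_mul_eq_mul_div, le_div_iff₀ (by positivity), mul_comm]
    refine h1.trans ?_
    rw [mul_comm]
    refine mul_le_mul_of_nonneg_left ?_ (by positivity)
    rw [neg_mul]
    rcases abs_cases (z * cubeSum I w p u) with ⟨h, _⟩ | ⟨h, _⟩ <;> rw [h]
    · linarith [Real.exp_pos (-(z * cubeSum I w p u))]
    · linarith [Real.exp_pos (z * cubeSum I w p u)]
  have hone : ∀ s : ℝ, |s| = z → ∫ u, Real.exp (s * cubeSum I w p u) ∂cubeMeasure I ≤
      Real.exp (∑ i ∈ I, g i) := by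
    intro s hs
    rw [integral_cubeMeasure_exp, Real.exp_sum]
    refine Finset.prod_le_prod (fun i _ ↦ integral_nonneg fun _ ↦ (Real.exp_pos _).le)
      fun i hi ↦ hg i hi _ ?_
    rw [abs_mul, hs]
  calc ∫ u, cubeSum I w p u ^ (2 * m) ∂cubeMeasure I
      ≤ ∫ u, (2 * m).factorial / z ^ (2 * m) *
        (Real.exp (z * cubeSum I w p u) + Real.exp (-z * cubeSum I w p u)) ∂cubeMeasure I := by
        refine integral_mono ?_ (((hexp z).add (hexp (-z))).const_mul _) hpt
        refine integrable_of_continuous_of_bound (by fun_prop) (A ^ (2 * m)) fun u ↦ ?_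
        rw [norm_pow]
        exact pow_le_pow_left₀ (norm_nonneg _) (hbd u) _
    _ = (2 * m).factorial / z ^ (2 * m) * (∫ u, Real.exp (z * cubeSum I w p u) ∂cubeMeasure I +
        ∫ u, Real.exp (-z * cubeSum I w p u) ∂cubeMeasure I) := by
        rw [integral_const_mul, integral_add (hexp z) (hexp (-z))]
    _ ≤ (2 * m).factorial / z ^ (2 * m) *
        (Real.exp (∑ i ∈ I, g i) + Real.exp (∑ i ∈ I, g i)) := by
        refine mul_le_mul_of_nonneg_left (add_le_add (hone z (abs_of_pos hz)) (hone (-z) ?_))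
          (by positivity)
        rw [abs_neg, abs_of_pos hz]
    _ = _ := by ring

/-- The version with Hoeffding's bound: no smallness of `z` is required, at the price of `B ^ 2` in
place of the variance. It serves for Taylor remainders and for chaining, where constants are
immaterial. -/
lemma Dissociated.integral_weightedSum_pow_le_subgaussian {n : ℕ → ℕ} {I : Finset ℕ} {r Q D m : ℕ}
    (h : Dissociated n I r Q) (w : ℕ → ℝ) {p : ℝ → ℝ} {B : ℝ} (hp : IsBoundedTrig p D B)
    (hr : 2 * m ≤ r) (hQ : 2 * m * D ≤ Q) {z : ℝ} (hz : 0 < z) :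
    ∫ x, weightedSum n I w p x ^ (2 * m) ∂unitMeasure ≤
      2 * (2 * m).factorial / z ^ (2 * m) * Real.exp (z ^ 2 * B ^ 2 * (∑ i ∈ I, w i ^ 2) / 2) := by
  refine (h.integral_weightedSum_pow_le w hp hr hQ hz (fun i ↦ (z * |w i|) ^ 2 * B ^ 2 / 2)
    fun i _ s hs ↦ ?_).trans (le_of_eq ?_)
  · rw [← hs, sq_abs]
    exact hp.integral_exp_le_subgaussian s
  · rw [Finset.mul_sum, Finset.sum_div]
    congr 2
    refine Finset.sum_congr rfl fun i _ ↦ ?_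
    rw [mul_pow, sq_abs]
    ring

lemma Dissociated.integral_weightedSum_pow_le_bernstein {n : ℕ → ℕ} {I : Finset ℕ} {r Q D m : ℕ}
    (h : Dissociated n I r Q) {p : ℝ → ℝ} {B : ℝ} (hp : IsBoundedTrig p D B)
    (hr : 2 * m ≤ r) (hQ : 2 * m * D ≤ Q) {z : ℝ} (hz : 0 < z) (hzB : z * B ≤ 1) :
    ∫ x, weightedSum n I 1 p x ^ (2 * m) ∂unitMeasure ≤ 2 * (2 * m).factorial / z ^ (2 * m) *
      Real.exp (I.card * (z ^ 2 * unitVariance p * (1 + z * B) / 2)) := by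
  refine (h.integral_weightedSum_pow_le 1 hp hr hQ hz
    (fun _ ↦ z ^ 2 * unitVariance p * (1 + z * B) / 2) fun i _ s hs ↦ ?_).trans (le_of_eq ?_)
  · simp only [Pi.one_apply, abs_one, mul_one] at hs
    rw [← hs, sq_abs]
    exact hp.integral_exp_le_bernstein (by rwa [hs])
  · rw [Finset.sum_const, nsmul_eq_mul]

/-- Truncate the exponential series at order `2 m` on the circle and on the cube. The truncated
parts have equal integrals, and both remainders are bounded by the same moment of order `2 m` over
`(2 m)!`, which together give the first error term. On the cube the characteristic function is a
product, compared with the Gaussian factor by factor, which gives the cubic sum. -/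
theorem Dissociated.norm_charFun_sub_le {n : ℕ → ℕ} {I : Finset ℕ} {r Q D m : ℕ}
    (h : Dissociated n I r Q) (w : ℕ → ℝ) {p : ℝ → ℝ} {B : ℝ} (hp : IsBoundedTrig p D B)
    (hr : 2 * m ≤ r) (hQ : 2 * m * D ≤ Q) {z : ℝ} (hz : 0 < z) (hw : ∀ i ∈ I, |w i| * B ≤ 1) :
    ‖∫ x, Complex.exp (weightedSum n I w p x * Complex.I) ∂unitMeasure -
      (Real.exp (-(unitVariance p * (∑ i ∈ I, w i ^ 2) / 2)) : ℂ)‖ ≤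
      4 / z ^ (2 * m) * Real.exp (z ^ 2 * B ^ 2 * (∑ i ∈ I, w i ^ 2) / 2) +
        ∑ i ∈ I, (|w i| * B) ^ 3 := by
  have hc := hp.continuous
  have hcs := continuous_cubeSum I w hc
  have hws := continuous_weightedSum n I w hc
  have hbd := abs_cubeSum_le I w hp.abs_le
  set A := ∑ i ∈ I, |w i| * B
  have hmom := h.integral_weightedSum_pow_le_subgaussian w hp hr hQ hz
  set E := Real.exp (z ^ 2 * B ^ 2 * (∑ i ∈ I, w i ^ 2) / 2)
  have hint_pow : ∀ k : ℕ, Integrable (fun u ↦ cubeSum I w p u ^ k) (cubeMeasure I) := fun k ↦ by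
    refine integrable_of_continuous_of_bound (by fun_prop) (A ^ k) fun u ↦ ?_
    rw [norm_pow]
    exact pow_le_pow_left₀ (norm_nonneg _) (hbd u) _
  have hfac : (0 : ℝ) < (2 * m).factorial := by positivity
  have hmom' : (∫ x, weightedSum n I w p x ^ (2 * m) ∂unitMeasure) / (2 * m).factorial ≤
      2 / z ^ (2 * m) * E := by
    rw [div_le_iff₀ hfac]
    refine hmom.trans (le_of_eq ?_)
    ring
  have hint_c : ∀ k : ℕ, Integrable (fun u ↦ ((cubeSum I w p u : ℂ) * Complex.I) ^ k /
      (k.factorial : ℂ)) (cubeMeasure I) := fun k ↦ by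
    have := ((hint_pow k).ofReal (𝕜 := ℂ)).mul_const (Complex.I ^ k / (k.factorial : ℂ))
    refine this.congr (Eventually.of_forall fun u ↦ ?_)
    simp only [Complex.coe_algebraMap]
    push_cast
    ring
  have hsum_eq : ∫ x, ∑ j ∈ Finset.range (2 * m),
      ((weightedSum n I w p x : ℂ) * Complex.I) ^ j / (j.factorial : ℂ) ∂unitMeasure =
      ∫ u, ∑ j ∈ Finset.range (2 * m),
        ((cubeSum I w p u : ℂ) * Complex.I) ^ j / (j.factorial : ℂ) ∂cubeMeasure I := by
    rw [integral_finsetSum _ fun k _ ↦ hint_c k,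
      integral_finsetSum _ fun k _ ↦ integrable_unitMeasure_of_continuous (by fun_prop)]
    refine Finset.sum_congr rfl fun j hj ↦ ?_
    have hj' : j < 2 * m := Finset.mem_range.1 hj
    have := h.integral_weightedSum_pow w hp.mem_trigPoly (m := j) (by omega)
      ((Nat.mul_le_mul_right D hj'.le).trans hQ)
    simp_rw [mul_pow, mul_div_assoc, integral_mul_const, ← Complex.ofReal_pow,
      integral_complex_ofReal, this]
  have hd1 : ‖∫ x, Complex.exp (weightedSum n I w p x * Complex.I) ∂unitMeasure -
      ∫ x, ∑ j ∈ Finset.range (2 * m),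
      ((weightedSum n I w p x : ℂ) * Complex.I) ^ j / (j.factorial : ℂ) ∂unitMeasure‖ ≤
      2 / z ^ (2 * m) * E := by
    rw [← integral_sub (integrable_unitMeasure_of_continuous (by fun_prop))
      (integrable_unitMeasure_of_continuous (by fun_prop))]
    refine le_trans ?_ hmom'
    rw [← integral_div]
    refine norm_integral_le_of_norm_le (integrable_unitMeasure_of_continuous (by fun_prop))
      (Eventually.of_forall fun x ↦ ?_)
    have := norm_exp_mul_I_sub_sum_le (2 * m) (weightedSum n I w p x)
    rwa [(even_two_mul m).pow_abs] at this
  have hd2 : ‖∫ u, Complex.exp (cubeSum I w p u * Complex.I) ∂cubeMeasure I -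
      ∫ u, ∑ j ∈ Finset.range (2 * m),
      ((cubeSum I w p u : ℂ) * Complex.I) ^ j / (j.factorial : ℂ) ∂cubeMeasure I‖ ≤
      2 / z ^ (2 * m) * E := by
    rw [← integral_sub (integrable_of_continuous_of_bound (by fun_prop) 1 fun u ↦ by
        rw [Complex.norm_exp_ofReal_mul_I]) (integrable_finsetSum _ fun k _ ↦ hint_c k)]
    refine le_trans ?_ hmom'
    rw [h.integral_weightedSum_pow w hp.mem_trigPoly hr hQ, ← integral_div]
    refine norm_integral_le_of_norm_le ((hint_pow _).div_const _)
      (Eventually.of_forall fun u ↦ ?_)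
    have := norm_exp_mul_I_sub_sum_le (2 * m) (cubeSum I w p u)
    rwa [(even_two_mul m).pow_abs] at this
  have hd3 : ‖∫ u, Complex.exp (cubeSum I w p u * Complex.I) ∂cubeMeasure I -
      (Real.exp (-(unitVariance p * (∑ i ∈ I, w i ^ 2) / 2)) : ℂ)‖ ≤ ∑ i ∈ I, (|w i| * B) ^ 3 := by
    have hR : (Real.exp (-(unitVariance p * (∑ i ∈ I, w i ^ 2) / 2)) : ℂ) =
        ∏ i ∈ I, (Real.exp (-(w i ^ 2 * unitVariance p / 2)) : ℂ) := by
      rw [← Complex.ofReal_prod, ← Real.exp_sum, Finset.sum_neg_distrib, Finset.mul_sum,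
        Finset.sum_div]
      simp_rw [mul_comm]
    rw [integral_cubeMeasure_cexp, hR]
    refine (norm_prod_sub_prod_le I _ _ (fun i _ ↦ ?_) fun i _ ↦ ?_).trans
      (Finset.sum_le_sum fun i hi ↦ hp.norm_integral_exp_sub_le (hw i hi))
    · refine (norm_integral_le_of_norm_le_const (C := 1) (Eventually.of_forall fun x ↦ ?_)).trans
        (by simp)
      rw [Complex.norm_exp_ofReal_mul_I]
    · rw [Complex.norm_real, Real.norm_of_nonneg (Real.exp_pos _).le, Real.exp_le_one_iff]
      have := IsBoundedTrig.unitVariance_nonneg p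
      have : 0 ≤ w i ^ 2 * unitVariance p := by positivity
      linarith
  rw [hsum_eq] at hd1
  rw [norm_sub_rev] at hd2
  have t1 := norm_sub_le_norm_sub_add_norm_sub
    (∫ x, Complex.exp (weightedSum n I w p x * Complex.I) ∂unitMeasure)
    (∫ u, ∑ j ∈ Finset.range (2 * m),
      ((cubeSum I w p u : ℂ) * Complex.I) ^ j / (j.factorial : ℂ) ∂cubeMeasure I)
    (∫ u, Complex.exp (cubeSum I w p u * Complex.I) ∂cubeMeasure I)
  have t2 := norm_sub_le_norm_sub_add_norm_sub
    (∫ x, Complex.exp (weightedSum n I w p x * Complex.I) ∂unitMeasure)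
    (∫ u, Complex.exp (cubeSum I w p u * Complex.I) ∂cubeMeasure I)
    (Real.exp (-(unitVariance p * (∑ i ∈ I, w i ^ 2) / 2)) : ℂ)
  have : 4 / z ^ (2 * m) * E = 2 / z ^ (2 * m) * E + 2 / z ^ (2 * m) * E := by ring
  linarith

/-! ### Dyadic approximations of the sums -/

lemma expChar_add_one (m : ℤ) (x : ℝ) : expChar m (x + 1) = expChar m x := by
  simp only [expChar]
  rw [Complex.exp_eq_exp_iff_exists_int]
  exact ⟨m, by push_cast; ring⟩

lemma IsBoundedTrig.periodic {p : ℝ → ℝ} {D : ℕ} {B : ℝ} (hp : IsBoundedTrig p D B) :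
    Function.Periodic p 1 := by
  intro x
  obtain ⟨c, hc⟩ := exists_coeff_of_mem_trigPoly hp.mem_trigPoly
  apply Complex.ofReal_injective
  rw [hc, hc]
  simp_rw [expChar_add_one]

lemma integral_comp_natCast_mul {g : ℝ → ℝ} (hg : Function.Periodic g 1) (hgm : Measurable g)
    {B : ℝ} (hB : ∀ x, |g x| ≤ B) {k : ℕ} (hk : 0 < k) :
    ∫ x, g ((k : ℝ) * x) ∂unitMeasure = ∫ x, g x ∂unitMeasure := by
  have hk' : (k : ℝ) ≠ 0 := by exact_mod_cast hk.ne'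
  rw [integral_unitMeasure, integral_unitMeasure, intervalIntegral.integral_comp_mul_left _ hk']
  have := hg.intervalIntegral_add_zsmul_eq (k : ℤ) 0 fun a b ↦
    ⟨IsAdmissible.integrable_of_measurable_of_bound hgm hB,
      IsAdmissible.integrable_of_measurable_of_bound hgm hB⟩
  simp only [zero_add, natCast_zsmul, nsmul_eq_mul, mul_one] at this
  rw [mul_zero, mul_one, this, smul_eq_mul]
  field_simp

/-- Trigonometric approximations `p κ` of `f`, of degree `2 ^ (6 κ)`. -/
structure IsDyadicApprox (f : ℝ → ℝ) (p : ℕ → ℝ → ℝ) (B C : ℝ) : Prop where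
  bound_pos : 0 < B
  const_pos : 0 < C
  measurable : Measurable f
  periodic : Function.Periodic f 1
  abs_le : ∀ x, |f x| ≤ B
  trig : ∀ κ, IsBoundedTrig (p κ) (2 ^ (6 * κ)) B
  integral_abs_sub_le : ∀ κ, ∫ x, |f x - p κ x| ∂unitMeasure ≤ C / 8 ^ κ

/-- Degree `2 ^ (6 κ)` has square root `8 ^ κ`: the error then beats the number `2 ^ κ` of terms,
while the degree leaves room below the coefficient bound `2 ^ (8 κ)`. -/
lemma IsAdmissible.exists_dyadicApprox {f : ℝ → ℝ} (hf : IsAdmissible f) :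
    ∃ p B C, IsDyadicApprox f p B C := by
  obtain ⟨B, C, hB0, hC0, hB, h⟩ := hf.exists_trigPoly_approx
  choose p h1 h2 h3 h4 using fun κ : ℕ ↦ h (2 ^ (6 * κ)) Nat.one_le_two_pow
  refine ⟨p, B, C, hB0, hC0, hf.measurable, hf.periodic_one, hB, fun κ ↦ ⟨h1 κ, h2 κ, h3 κ⟩,
    fun κ ↦ (h4 κ).trans (le_of_eq ?_)⟩
  congr 1
  push_cast
  rw [show 6 * κ = 3 * κ * 2 by ring, pow_mul, Real.sqrt_sq (by positivity), pow_mul]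
  norm_num

/-- The total deviation of the first `2 ^ κ` terms from their trigonometric approximations. -/
noncomputable def approxError (f : ℝ → ℝ) (p : ℕ → ℝ → ℝ) (n : ℕ → ℕ) (κ : ℕ) (x : ℝ) : ℝ :=
  ∑ i ∈ Finset.Icc 1 (2 ^ κ), |f ((n i : ℝ) * x) - p κ ((n i : ℝ) * x)|

lemma approxError_nonneg (f : ℝ → ℝ) (p : ℕ → ℝ → ℝ) (n : ℕ → ℕ) (κ : ℕ) (x : ℝ) :
    0 ≤ approxError f p n κ x := Finset.sum_nonneg fun _ _ ↦ abs_nonneg _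

lemma l2Norm_nonneg (f : ℝ → ℝ) : 0 ≤ l2Norm f := Real.sqrt_nonneg _

lemma l2Norm_sq (f : ℝ → ℝ) : l2Norm f ^ 2 = ∫ x, f x ^ 2 ∂unitMeasure := by
  rw [l2Norm, ← integral_unitMeasure, Real.sq_sqrt (integral_nonneg fun _ ↦ sq_nonneg _)]

namespace IsDyadicApprox

variable {f : ℝ → ℝ} {p : ℕ → ℝ → ℝ} {B C : ℝ} {n : ℕ → ℕ}

lemma measurable_approxError (h : IsDyadicApprox f p B C) (κ : ℕ) :
    Measurable (approxError f p n κ) := by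
  have h1 := h.measurable
  have h2 := (h.trig κ).continuous.measurable
  unfold approxError
  fun_prop

lemma abs_sub_le (h : IsDyadicApprox f p B C) (κ : ℕ) (x : ℝ) : |f x - p κ x| ≤ 2 * B := by
  have := abs_sub (f x) (p κ x)
  linarith [h.abs_le x, (h.trig κ).abs_le x]

lemma integrable_approxError (h : IsDyadicApprox f p B C) (κ : ℕ) :
    Integrable (approxError f p n κ) unitMeasure := by
  refine IsAdmissible.integrable_of_measurable_of_bound (h.measurable_approxError κ)
    (B := ∑ i ∈ Finset.Icc 1 (2 ^ κ), 2 * B) fun x ↦ ?_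
  rw [abs_of_nonneg (approxError_nonneg _ _ _ _ _)]
  exact Finset.sum_le_sum fun i _ ↦ h.abs_sub_le κ _

lemma integral_approxError_le (h : IsDyadicApprox f p B C) (hn : ∀ k, 1 ≤ k → 0 < n k) (κ : ℕ) :
    ∫ x, approxError f p n κ x ∂unitMeasure ≤ C / 4 ^ κ := by
  have h1 := h.measurable
  have h2 := (h.trig κ).continuous.measurable
  have hper : Function.Periodic (fun x ↦ |f x - p κ x|) 1 := fun x ↦ by
    simp only
    rw [h.periodic, (h.trig κ).periodic]
  unfold approxError
  rw [integral_finsetSum _ fun i _ ↦ IsAdmissible.integrable_of_measurable_of_bound (B := 2 * B)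
    (by fun_prop) fun x ↦ by rw [abs_abs]; exact h.abs_sub_le κ _]
  calc ∑ i ∈ Finset.Icc 1 (2 ^ κ), ∫ x, |f ((n i : ℝ) * x) - p κ ((n i : ℝ) * x)| ∂unitMeasure
      ≤ ∑ i ∈ Finset.Icc 1 (2 ^ κ), C / 8 ^ κ := by
        refine Finset.sum_le_sum fun i hi ↦ ?_
        rw [integral_comp_natCast_mul hper (by fun_prop) (B := 2 * B)
          (fun x ↦ by rw [abs_abs]; exact h.abs_sub_le κ x) (hn i (Finset.mem_Icc.1 hi).1)]
        exact h.integral_abs_sub_le κ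
    _ = C / 4 ^ κ := by
        rw [Finset.sum_const, Nat.card_Icc, nsmul_eq_mul]
        simp only [add_tsub_cancel_right]
        push_cast
        rw [show (8 : ℝ) ^ κ = 2 ^ κ * 4 ^ κ by rw [← mul_pow]; norm_num]
        field_simp

/-- Two errors occur: at most `2 ^ (κ / 8)` discarded indices, each bounded by `B`, and the
replacement of `f` by `p κ` on the rest. The second is dominated by `approxError`, which does not
depend on `J`, so one exceptional set serves all partial sums at the scale. -/
lemma abs_sum_sub_weightedSum_le (h : IsDyadicApprox f p B C) (hinj : Set.InjOn n (Set.Ici 1))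
    (κ : ℕ) {J : Finset ℕ} (hJ : J ⊆ Finset.Icc 1 (2 ^ κ)) (x : ℝ) :
    |∑ i ∈ J, f ((n i : ℝ) * x) - weightedSum n (J ∩ dyadicBulk n κ) 1 (p κ) x| ≤
      2 ^ (κ / 8) * B + approxError f p n κ x := by
  classical
  have h1 : ∑ i ∈ J, f ((n i : ℝ) * x) - weightedSum n (J ∩ dyadicBulk n κ) 1 (p κ) x =
      ∑ i ∈ J \ dyadicBulk n κ, f ((n i : ℝ) * x) +
        ∑ i ∈ J ∩ dyadicBulk n κ, (f ((n i : ℝ) * x) - p κ ((n i : ℝ) * x)) := by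
    rw [← Finset.sum_inter_add_sum_sdiff J (dyadicBulk n κ), Finset.sum_sub_distrib, weightedSum]
    simp only [Pi.one_apply, one_mul]
    ring
  rw [h1]
  refine (abs_add_le _ _).trans (add_le_add ?_ ?_)
  · refine (Finset.abs_sum_le_sum_abs _ _).trans
      ((Finset.sum_le_sum fun i _ ↦ h.abs_le _).trans ?_)
    rw [Finset.sum_const, nsmul_eq_mul]
    refine mul_le_mul_of_nonneg_right ?_ h.bound_pos.le
    have := (Finset.card_le_card (Finset.sdiff_subset_sdiff hJ le_rfl)).trans
      (card_sdiff_bulk_le hinj (2 ^ (κ / 8)) (2 ^ κ))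
    exact_mod_cast this
  · refine (Finset.abs_sum_le_sum_abs _ _).trans ?_
    exact Finset.sum_le_sum_of_subset_of_nonneg (Finset.inter_subset_left.trans hJ)
      fun _ _ _ ↦ abs_nonneg _

lemma card_le_card_inter_add (hinj : Set.InjOn n (Set.Ici 1)) (κ : ℕ) {J : Finset ℕ}
    (hJ : J ⊆ Finset.Icc 1 (2 ^ κ)) : J.card ≤ (J ∩ dyadicBulk n κ).card + 2 ^ (κ / 8) := by
  classical
  rw [← Finset.card_inter_add_card_sdiff J (dyadicBulk n κ)]
  have := (Finset.card_le_card (Finset.sdiff_subset_sdiff hJ le_rfl)).trans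
      (card_sdiff_bulk_le hinj (2 ^ (κ / 8)) (2 ^ κ))
  exact Nat.add_le_add_left this _

/-- `L¹` convergence together with the common bound `B` gives convergence of second moments. -/
lemma tendsto_unitVariance (h : IsDyadicApprox f p B C) :
    Tendsto (fun κ ↦ unitVariance (p κ)) atTop (𝓝 (l2Norm f ^ 2)) := by
  have h1 := h.measurable
  rw [tendsto_iff_norm_sub_tendsto_zero]
  have hlim : Tendsto (fun κ : ℕ ↦ 2 * B * (C * (1 / 8 : ℝ) ^ κ)) atTop (𝓝 0) := by
    have := ((tendsto_pow_atTop_nhds_zero_of_lt_one (r := (1 / 8 : ℝ)) (by norm_num)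
      (by norm_num)).const_mul C).const_mul (2 * B)
    simpa using this
  refine squeeze_zero (fun _ ↦ norm_nonneg _) (fun κ ↦ ?_) hlim
  have hc := (h.trig κ).continuous
  have hi1 : Integrable (fun x ↦ p κ x ^ 2) unitMeasure :=
    integrable_unitMeasure_of_continuous (by fun_prop)
  have hi2 : Integrable (fun x ↦ f x ^ 2) unitMeasure := by
    refine IsAdmissible.integrable_of_measurable_of_bound (B := B ^ 2) (by fun_prop) fun x ↦ ?_
    rw [abs_pow]
    exact pow_le_pow_left₀ (abs_nonneg _) (h.abs_le x) 2
  have hm := hc.measurable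
  have hi3 : Integrable (fun x ↦ |f x - p κ x|) unitMeasure :=
    IsAdmissible.integrable_of_measurable_of_bound (B := 2 * B) (by fun_prop)
      fun x ↦ by rw [abs_abs]; exact h.abs_sub_le κ x
  rw [l2Norm_sq, unitVariance, ← integral_sub hi1 hi2]
  calc ‖∫ x, (p κ x ^ 2 - f x ^ 2) ∂unitMeasure‖
      ≤ ∫ x, 2 * B * |f x - p κ x| ∂unitMeasure := by
        refine norm_integral_le_of_norm_le (hi3.const_mul _) (Eventually.of_forall fun x ↦ ?_)
        rw [Real.norm_eq_abs, show p κ x ^ 2 - f x ^ 2 = -((p κ x + f x) * (f x - p κ x)) by ring,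
          abs_neg, abs_mul]
        refine mul_le_mul_of_nonneg_right ?_ (abs_nonneg _)
        have := abs_add_le (p κ x) (f x)
        linarith [h.abs_le x, (h.trig κ).abs_le x]
    _ ≤ 2 * B * (C * (1 / 8 : ℝ) ^ κ) := by
        rw [integral_const_mul, one_div, inv_pow, ← div_eq_mul_inv]
        exact mul_le_mul_of_nonneg_left (h.integral_abs_sub_le κ) (by linarith [h.bound_pos])

end IsDyadicApprox

/-! ### The central limit theorem -/

lemma norm_exp_mul_I_sub_exp_mul_I_le (a b : ℝ) :
    ‖Complex.exp (a * Complex.I) - Complex.exp (b * Complex.I)‖ ≤ |a - b| := by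
  have h1 : Complex.exp (a * Complex.I) - Complex.exp (b * Complex.I) =
      Complex.exp (b * Complex.I) * (Complex.exp (((a - b : ℝ) : ℂ) * Complex.I) - 1) := by
    rw [mul_sub, ← Complex.exp_add, mul_one]
    congr 2
    push_cast
    ring
  rw [h1, norm_mul, Complex.norm_exp_ofReal_mul_I, one_mul]
  simpa using norm_exp_mul_I_sub_sum_le 1 (a - b)

lemma map_coe_unitInterval :
    (volume : Measure unitInterval).map (fun x : unitInterval ↦ (x : ℝ)) = unitMeasure := by
  rw [show (volume : Measure unitInterval) = Measure.comap Subtype.val volume from rfl,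
    (MeasurableEmbedding.subtype_coe measurableSet_Icc).map_comap, Subtype.range_coe, unitMeasure]
  exact (restrict_Ioc_eq_restrict_Icc).symm

lemma tendsto_clog_two : Tendsto (Nat.clog 2) atTop atTop := by
  refine tendsto_atTop_mono' _ ?_ (tendsto_atTop_atTop.2 fun b ↦ ⟨2 ^ b, fun a ha ↦ ?_⟩ :
    Tendsto (Nat.log 2) atTop atTop)
  · exact Eventually.of_forall fun N ↦ Nat.log_le_clog 2 N
  · rw [← Nat.log_pow (b := 2) (by norm_num) b]
    exact Nat.log_mono_right ha

lemma two_pow_clog_le {N : ℕ} (hN : 1 ≤ N) : 2 ^ Nat.clog 2 N ≤ 2 * N := by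
  rcases hN.eq_or_lt with rfl | h
  · simp
  · have h1 := Nat.pow_pred_clog_lt_self (b := 2) (by norm_num) h
    have h2 : 0 < Nat.clog 2 N := Nat.clog_pos (by norm_num) h
    calc 2 ^ Nat.clog 2 N = 2 * 2 ^ (Nat.clog 2 N).pred := by
          rw [← pow_succ', ← Nat.succ_eq_add_one, Nat.succ_pred_eq_of_pos h2]
      _ ≤ _ := by omega

lemma tendsto_two_pow_clog_div_sqrt :
    Tendsto (fun N : ℕ ↦ (2 : ℝ) ^ (Nat.clog 2 N / 8) / √N) atTop (𝓝 0) := by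
  have hlim : Tendsto (fun N : ℕ ↦ 2 / √√(N : ℝ)) atTop (𝓝 0) :=
    ((Real.tendsto_sqrt_atTop.comp Real.tendsto_sqrt_atTop).comp
      tendsto_natCast_atTop_atTop).const_div_atTop 2
  refine squeeze_zero' (Eventually.of_forall fun N ↦ by positivity) ?_ hlim
  filter_upwards [eventually_ge_atTop 1] with N hN
  have hN' : (1 : ℝ) ≤ N := by exact_mod_cast hN
  -- The discarded number is of order `N ^ (1 / 8)`; the cruder bound `2 * N ^ (1 / 4)` already
  -- suffices and keeps the computation to square roots.
  set y := √√(N : ℝ) with hy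
  have hy2 : √(N : ℝ) = y ^ 2 := (Real.sq_sqrt (Real.sqrt_nonneg _)).symm
  have hy4 : (N : ℝ) = y ^ 4 := by
    rw [show y ^ 4 = (y ^ 2) ^ 2 by ring, ← hy2, Real.sq_sqrt (by positivity)]
  have hy1 : 1 ≤ y := by
    rw [hy, Real.one_le_sqrt, Real.one_le_sqrt]
    exact hN'
  have h1 : ((2 : ℝ) ^ (Nat.clog 2 N / 8)) ^ 8 ≤ 2 * N := by
    have : (2 ^ (Nat.clog 2 N / 8)) ^ 8 ≤ 2 * N := by
      rw [← pow_mul]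
      exact (Nat.pow_le_pow_right (by norm_num) (Nat.div_mul_le_self _ _)).trans
        (two_pow_clog_le hN)
    exact_mod_cast this
  have h2 : (2 : ℝ) ^ (Nat.clog 2 N / 8) ≤ 2 * y := by
    refine le_of_pow_le_pow_left₀ (n := 8) (by norm_num) (by positivity) (h1.trans ?_)
    rw [hy4, mul_pow]
    have : y ^ 4 ≤ y ^ 8 := pow_le_pow_right₀ hy1 (by norm_num)
    nlinarith [pow_pos (zero_lt_one.trans_le hy1) 8]
  rw [hy2, div_le_div_iff₀ (by positivity) (by positivity)]
  nlinarith

/-- A power of order `2 m ≤ 2 κ` of a polynomial of degree `2 ^ (6 κ)` stays within the coefficient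
bound of `dyadicBulk`. -/
lemma two_mul_mul_two_pow_le {m κ : ℕ} (h : m ≤ κ) :
    2 * m * 2 ^ (6 * κ) ≤ 2 ^ (8 * κ) := by
  have h1 : 2 * m ≤ 2 ^ (2 * κ) := by
    have h2 : κ < 2 ^ κ := Nat.lt_two_pow_self
    have h3 : 1 ≤ 2 ^ κ := Nat.one_le_two_pow
    rw [two_mul κ, pow_add]
    rcases Nat.eq_zero_or_pos κ with rfl | hk
    · omega
    · have : 2 ≤ 2 ^ κ := by
        calc 2 = 2 ^ 1 := rfl
          _ ≤ 2 ^ κ := Nat.pow_le_pow_right (by norm_num) hk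
      nlinarith
  calc 2 * m * 2 ^ (6 * κ) ≤ 2 ^ (2 * κ) * 2 ^ (6 * κ) := Nat.mul_le_mul_right _ h1
    _ = _ := by rw [← pow_add]; congr 1; ring

/-- With `κ = Nat.clog 2 N`, the sum is replaced by its bulk polynomial version at a cost `o(√N)` in
`L¹`. The characteristic function of the latter is nearly Gaussian, and its variance converges
because the bulk contains asymptotically all of `[1, N]`. -/
theorem IsDyadicApprox.tendsto_integral_cexp {f : ℝ → ℝ} {p : ℕ → ℝ → ℝ} {B C : ℝ}
    (h : IsDyadicApprox f p B C) {ω : ℕ → ℝ} {n : ℕ → ℕ} (hω_lim : Tendsto ω atTop atTop)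
    (hn_pos : ∀ k, 1 ≤ k → 0 < n k) (hn_inj : Set.InjOn n (Set.Ici 1)) (hA : ConditionA ω n)
    (t : ℝ) :
    Tendsto (fun N : ℕ ↦ ∫ x, Complex.exp ((t * ((√(N : ℝ))⁻¹ *
        ∑ k ∈ Finset.Icc 1 N, f ((n k : ℝ) * x)) : ℝ) * Complex.I) ∂unitMeasure) atTop
      (𝓝 (Real.exp (-(l2Norm f ^ 2 * t ^ 2 / 2)) : ℂ)) := by
  classical
  have hfm := h.measurable
  set κ : ℕ → ℕ := Nat.clog 2
  set I : ℕ → Finset ℕ := fun N ↦ Finset.Icc 1 N ∩ dyadicBulk n (κ N) with hI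
  set q : ℕ → ℝ := fun N ↦ 2 ^ (κ N / 8) with hq
  have hq0 : Tendsto (fun N ↦ q N / √N) atTop (𝓝 0) := tendsto_two_pow_clog_div_sqrt
  have hJ : ∀ N, Finset.Icc 1 N ⊆ Finset.Icc 1 (2 ^ κ N) := fun N ↦
    Finset.Icc_subset_Icc_right (Nat.le_pow_clog (by norm_num) N)
  set T : ℕ → ℝ → ℝ := fun N ↦ weightedSum n (I N) (fun _ ↦ t / √N) (p (κ N)) with hT
  have hTc : ∀ N, Continuous (T N) := fun N ↦ continuous_weightedSum _ _ _ (h.trig _).continuous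
  have hT1 : ∀ N x, T N x = t / √N * weightedSum n (I N) 1 (p (κ N)) x := fun N x ↦ by
    simp [hT, weightedSum, Finset.mul_sum]
  set V : ℕ → ℝ := fun N ↦ ∑ i ∈ I N, (t / √(N : ℝ)) ^ 2 with hV
  have hVeq : ∀ N : ℕ, V N = t ^ 2 * ((I N).card / N) := fun N ↦ by
    rw [hV]
    simp only
    rw [Finset.sum_const, nsmul_eq_mul, div_pow, Real.sq_sqrt (Nat.cast_nonneg N)]
    ring
  have hcard_le : ∀ N, (I N).card ≤ N := fun N ↦ by
    have := Finset.card_le_card (Finset.inter_subset_left (s₁ := Finset.Icc 1 N)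
      (s₂ := dyadicBulk n (κ N)))
    simpa using this
  have hcard : Tendsto (fun N ↦ ((I N).card : ℝ) / N) atTop (𝓝 1) := by
    rw [tendsto_iff_norm_sub_tendsto_zero]
    refine squeeze_zero' (Eventually.of_forall fun _ ↦ norm_nonneg _) ?_ hq0
    filter_upwards [eventually_ge_atTop 1] with N hN
    have hN' : (1 : ℝ) ≤ N := by exact_mod_cast hN
    have h1 : ((I N).card : ℝ) ≤ N := by exact_mod_cast hcard_le N
    have h2 : (N : ℝ) ≤ (I N).card + q N := by
      have := IsDyadicApprox.card_le_card_inter_add hn_inj (κ N) (hJ N)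
      rw [Nat.card_Icc, Nat.add_sub_cancel] at this
      simp only [hq, hI]
      exact_mod_cast this
    have hs : √(N : ℝ) ≤ N := by
      rw [Real.sqrt_le_left (by linarith)]
      nlinarith
    rw [Real.norm_eq_abs, abs_sub_comm, abs_of_nonneg (by
      rw [sub_nonneg, div_le_one (by linarith)]; exact h1)]
    calc 1 - ((I N).card : ℝ) / N = (N - (I N).card) / N := by field_simp
      _ ≤ q N / N := by gcongr; linarith
      _ ≤ q N / √N := by gcongr
  have hκ : Tendsto κ atTop atTop := tendsto_clog_two
  have hVlim : Tendsto (fun N ↦ (Real.exp (-(unitVariance (p (κ N)) * V N / 2)) : ℂ)) atTop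
      (𝓝 (Real.exp (-(l2Norm f ^ 2 * t ^ 2 / 2)) : ℂ)) := by
    refine (Complex.continuous_ofReal.tendsto _).comp ((Real.continuous_exp.tendsto _).comp ?_)
    simp_rw [hVeq]
    have := (((h.tendsto_unitVariance.comp hκ).mul (hcard.const_mul (t ^ 2))).div_const 2).neg
    simpa using this
  have ha : Tendsto (fun N : ℕ ↦ ∫ x, Complex.exp ((t * ((√(N : ℝ))⁻¹ *
        ∑ k ∈ Finset.Icc 1 N, f ((n k : ℝ) * x)) : ℝ) * Complex.I) ∂unitMeasure -
        ∫ x, Complex.exp (T N x * Complex.I) ∂unitMeasure) atTop (𝓝 0) := by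
    rw [tendsto_zero_iff_norm_tendsto_zero]
    have hlim : Tendsto (fun N : ℕ ↦ |t| * ((B + C) * (q N / √N))) atTop (𝓝 0) := by
      simpa using (hq0.const_mul (B + C)).const_mul |t|
    refine squeeze_zero' (Eventually.of_forall fun _ ↦ norm_nonneg _) ?_ hlim
    filter_upwards [eventually_ge_atTop 1] with N hN
    have hs : 0 < √(N : ℝ) := Real.sqrt_pos.2 (by exact_mod_cast hN)
    have hTm := (hTc N).measurable
    rw [← integral_sub]
    · have hint := (((integrable_const (q N * B)).add
        (h.integrable_approxError (n := n) (κ N))).const_mul (|t| / √N))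
      refine (norm_integral_le_of_norm_le hint (Eventually.of_forall fun x ↦ ?_)).trans ?_
      · refine (norm_exp_mul_I_sub_exp_mul_I_le _ _).trans ?_
        rw [hT1, show t * ((√(N : ℝ))⁻¹ * ∑ k ∈ Finset.Icc 1 N, f ((n k : ℝ) * x)) - t / √N *
          weightedSum n (I N) 1 (p (κ N)) x = t / √N * (∑ k ∈ Finset.Icc 1 N, f ((n k : ℝ) * x) -
            weightedSum n (I N) 1 (p (κ N)) x) by ring, abs_mul, abs_div, abs_of_pos hs]
        exact mul_le_mul_of_nonneg_left (h.abs_sum_sub_weightedSum_le hn_inj (κ N) (hJ N) x)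
          (by positivity)
      · rw [integral_const_mul]
        simp only [Pi.add_apply]
        rw [integral_add (integrable_const _) (h.integrable_approxError (κ N))]
        have h1 := h.integral_approxError_le hn_pos (κ N)
        have h2 : C / 4 ^ κ N ≤ C * q N := by
          have h3 : (1 : ℝ) ≤ 4 ^ κ N := one_le_pow₀ (by norm_num)
          have h4 : 1 ≤ q N := one_le_pow₀ (by norm_num)
          calc C / 4 ^ κ N ≤ C := div_le_self h.const_pos.le h3
            _ ≤ C * q N := le_mul_of_one_le_right h.const_pos.le h4
        simp only [integral_const, probReal_univ, one_smul]
        calc |t| / √N * (q N * B + ∫ x, approxError f p n (κ N) x ∂unitMeasure)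
            ≤ |t| / √N * (q N * B + C * q N) := by gcongr; linarith
          _ = _ := by field_simp
    · refine Integrable.of_bound (Measurable.aestronglyMeasurable (by fun_prop)) 1
        (Eventually.of_forall fun x ↦ ?_)
      rw [Complex.norm_exp_ofReal_mul_I]
    · refine Integrable.of_bound (Measurable.aestronglyMeasurable (by fun_prop)) 1
        (Eventually.of_forall fun x ↦ ?_)
      rw [Complex.norm_exp_ofReal_mul_I]
  have hb : Tendsto (fun N : ℕ ↦ ∫ x, Complex.exp (T N x * Complex.I) ∂unitMeasure -
      (Real.exp (-(unitVariance (p (κ N)) * V N / 2)) : ℂ)) atTop (𝓝 0) := by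
    rw [Metric.tendsto_nhds]
    intro ε hε
    have hlim : Tendsto (fun m : ℕ ↦ 4 * Real.exp (2 * B ^ 2 * t ^ 2) * (1 / 4 : ℝ) ^ m) atTop
        (𝓝 0) := by
      simpa using (tendsto_pow_atTop_nhds_zero_of_lt_one (r := (1 / 4 : ℝ)) (by norm_num)
        (by norm_num)).const_mul (4 * Real.exp (2 * B ^ 2 * t ^ 2))
    -- The order is fixed before `N`: with `z = 2` below, the truncation error is at most `4 exp (2
    -- B² t²) 4 ^ (-m)` uniformly in `N`. Only a bounded order of dissociation is therefore needed.
    obtain ⟨m, hm⟩ := (hlim.eventually (gt_mem_nhds (half_pos hε))).exists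
    have hdis := hκ.eventually (hA.dissociated_dyadicBulk hn_pos hω_lim (fun _ ↦ 2 * m)
      ((hω_lim.comp tendsto_two_pow_div).eventually_ge_atTop _))
    have hsqrt : Tendsto (fun N : ℕ ↦ (√(N : ℝ))⁻¹) atTop (𝓝 0) :=
      (Real.tendsto_sqrt_atTop.comp tendsto_natCast_atTop_atTop).inv_tendsto_atTop
    have hw1 : ∀ᶠ N : ℕ in atTop, |t| * B * (√(N : ℝ))⁻¹ < 1 := by
      have := hsqrt.const_mul (|t| * B)
      rw [mul_zero] at this
      exact this.eventually (gt_mem_nhds one_pos)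
    have hw2 : ∀ᶠ N : ℕ in atTop, (|t| * B) ^ 3 * (√(N : ℝ))⁻¹ < ε / 2 := by
      have := hsqrt.const_mul ((|t| * B) ^ 3)
      rw [mul_zero] at this
      exact this.eventually (gt_mem_nhds (half_pos hε))
    filter_upwards [hdis, hw1, hw2, hκ.eventually_ge_atTop m, eventually_ge_atTop 1] with
      N hd h1 h2 h3 hN
    have hN' : (1 : ℝ) ≤ N := by exact_mod_cast hN
    have hs : 0 < √(N : ℝ) := Real.sqrt_pos.2 (by linarith)
    have hss : √(N : ℝ) ^ 2 = N := Real.sq_sqrt (by linarith)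
    have habs : |t / √(N : ℝ)| = |t| * (√(N : ℝ))⁻¹ := by
      rw [abs_div, abs_of_pos hs, div_eq_mul_inv]
    have key := (hd.mono (Finset.inter_subset_right (s₁ := Finset.Icc 1 N)) le_rfl
      le_rfl).norm_charFun_sub_le (fun _ ↦ t / √N) (h.trig (κ N)) le_rfl
      (two_mul_mul_two_pow_le h3) (z := 2) two_pos (fun i _ ↦ by
        rw [habs]; nlinarith)
    rw [dist_zero_right]
    refine key.trans_lt ?_
    have hVN : V N ≤ t ^ 2 := by
      rw [hVeq]
      refine mul_le_of_le_one_right (sq_nonneg t) ((div_le_one (by linarith)).2 ?_)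
      exact_mod_cast hcard_le N
    have e1 : 4 / (2 : ℝ) ^ (2 * m) * Real.exp (2 ^ 2 * B ^ 2 * V N / 2) ≤
        4 * Real.exp (2 * B ^ 2 * t ^ 2) * (1 / 4 : ℝ) ^ m := by
      have : Real.exp (2 ^ 2 * B ^ 2 * V N / 2) ≤ Real.exp (2 * B ^ 2 * t ^ 2) := by
        refine Real.exp_le_exp.2 ?_
        nlinarith [sq_nonneg B]
      rw [pow_mul, one_div, inv_pow, show (2 : ℝ) ^ 2 = 4 by norm_num] at *
      calc 4 / (4 : ℝ) ^ m * Real.exp (4 * B ^ 2 * V N / 2)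
          ≤ 4 / (4 : ℝ) ^ m * Real.exp (2 * B ^ 2 * t ^ 2) := by gcongr
        _ = _ := by ring
    have e2 : ∑ i ∈ I N, (|t / √(N : ℝ)| * B) ^ 3 ≤ (|t| * B) ^ 3 * (√(N : ℝ))⁻¹ := by
      rw [Finset.sum_const, nsmul_eq_mul, habs]
      have h4 : ((I N).card : ℝ) ≤ √(N : ℝ) ^ 2 := by
        rw [hss]
        exact_mod_cast hcard_le N
      have hB := h.bound_pos
      calc ((I N).card : ℝ) * (|t| * (√(N : ℝ))⁻¹ * B) ^ 3
          ≤ √(N : ℝ) ^ 2 * (|t| * (√(N : ℝ))⁻¹ * B) ^ 3 := by gcongr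
        _ = _ := by field_simp
    change 4 / (2 : ℝ) ^ (2 * m) * Real.exp (2 ^ 2 * B ^ 2 * V N / 2) + _ < ε
    linarith
  have := (ha.add hb).add hVlim
  simpa using this

/-- Lévy's continuity theorem, after carrying the law from `unitInterval` to `unitMeasure`. -/
theorem IsAdmissible.satisfiesCLT {f : ℝ → ℝ} (hf : IsAdmissible f) {ω : ℕ → ℝ} {n : ℕ → ℕ}
    (hω_lim : Tendsto ω atTop atTop) (hn_pos : ∀ k, 1 ≤ k → 0 < n k)
    (hn_inj : Set.InjOn n (Set.Ici 1)) (hA : ConditionA ω n) : SatisfiesCLT f n := by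
  obtain ⟨p, B, C, h⟩ := hf.exists_dyadicApprox
  have hfm := hf.measurable
  have hmeas : ∀ N : ℕ, Measurable fun x : ℝ ↦
      (√(N : ℝ))⁻¹ * ∑ k ∈ Finset.Icc 1 N, f ((n k : ℝ) * x) := fun N ↦ by fun_prop
  refine ⟨fun N ↦ ((hmeas N).comp measurable_subtype_coe).aemeasurable, aemeasurable_id,
    ProbabilityMeasure.tendsto_iff_tendsto_charFun.2 fun t ↦ ?_⟩
  simp only [ProbabilityMeasure.coe_mk, Measure.map_id]
  have h1 : ∀ N : ℕ, charFun ((volume : Measure unitInterval).map fun x : unitInterval ↦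
      (√(N : ℝ))⁻¹ * ∑ k ∈ Finset.Icc 1 N, f ((n k : ℝ) * (x : ℝ))) t =
      ∫ x, Complex.exp ((t * ((√(N : ℝ))⁻¹ *
        ∑ k ∈ Finset.Icc 1 N, f ((n k : ℝ) * x)) : ℝ) * Complex.I) ∂unitMeasure := by
    intro N
    have : (volume : Measure unitInterval).map (fun x : unitInterval ↦
        (√(N : ℝ))⁻¹ * ∑ k ∈ Finset.Icc 1 N, f ((n k : ℝ) * (x : ℝ))) =
        unitMeasure.map fun x ↦ (√(N : ℝ))⁻¹ * ∑ k ∈ Finset.Icc 1 N, f ((n k : ℝ) * x) := by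
      rw [← map_coe_unitInterval, Measure.map_map (hmeas N) measurable_subtype_coe]
      rfl
    rw [this, charFun_apply_real, integral_map (hmeas N).aemeasurable (by fun_prop)]
    push_cast
    rfl
  simp_rw [h1]
  convert h.tendsto_integral_cexp hω_lim hn_pos hn_inj hA t using 2
  rw [charFun_gaussianReal, Complex.ofReal_exp]
  congr 1
  rw [Real.coe_toNNReal _ (sq_nonneg _)]
  push_cast
  ring

/-! ### Tail bounds from high moments -/

/-- A Stirling bound with the exact exponential rate, up to a linear factor. The induction step is
`exp 1 ≤ ((k + 2) / (k + 1)) ^ (k + 2)`. -/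
lemma factorial_le_mul_exp (k : ℕ) :
    ((k + 1).factorial : ℝ) ≤ (k + 1) ^ (k + 2) * Real.exp (-k) := by
  induction k with
  | zero => simp
  | succ k ih =>
    rw [Nat.factorial_succ]
    push_cast
    have hk : (0 : ℝ) < k + 1 := by positivity
    have h1 : (k + 1 : ℝ) ^ (k + 2) * Real.exp 1 ≤ (k + 1 + 1) ^ (k + 2) := by
      have h2 : Real.exp (1 / (k + 2)) ≤ (k + 2) / (k + 1) := by
        have h3 := Real.add_one_le_exp (-(1 / (k + 2) : ℝ))
        rw [Real.exp_neg] at h3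
        have h4 : -(1 / (k + 2) : ℝ) + 1 = (k + 1) / (k + 2) := by field_simp; ring
        rw [h4] at h3
        have h5 := inv_anti₀ (by positivity) h3
        rwa [inv_inv, inv_div] at h5
      have h6 : Real.exp 1 ≤ ((k + 2) / (k + 1) : ℝ) ^ (k + 2) := by
        calc Real.exp 1 = Real.exp (1 / (k + 2)) ^ (k + 2) := by
              rw [← Real.exp_nat_mul]
              congr 1
              push_cast
              field_simp
          _ ≤ _ := pow_le_pow_left₀ (Real.exp_pos _).le h2 _
      rw [div_pow, le_div_iff₀ (by positivity)] at h6
      rw [show (k + 1 + 1 : ℝ) = k + 2 by ring]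
      linarith
    calc (k + 1 + 1 : ℝ) * (k + 1).factorial
        ≤ (k + 1 + 1) * ((k + 1) ^ (k + 2) * Real.exp (-k)) := by gcongr
      _ = (k + 1 + 1) * ((k + 1) ^ (k + 2) * Real.exp 1) * Real.exp (-(k + 1)) := by
          rw [show (-k : ℝ) = 1 + -(k + 1) by ring, Real.exp_add]
          ring
      _ ≤ (k + 1 + 1) * (k + 1 + 1) ^ (k + 2) * Real.exp (-(k + 1)) := by gcongr
      _ = _ := by ring

lemma factorial_two_mul_le {m : ℕ} (hm : 1 ≤ m) :
    ((2 * m).factorial : ℝ) ≤ 2 * m * (2 * m) ^ (2 * m) * (Real.exp 1 * Real.exp (-(2 * m))) := by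
  obtain ⟨k, hk⟩ : ∃ k, 2 * m = k + 1 := ⟨2 * m - 1, by omega⟩
  have hk' : (2 * m : ℝ) = k + 1 := by exact_mod_cast hk
  have := factorial_le_mul_exp k
  rw [hk, hk', ← Real.exp_add]
  refine this.trans (le_of_eq ?_)
  rw [show (1 + -(k + 1) : ℝ) = -k by ring]
  ring

/-- Markov's inequality for the moment of order `2 m`. -/
lemma measureReal_le_of_integral_pow_le {T : ℝ → ℝ} (hT : Continuous T) {m : ℕ} (hm : 1 ≤ m)
    {V y : ℝ} (hV : 0 < V) (hy : 0 < y)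
    (h : ∫ x, T x ^ (2 * m) ∂unitMeasure ≤
      2 * (2 * m).factorial / √(2 * m / V) ^ (2 * m) * Real.exp m) :
    unitMeasure.real {x | y ≤ |T x|} ≤
      4 * Real.exp 1 * m * Real.exp (-m) * (2 * m * V / y ^ 2) ^ m := by
  have hm0 : (0 : ℝ) < m := by exact_mod_cast hm
  have h1 : y ^ (2 * m) * unitMeasure.real {x | y ≤ |T x|} ≤
      ∫ x, T x ^ (2 * m) ∂unitMeasure := by
    have h2 := mul_meas_ge_le_integral_of_nonneg (μ := unitMeasure) (f := fun x ↦ T x ^ (2 * m))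
      (Eventually.of_forall fun x ↦ Even.pow_nonneg (even_two_mul m) _)
      (integrable_unitMeasure_of_continuous (by fun_prop)) (y ^ (2 * m))
    refine le_trans ?_ h2
    gcongr ?_ * ?_
    refine measureReal_mono (fun x hx ↦ ?_)
    have hx' : y ≤ |T x| := hx
    change y ^ (2 * m) ≤ T x ^ (2 * m)
    rw [← (even_two_mul m).pow_abs (T x)]
    exact pow_le_pow_left₀ hy.le hx' _
  -- The value `z = √(2 m / V)` minimises `z ^ (-2 m) * exp (z ^ 2 * V / 2)` and makes the
  -- exponential equal to `exp m`.
  have h3 : √(2 * m / V) ^ (2 * m) = (2 * m / V) ^ m := by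
    rw [pow_mul, Real.sq_sqrt (by positivity)]
  rw [h3] at h
  have h4 := h1.trans h
  rw [← le_div_iff₀' (by positivity)] at h4
  refine h4.trans ?_
  rw [div_le_iff₀ (by positivity)]
  calc 2 * (2 * m).factorial / (2 * m / V) ^ m * Real.exp m
      ≤ 2 * (2 * m * (2 * m) ^ (2 * m) * (Real.exp 1 * Real.exp (-(2 * m)))) / (2 * m / V) ^ m *
        Real.exp m := by
        gcongr
        exact factorial_two_mul_le hm
    _ = 4 * Real.exp 1 * m * (Real.exp (-(2 * m)) * Real.exp m) * (2 * m * V) ^ m := by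
        rw [div_pow, pow_mul (2 * m : ℝ), sq, mul_pow (2 * m : ℝ) (2 * m) m, mul_pow (2 * m : ℝ) V]
        field_simp
        ring
    _ = _ := by
        rw [← Real.exp_add, show -(2 * m : ℝ) + m = -m by ring, div_pow, pow_mul y]
        field_simp

lemma Dissociated.measureReal_le_subgaussian {n : ℕ → ℕ} {I : Finset ℕ} {r Q D m : ℕ}
    (h : Dissociated n I r Q) {p : ℝ → ℝ} {B : ℝ} (hp : IsBoundedTrig p D B) (hB : 0 < B)
    (hm : 1 ≤ m) (hr : 2 * m ≤ r) (hQ : 2 * m * D ≤ Q) {L y : ℝ} (hL : 0 < L) (hI : I.card ≤ L)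
    (hy : 0 < y) :
    unitMeasure.real {x | y ≤ |weightedSum n I 1 p x|} ≤
      4 * Real.exp 1 * m * Real.exp (-m) * (2 * m * (L * B ^ 2) / y ^ 2) ^ m := by
  have hm0 : (0 : ℝ) < m := by exact_mod_cast hm
  refine measureReal_le_of_integral_pow_le (continuous_weightedSum _ _ _ hp.continuous) hm
    (by positivity) hy ?_
  refine (h.integral_weightedSum_pow_le_subgaussian 1 hp hr hQ
    (z := √(2 * m / (L * B ^ 2))) (by positivity)).trans ?_
  gcongr
  rw [Real.sq_sqrt (by positivity)]
  simp only [Pi.one_apply, one_pow, Finset.sum_const, nsmul_eq_mul, mul_one]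
  calc 2 * m / (L * B ^ 2) * B ^ 2 * (I.card : ℝ) / 2
      ≤ 2 * m / (L * B ^ 2) * B ^ 2 * L / 2 := by gcongr
    _ = (m : ℝ) := by field_simp

/-- Here `v` is any number exceeding the variance by the Bernstein correction; that correction tends
to zero when `m` is small compared with `L`, so `v` can be taken arbitrarily close to the variance.
-/
lemma Dissociated.measureReal_le_bernstein {n : ℕ → ℕ} {I : Finset ℕ} {r Q D m : ℕ}
    (h : Dissociated n I r Q) {p : ℝ → ℝ} {B : ℝ} (hp : IsBoundedTrig p D B)
    (hm : 1 ≤ m) (hr : 2 * m ≤ r) (hQ : 2 * m * D ≤ Q) {L y v : ℝ} (hL : 0 < L) (hI : I.card ≤ L)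
    (hy : 0 < y) (hv : 0 < v) (hz : √(2 * m / (L * v)) * B ≤ 1)
    (hvar : unitVariance p * (1 + √(2 * m / (L * v)) * B) ≤ v) :
    unitMeasure.real {x | y ≤ |weightedSum n I 1 p x|} ≤
      4 * Real.exp 1 * m * Real.exp (-m) * (2 * m * (L * v) / y ^ 2) ^ m := by
  have hm0 : (0 : ℝ) < m := by exact_mod_cast hm
  refine measureReal_le_of_integral_pow_le (continuous_weightedSum _ _ _ hp.continuous) hm
    (by positivity) hy ?_
  refine (h.integral_weightedSum_pow_le_bernstein hp hr hQ
    (z := √(2 * m / (L * v))) (by positivity) hz).trans ?_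
  gcongr
  rw [mul_assoc (√(2 * m / (L * v)) ^ 2), Real.sq_sqrt (by positivity)]
  have := IsBoundedTrig.unitVariance_nonneg p
  have hB := hp.nonneg_bound
  calc (I.card : ℝ) * (2 * m / (L * v) * (unitVariance p * (1 + √(2 * m / (L * v)) * B)) / 2)
      ≤ L * (2 * m / (L * v) * v / 2) := by gcongr
    _ = (m : ℝ) := by field_simp

/-! ### Upper half of the law of the iterated logarithm -/

/-- Chaining along the binary digits of `N`: each level `j < J` contributes at most one dyadic
increment of length `2 ^ j`. -/
lemma abs_sub_le_of_dyadic (G : ℕ → ℝ) (y : ℕ → ℝ) {J K : ℕ}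
    (h : ∀ j < J, ∀ i, (i + 1) * 2 ^ j ≤ K → |G ((i + 1) * 2 ^ j) - G (i * 2 ^ j)| ≤ y j)
    {i N : ℕ} (h1 : i * 2 ^ J ≤ N) (h2 : N < (i + 1) * 2 ^ J) (h3 : (i + 1) * 2 ^ J ≤ K) :
    |G N - G (i * 2 ^ J)| ≤ ∑ j ∈ Finset.range J, y j := by
  induction J generalizing i with
  | zero =>
    have : N = i := by
      rw [pow_zero] at *
      omega
    simp [this]
  | succ J ih =>
    have hJ := fun j (hj : j < J) ↦ h j (hj.trans J.lt_succ_self)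
    have hy : 0 ≤ y J := (abs_nonneg _).trans (h J J.lt_succ_self (2 * i) (by
      refine le_trans ?_ h3
      rw [pow_succ]
      nlinarith [Nat.two_pow_pos J]))
    rw [Finset.sum_range_succ]
    rw [pow_succ] at h1 h2 h3 ⊢
    rcases Nat.lt_or_ge N ((2 * i + 1) * 2 ^ J) with hN | hN
    · have := ih hJ (i := 2 * i) (by linarith) hN (by nlinarith [Nat.two_pow_pos J])
      rw [show i * (2 ^ J * 2) = 2 * i * 2 ^ J by ring]
      linarith
    · have e1 := ih hJ (i := 2 * i + 1) hN (by linarith) (by linarith)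
      have e2 := h J J.lt_succ_self (2 * i) (by nlinarith [Nat.two_pow_pos J])
      rw [show i * (2 ^ J * 2) = 2 * i * 2 ^ J by ring]
      have := abs_sub_le (G N) (G ((2 * i + 1) * 2 ^ J)) (G (2 * i * 2 ^ J))
      linarith

lemma ae_eventually_notMem_of_summable {α : Type*} [MeasurableSpace α] {μ : Measure α}
    [IsFiniteMeasure μ] {s : ℕ → Set α} {b : ℕ → ℝ} (hb : Summable b)
    (h : ∀ᶠ k in atTop, μ.real (s k) ≤ b k) : ∀ᵐ x ∂μ, ∀ᶠ k in atTop, x ∉ s k := by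
  obtain ⟨k₀, hk₀⟩ := eventually_atTop.1 h
  have hsum : Summable fun k ↦ μ.real (s (k + k₀)) :=
    Summable.of_nonneg_of_le (fun _ ↦ measureReal_nonneg) (fun k ↦ hk₀ _ (Nat.le_add_left _ _))
      ((summable_nat_add_iff k₀).2 hb)
  have : ∑' k, μ (s (k + k₀)) ≠ ⊤ := by
    have h1 : ∀ k, μ (s (k + k₀)) = ENNReal.ofReal (μ.real (s (k + k₀))) := fun k ↦
      (ofReal_measureReal).symm
    simp_rw [h1]
    exact hsum.tsum_ofReal_ne_top
  filter_upwards [ae_eventually_notMem this] with x hx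
  obtain ⟨k₁, hk₁⟩ := eventually_atTop.1 hx
  refine eventually_atTop.2 ⟨k₁ + k₀, fun k hk ↦ ?_⟩
  have := hk₁ (k - k₀) (by omega)
  rwa [Nat.sub_add_cancel (by omega)] at this

/-- With order `⌊log k⌋` the tail is `O(k ^ (-(1 + β)))` up to a logarithm, which is absorbed by `k
^ (β / 2)`. -/
lemma summable_floor_log_mul_exp {β : ℝ} (hβ : 0 < β) :
    Summable fun k : ℕ ↦ (⌊Real.log k⌋₊ : ℝ) * Real.exp (-((1 + β) * ⌊Real.log k⌋₊)) := by
  have hs : Summable fun k : ℕ ↦ (2 / β * Real.exp (1 + β)) * ((k : ℝ) ^ (1 + β / 2))⁻¹ :=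
    (Real.summable_nat_rpow_inv.2 (by linarith)).mul_left _
  refine Summable.of_nonneg_of_le (fun k ↦ by positivity) (fun k ↦ ?_) hs
  rcases Nat.eq_zero_or_pos k with rfl | hk
  · simp
    positivity
  have hk' : (0 : ℝ) < k := by exact_mod_cast hk
  have h0 : 0 ≤ Real.log k := Real.log_natCast_nonneg k
  have h1 : (⌊Real.log k⌋₊ : ℝ) ≤ k ^ (β / 2) / (β / 2) :=
    (Nat.floor_le h0).trans (Real.log_le_rpow_div hk'.le (by positivity))
  have h2 : Real.exp (-((1 + β) * ⌊Real.log k⌋₊)) ≤ Real.exp (1 + β) * (k : ℝ) ^ (-(1 + β)) := by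
    rw [Real.rpow_def_of_pos hk', ← Real.exp_add, Real.exp_le_exp]
    have := Nat.lt_floor_add_one (Real.log k)
    nlinarith
  calc (⌊Real.log k⌋₊ : ℝ) * Real.exp (-((1 + β) * ⌊Real.log k⌋₊))
      ≤ k ^ (β / 2) / (β / 2) * (Real.exp (1 + β) * (k : ℝ) ^ (-(1 + β))) := by gcongr
    _ = 2 / β * Real.exp (1 + β) * ((k : ℝ) ^ (β / 2) * (k : ℝ) ^ (-(1 + β))) := by
        field_simp
    _ = _ := by
        rw [← Real.rpow_add hk', ← Real.rpow_neg hk'.le]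
        congr 2
        ring

/-- The sum of the trigonometric approximations at scale `κ` over the main part of `[1, N]`. -/
noncomputable def bulkSum (n : ℕ → ℕ) (p : ℕ → ℝ → ℝ) (κ N : ℕ) (x : ℝ) : ℝ :=
  weightedSum n (Finset.Icc 1 N ∩ dyadicBulk n κ) 1 (p κ) x

lemma bulkSum_sub (n : ℕ → ℕ) (p : ℕ → ℝ → ℝ) (κ : ℕ) {a b : ℕ} (hab : a ≤ b) (x : ℝ) :
    bulkSum n p κ b x - bulkSum n p κ a x =
      weightedSum n (Finset.Ioc a b ∩ dyadicBulk n κ) 1 (p κ) x := by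
  classical
  have h1 : Finset.Icc 1 b ∩ dyadicBulk n κ =
      (Finset.Icc 1 a ∩ dyadicBulk n κ) ∪ (Finset.Ioc a b ∩ dyadicBulk n κ) := by
    ext i
    simp only [Finset.mem_inter, Finset.mem_union, Finset.mem_Icc, Finset.mem_Ioc]
    have : 1 ≤ i ∧ i ≤ b ↔ (1 ≤ i ∧ i ≤ a) ∨ (a < i ∧ i ≤ b) := by omega
    tauto
  have h2 : Disjoint (Finset.Icc 1 a ∩ dyadicBulk n κ) (Finset.Ioc a b ∩ dyadicBulk n κ) := by
    rw [Finset.disjoint_left]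
    intro i hi hi'
    simp only [Finset.mem_inter, Finset.mem_Icc, Finset.mem_Ioc] at hi hi'
    omega
  simp only [bulkSum, weightedSum]
  rw [h1, Finset.sum_union h2]
  ring

/-- The set of main indices is dissociated up to any logarithmic order, at all large scales. -/
def LogDissociated (n : ℕ → ℕ) : Prop :=
  ∀ A : ℝ, 0 ≤ A → ∀ᶠ κ : ℕ in atTop,
    Dissociated n (dyadicBulk n κ) ⌊A * Real.log κ⌋₊ (2 ^ (8 * κ))

lemma ConditionA.logDissociated {ω : ℕ → ℝ} {n : ℕ → ℕ} (hA : ConditionA ω n)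
    (hn_pos : ∀ k, 1 ≤ k → 0 < n k) (hω_lim : Tendsto ω atTop atTop)
    (hω : ∃ α : ℝ, 0 < α ∧ ∃ k₀ : ℕ, ∀ k : ℕ, 1 ≤ k → k₀ ≤ k → Real.log (k : ℝ) ^ α ≤ ω k) :
    LogDissociated n := by
  obtain ⟨α, hα, k₀, hk⟩ := hω
  intro A hA0
  refine hA.dissociated_dyadicBulk hn_pos hω_lim _ ?_
  filter_upwards [eventually_mul_log_le_of_log_rpow_le hα hk A] with κ hκ
  exact (Nat.floor_le (mul_nonneg hA0 (Real.log_natCast_nonneg κ))).trans hκ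

lemma tendsto_floor_log : Tendsto (fun k : ℕ ↦ ⌊Real.log k⌋₊) atTop atTop :=
  tendsto_nat_floor_atTop.comp (Real.tendsto_log_atTop.comp tendsto_natCast_atTop_atTop)

lemma LogDissociated.eventually_two_mul {n : ℕ → ℕ} (h : LogDissociated n) :
    ∀ᶠ k : ℕ in atTop,
      Dissociated n (dyadicBulk n (k + 1)) (2 * ⌊Real.log k⌋₊) (2 ^ (8 * (k + 1))) := by
  filter_upwards [(tendsto_add_atTop_nat 1).eventually (h 2 (by norm_num)),
    eventually_ge_atTop 1] with k hk h1
  have hk1 : (0 : ℝ) < k := by exact_mod_cast h1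
  refine hk.mono le_rfl (Nat.le_floor ?_) le_rfl
  have h2 := Nat.floor_le (Real.log_natCast_nonneg k)
  have h3 : Real.log (k : ℝ) ≤ Real.log ((k + 1 : ℕ) : ℝ) :=
    Real.log_le_log hk1 (by push_cast; linarith)
  push_cast at h3 ⊢
  linarith

lemma floor_log_le (k : ℕ) : ⌊Real.log k⌋₊ ≤ k :=
  Nat.floor_le_of_le ((Real.log_le_self (Nat.cast_nonneg k)))

lemma tendsto_floor_log_div_two_pow (c : ℝ) :
    Tendsto (fun k : ℕ ↦ √(2 * ⌊Real.log k⌋₊ / (2 ^ k * c))) atTop (𝓝 0) := by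
  have h1 : Tendsto (fun k : ℕ ↦ (k : ℝ) * (1 / 2 : ℝ) ^ k) atTop (𝓝 0) :=
    tendsto_self_mul_const_pow_of_lt_one (by norm_num) (by norm_num)
  have h2 : Tendsto (fun k : ℕ ↦ (⌊Real.log k⌋₊ : ℝ) * (1 / 2 : ℝ) ^ k) atTop (𝓝 0) := by
    refine squeeze_zero (fun _ ↦ by positivity) (fun k ↦ ?_) h1
    gcongr
    exact floor_log_le k
  have h3 := (h2.const_mul (2 / c)).sqrt
  rw [mul_zero, Real.sqrt_zero] at h3
  refine h3.congr fun k ↦ ?_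
  congr 1
  rw [one_div, inv_pow]
  field_simp

namespace IsDyadicApprox

variable {f : ℝ → ℝ} {p : ℕ → ℝ → ℝ} {B C : ℝ} {n : ℕ → ℕ}

/-- At the grid points `L = i * 2 ^ (k - s)` the Bernstein tail with `y ^ 2 = 2 m L v'` is `(v / v')
^ m * exp (-m)` up to a factor of order `m`. The ratio `v / v' < 1` supplies the extra exponent `β =
log (v' / v)` for summability. The number `2 ^ s` of grid points does not grow with `k`. -/
lemma ae_eventually_abs_bulkSum_lt (h : IsDyadicApprox f p B C) (hn : LogDissociated n) (s : ℕ)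
    {v v' : ℝ} (hv : l2Norm f ^ 2 < v) (hv' : v < v') :
    ∀ᵐ x ∂unitMeasure, ∀ᶠ k : ℕ in atTop, ∀ i ∈ Finset.Ico (2 ^ s) (2 ^ (s + 1)),
      |bulkSum n p (k + 1) (i * 2 ^ (k - s)) x| <
        √(2 * ⌊Real.log k⌋₊ * (i * 2 ^ (k - s) : ℕ) * v') := by
  classical
  have hv0 : 0 < v := (sq_nonneg _).trans_lt hv
  have hB := h.bound_pos
  set β := Real.log (v' / v) with hβ
  have hβ0 : 0 < β := Real.log_pos ((one_lt_div hv0).2 hv')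
  set m : ℕ → ℕ := fun k ↦ ⌊Real.log k⌋₊ with hm
  set bad : ℕ → ℕ → Set ℝ := fun k i ↦ {x | √(2 * m k * (i * 2 ^ (k - s) : ℕ) * v') ≤
    |bulkSum n p (k + 1) (i * 2 ^ (k - s)) x|} with hbad
  have hz := tendsto_floor_log_div_two_pow v
  have hvar : ∀ᶠ k : ℕ in atTop,
      unitVariance (p (k + 1)) * (1 + √(2 * m k / (2 ^ k * v)) * B) < v := by
    have h1 := (h.tendsto_unitVariance.comp (tendsto_add_atTop_nat 1)).mul
      ((hz.mul_const B).const_add 1)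
    simp only [zero_mul, add_zero, mul_one] at h1
    exact h1.eventually (gt_mem_nhds hv)
  have hzB : ∀ᶠ k : ℕ in atTop, √(2 * m k / (2 ^ k * v)) * B < 1 := by
    have h1 := hz.mul_const B
    rw [zero_mul] at h1
    exact h1.eventually (gt_mem_nhds one_pos)
  have hbound : ∀ᶠ k : ℕ in atTop, unitMeasure.real
      (⋃ i ∈ Finset.Ico (2 ^ s) (2 ^ (s + 1)), bad k i) ≤
        2 ^ s * (4 * Real.exp 1) * (m k * Real.exp (-((1 + β) * m k))) := by
    filter_upwards [hvar, hzB, hn.eventually_two_mul, tendsto_floor_log.eventually_ge_atTop 1,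
      eventually_ge_atTop s] with k h1 h2 h3 h4 h5
    have hm0 : (0 : ℝ) < m k := by exact_mod_cast h4
    have hone : ∀ i ∈ Finset.Ico (2 ^ s) (2 ^ (s + 1)), unitMeasure.real (bad k i) ≤
        4 * Real.exp 1 * (m k * Real.exp (-((1 + β) * m k))) := by
      intro i hi
      obtain ⟨hi1, hi2⟩ := Finset.mem_Ico.1 hi
      have hL : 2 ^ k ≤ i * 2 ^ (k - s) := by
        calc 2 ^ k = 2 ^ s * 2 ^ (k - s) := by rw [← pow_add]; congr 1; omega
          _ ≤ _ := Nat.mul_le_mul_right _ hi1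
      set L : ℕ := i * 2 ^ (k - s)
      have hL' : (2 : ℝ) ^ k ≤ L := by exact_mod_cast hL
      have hL0 : (0 : ℝ) < L := lt_of_lt_of_le (by positivity) hL'
      have hzle : √(2 * m k / (L * v)) ≤ √(2 * m k / (2 ^ k * v)) := by gcongr
      have hv'0 : 0 < v' := hv0.trans hv'
      have hvarp := IsBoundedTrig.unitVariance_nonneg (p (k + 1))
      refine ((h3.mono (Finset.inter_subset_right (s₁ := Finset.Icc 1 L)) le_rfl
        le_rfl).measureReal_le_bernstein (h.trig (k + 1)) h4 le_rfl
        (two_mul_mul_two_pow_le ((floor_log_le k).trans k.le_succ)) (L := L) (v := v)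
        (y := √(2 * m k * L * v')) hL0 ?_ (by positivity) hv0 ?_ ?_).trans (le_of_eq ?_)
      · have := Finset.card_le_card (Finset.inter_subset_left (s₁ := Finset.Icc 1 L)
          (s₂ := dyadicBulk n (k + 1)))
        rw [Nat.card_Icc, Nat.add_sub_cancel] at this
        exact_mod_cast this
      · exact (mul_le_mul_of_nonneg_right hzle hB.le).trans h2.le
      · refine le_trans ?_ h1.le
        gcongr
      · rw [Real.sq_sqrt (by positivity)]
        have e1 : 2 * (m k : ℝ) * (L * v) / (2 * m k * L * v') = (v' / v)⁻¹ := by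
          field_simp
        change 4 * Real.exp 1 * (m k : ℝ) * Real.exp (-(m k : ℝ)) *
          (2 * (m k : ℝ) * (L * v) / (2 * m k * L * v')) ^ m k = _
        have e2 : ((v' / v)⁻¹) ^ m k = Real.exp (-(β * m k)) := by
          rw [inv_pow, Real.exp_neg, mul_comm, Real.exp_nat_mul, hβ, Real.exp_log (by positivity)]
        rw [e1, e2, show -((1 + β) * (m k : ℝ)) = -m k + -(β * m k) by ring, Real.exp_add]
        ring
    refine (measureReal_biUnion_finset_le _ _).trans ((Finset.sum_le_sum hone).trans
      (le_of_eq ?_))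
    rw [Finset.sum_const, Nat.card_Ico, pow_succ, nsmul_eq_mul,
      show 2 ^ s * 2 - 2 ^ s = 2 ^ s by omega]
    push_cast
    ring
  filter_upwards [ae_eventually_notMem_of_summable
    ((summable_floor_log_mul_exp hβ0).mul_left _) hbound] with x hx
  filter_upwards [hx] with k hk i hi
  by_contra! hcon
  exact hk (Set.mem_biUnion hi hcon)

/-- Increments of length `2 ^ j` have standard deviation smaller than that of a grid step by `2 ^
(-d / 2)`, where `d = k - s - j`. The thresholds are allowed to decay more slowly, like `(3 / 4) ^
d`, so the tail gains a factor geometric in `d` that beats the number of increments. -/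
lemma ae_eventually_abs_bulkSum_sub_le (h : IsDyadicApprox f p B C) (hn : LogDissociated n)
    (s : ℕ) :
    ∀ᵐ x ∂unitMeasure, ∀ᶠ k : ℕ in atTop, ∀ j < k - s, ∀ i, (i + 1) * 2 ^ j ≤ 2 ^ (k + 1) →
      |bulkSum n p (k + 1) ((i + 1) * 2 ^ j) x - bulkSum n p (k + 1) (i * 2 ^ j) x| ≤
        2 * B * √(⌊Real.log k⌋₊ * 2 ^ (k - s)) * (3 / 4) ^ (k - s - j) := by
  classical
  have hB := h.bound_pos
  set m : ℕ → ℕ := fun k ↦ ⌊Real.log k⌋₊ with hm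
  set y : ℕ → ℕ → ℝ := fun k j ↦ 2 * B * √(m k * 2 ^ (k - s)) * (3 / 4) ^ (k - s - j) with hy
  set bad : ℕ → ℕ → ℕ → Set ℝ := fun k j i ↦ {x | y k j ≤
    |bulkSum n p (k + 1) ((i + 1) * 2 ^ j) x - bulkSum n p (k + 1) (i * 2 ^ j) x|} with hbad
  have hbound : ∀ᶠ k : ℕ in atTop, unitMeasure.real
      (⋃ j ∈ Finset.range (k - s), ⋃ i ∈ Finset.range (2 ^ (k + 1 - j)), bad k j i) ≤
        2 ^ (s + 1) * (4 * Real.exp 1) * (m k * Real.exp (-((1 + Real.log 2) * m k))) := by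
    filter_upwards [hn.eventually_two_mul, tendsto_floor_log.eventually_ge_atTop 12,
      eventually_ge_atTop s] with k h3 h4 h5
    have hm1 : 1 ≤ m k := le_trans (by norm_num) h4
    have hm0 : (0 : ℝ) < m k := by exact_mod_cast hm1
    -- Here `8 / 9 = (1 / 2) * (4 / 3) ^ 2`. Twelve factors give `1 / 4` per level, against the `2 ^
    -- (s + 1) * 2 ^ d` increments at that level.
    have hm12 : ((8 : ℝ) / 9) ^ m k ≤ 1 / 4 :=
      (pow_le_pow_of_le_one (by norm_num) (by norm_num) h4).trans (by norm_num)
    have hone : ∀ j ∈ Finset.range (k - s), ∀ i ∈ Finset.range (2 ^ (k + 1 - j)),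
        unitMeasure.real (bad k j i) ≤ 4 * Real.exp 1 * (m k * Real.exp (-((1 + Real.log 2) * m k)))
          * (1 / 4) ^ (k - s - j) := by
      intro j hj i _
      have hj' := Finset.mem_range.1 hj
      have hset : bad k j i = {x | y k j ≤ |weightedSum n
          (Finset.Ioc (i * 2 ^ j) ((i + 1) * 2 ^ j) ∩ dyadicBulk n (k + 1)) 1 (p (k + 1)) x|} := by
        simp only [hbad]
        ext x
        rw [Set.mem_ofPred_eq, Set.mem_ofPred_eq, bulkSum_sub n p (k + 1) (by gcongr; omega)]
      have hmul : m k * 2 ^ (k - s) > (0 : ℝ) := by positivity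
      rw [hset]
      refine ((h3.mono (Finset.inter_subset_right
        (s₁ := Finset.Ioc (i * 2 ^ j) ((i + 1) * 2 ^ j))) le_rfl
        le_rfl).measureReal_le_subgaussian (h.trig (k + 1)) hB hm1 le_rfl
        (two_mul_mul_two_pow_le ((floor_log_le k).trans k.le_succ)) (L := 2 ^ j)
        (y := y k j) (by positivity) ?_ (by positivity)).trans ?_
      · have := Finset.card_le_card (Finset.inter_subset_left
          (s₁ := Finset.Ioc (i * 2 ^ j) ((i + 1) * 2 ^ j)) (s₂ := dyadicBulk n (k + 1)))
        rw [Nat.card_Ioc, add_mul, one_mul, Nat.add_sub_cancel_left] at this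
        rw [add_mul, one_mul]
        exact_mod_cast this
      · have e1 : 2 * (m k : ℝ) * (2 ^ j * B ^ 2) / y k j ^ 2 =
            1 / 2 * (8 / 9) ^ (k - s - j) := by
          obtain ⟨d, hd⟩ : ∃ d, k - s = j + d := ⟨k - s - j, by omega⟩
          have hd' : k - s - j = d := by omega
          simp only [hy]
          rw [hd', hd, mul_pow, mul_pow, Real.sq_sqrt (by positivity), pow_add, ← pow_mul,
            mul_comm d 2, pow_mul (3 / 4 : ℝ), div_eq_iff (by positivity),
            show ((3 : ℝ) / 4) ^ 2 = 9 / 16 by norm_num]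
          have : (8 / 9 : ℝ) ^ d * 2 ^ d * (9 / 16) ^ d = 1 := by
            rw [← mul_pow, ← mul_pow]; norm_num
          calc 2 * (m k : ℝ) * (2 ^ j * B ^ 2)
              = 2 * (m k : ℝ) * (2 ^ j * B ^ 2) * ((8 / 9 : ℝ) ^ d * 2 ^ d * (9 / 16) ^ d) := by
                rw [this, mul_one]
            _ = _ := by ring
        -- The remaining factor `1 / 2` in the ratio comes from the constant `2 * B` in the
        -- threshold; it provides `β = log 2` for summability in `k`.
        have e2 : (2⁻¹ : ℝ) ^ m k = Real.exp (-(Real.log 2 * m k)) := by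
          rw [inv_pow, Real.exp_neg, mul_comm, Real.exp_nat_mul, Real.exp_log (by positivity)]
        change 4 * Real.exp 1 * (m k : ℝ) * Real.exp (-(m k : ℝ)) *
          (2 * (m k : ℝ) * (2 ^ j * B ^ 2) / y k j ^ 2) ^ m k ≤ _
        rw [e1, mul_pow, one_div, e2, ← pow_mul, mul_comm (k - s - j), pow_mul,
          show -((1 + Real.log 2) * (m k : ℝ)) = -m k + -(Real.log 2 * m k) by ring, Real.exp_add]
        calc 4 * Real.exp 1 * (m k : ℝ) * Real.exp (-(m k : ℝ)) *
              (Real.exp (-(Real.log 2 * m k)) * ((8 / 9 : ℝ) ^ m k) ^ (k - s - j))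
            ≤ 4 * Real.exp 1 * (m k : ℝ) * Real.exp (-(m k : ℝ)) *
              (Real.exp (-(Real.log 2 * m k)) * (1 / 4) ^ (k - s - j)) := by gcongr
          _ = _ := by ring
    set c := 4 * Real.exp 1 * (m k * Real.exp (-((1 + Real.log 2) * m k))) with hc
    have hc0 : 0 ≤ c := by positivity
    refine (measureReal_biUnion_finset_le _ _).trans ((Finset.sum_le_sum fun j hj ↦
      (measureReal_biUnion_finset_le _ _).trans (Finset.sum_le_sum (hone j hj))).trans ?_)
    calc ∑ j ∈ Finset.range (k - s), ∑ i ∈ Finset.range (2 ^ (k + 1 - j)),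
          c * (1 / 4) ^ (k - s - j)
        = ∑ j ∈ Finset.range (k - s), 2 ^ (s + 1) * c * (1 / 2) ^ (k - s - j) := by
          refine Finset.sum_congr rfl fun j hj ↦ ?_
          have hj' := Finset.mem_range.1 hj
          obtain ⟨d, hd⟩ : ∃ d, k - s = j + d := ⟨k - s - j, by omega⟩
          have hd' : k - s - j = d := by omega
          rw [Finset.sum_const, Finset.card_range, nsmul_eq_mul, hd',
            show k + 1 - j = (s + 1) + d by omega]
          push_cast
          rw [pow_add (2 : ℝ), show (1 / 2 : ℝ) = 2 * (1 / 4) by norm_num, mul_pow (2 : ℝ) (1 / 4)]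
          ring
      _ = 2 ^ (s + 1) * c * ∑ j ∈ Finset.range (k - s), (1 / 2 : ℝ) ^ (k - s - j) := by
          rw [Finset.mul_sum]
      _ ≤ 2 ^ (s + 1) * c * 1 := by
          refine mul_le_mul_of_nonneg_left ?_ (by positivity)
          have : ∀ J : ℕ, ∑ j ∈ Finset.range J, (1 / 2 : ℝ) ^ (J - j) ≤ 1 := by
            intro J
            induction J with
            | zero => simp
            | succ J ih =>
              rw [Finset.sum_range_succ]
              have : ∑ j ∈ Finset.range J, (1 / 2 : ℝ) ^ (J + 1 - j) =
                  1 / 2 * ∑ j ∈ Finset.range J, (1 / 2 : ℝ) ^ (J - j) := by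
                rw [Finset.mul_sum]
                refine Finset.sum_congr rfl fun j hj ↦ ?_
                have := Finset.mem_range.1 hj
                rw [show J + 1 - j = (J - j) + 1 by omega, pow_succ]
                ring
              rw [this, Nat.add_sub_cancel_left, pow_one]
              linarith
          exact this _
      _ = _ := by rw [hc]; ring
  filter_upwards [ae_eventually_notMem_of_summable
    ((summable_floor_log_mul_exp (Real.log_pos one_lt_two)).mul_left _) hbound] with x hx
  filter_upwards [hx] with k hk j hj i hi
  by_contra! hcon
  refine hk (Set.mem_biUnion (Finset.mem_range.2 hj) (Set.mem_biUnion (x := i) ?_ hcon.le))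
  have h1 : 2 ^ (k + 1) = 2 ^ (k + 1 - j) * 2 ^ j := by
    rw [← pow_add]
    congr 1
    omega
  rw [h1] at hi
  have := Nat.le_of_mul_le_mul_right hi (Nat.two_pow_pos j)
  exact Finset.mem_coe.2 (Finset.mem_range.2 (by omega))

lemma ae_eventually_approxError_lt (h : IsDyadicApprox f p B C)
    (hn_pos : ∀ k, 1 ≤ k → 0 < n k) :
    ∀ᵐ x ∂unitMeasure, ∀ᶠ k : ℕ in atTop, approxError f p n k x < 1 := by
  have hs : Summable fun k : ℕ ↦ C * (1 / 4 : ℝ) ^ k :=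
    (summable_geometric_of_lt_one (by norm_num) (by norm_num)).mul_left C
  have := ae_eventually_notMem_of_summable (μ := unitMeasure)
    (s := fun k ↦ {x | 1 ≤ approxError f p n k x}) hs (Eventually.of_forall fun k ↦ ?_)
  · filter_upwards [this] with x hx
    filter_upwards [hx] with k hk
    exact not_le.1 hk
  · have h1 := mul_meas_ge_le_integral_of_nonneg (μ := unitMeasure)
      (Eventually.of_forall (approxError_nonneg f p n k)) (h.integrable_approxError k) 1
    rw [one_mul] at h1
    refine h1.trans ((h.integral_approxError_le hn_pos k).trans (le_of_eq ?_))
    rw [one_div, inv_pow, div_eq_mul_inv]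

/-- Nearest grid point below `N`, then the chained increments, then the passage from the bulk
polynomial sum to `f`: these use `δ / 2`, `δ / 4` and `δ / 4` of the margin. The normalisation is by
`log k`, comparable to `log (log N)`. -/
theorem ae_eventually_abs_sum_le (h : IsDyadicApprox f p B C)
    (hn : LogDissociated n) (hn_pos : ∀ k, 1 ≤ k → 0 < n k) (hn_inj : Set.InjOn n (Set.Ici 1))
    {δ : ℝ} (hδ : 0 < δ) :
    ∀ᵐ x ∂unitMeasure, ∀ᶠ k : ℕ in atTop, ∀ N, 2 ^ k ≤ N → N < 2 ^ (k + 1) →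
      |∑ i ∈ Finset.Icc 1 N, f ((n i : ℝ) * x)| ≤
        (l2Norm f + δ) * √(2 * N * Real.log k) := by
  have hB := h.bound_pos
  have hσ := l2Norm_nonneg f
  -- The chained increments add up to at most `2 * B * 3` times the size attached to one grid step,
  -- `3` bounding the geometric series of ratio `3 / 4`; a fine grid makes this small.
  obtain ⟨s, hs⟩ : ∃ s : ℕ, 6 * B / √(2 ^ s) < δ / 4 := by
    have h1 : Tendsto (fun s : ℕ ↦ 6 * B / √((2 : ℝ) ^ s)) atTop (𝓝 0) :=
      (Real.tendsto_sqrt_atTop.comp (tendsto_pow_atTop_atTop_of_one_lt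
        one_lt_two)).const_div_atTop _
    exact (h1.eventually (gt_mem_nhds (by positivity))).exists
  have hrest : ∀ᶠ k : ℕ in atTop, 2 ^ ((k + 1) / 8) * B + 1 ≤ δ / 4 * √((2 : ℝ) ^ k) := by
    have h1 := (tendsto_two_pow_clog_div_sqrt.comp
      ((tendsto_pow_atTop_atTop_of_one_lt (r := 2) (by norm_num)).comp
        (tendsto_add_atTop_nat 1))).const_mul ((B + 1) * √2)
    rw [mul_zero] at h1
    filter_upwards [h1.eventually (gt_mem_nhds (show 0 < δ / 4 by positivity))] with k hk
    simp only [Function.comp_apply] at hk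
    rw [Nat.clog_pow 2 _ (by norm_num)] at hk
    push_cast at hk
    rw [pow_succ (2 : ℝ) k, Real.sqrt_mul (by positivity), show (B + 1) * √2 *
      (2 ^ ((k + 1) / 8) / (√(2 ^ k) * √2)) = (B + 1) * 2 ^ ((k + 1) / 8) / √(2 ^ k) by
        field_simp, div_lt_iff₀ (by positivity)] at hk
    have : (1 : ℝ) ≤ 2 ^ ((k + 1) / 8) := one_le_pow₀ (by norm_num)
    nlinarith
  filter_upwards [h.ae_eventually_abs_bulkSum_lt hn s (v := (l2Norm f + δ / 4) ^ 2)
      (v' := (l2Norm f + δ / 2) ^ 2) (by nlinarith) (by nlinarith),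
    h.ae_eventually_abs_bulkSum_sub_le hn s, h.ae_eventually_approxError_lt hn_pos] with x h1 h2 h3
  filter_upwards [h1, h2, (tendsto_add_atTop_nat 1).eventually h3, hrest, eventually_ge_atTop s,
    eventually_ge_atTop 3] with k h1 h2 h3 h4 h5 h6 N hN1 hN2
  have hlog : 1 ≤ Real.log k := by
    rw [← Real.log_exp 1]
    refine Real.log_le_log (Real.exp_pos _) (Real.exp_one_lt_d9.le.trans ?_)
    have : (3 : ℝ) ≤ k := by exact_mod_cast h6
    linarith
  have hmlog : (⌊Real.log k⌋₊ : ℝ) ≤ Real.log k := Nat.floor_le (by linarith)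
  have hN0 : (2 : ℝ) ^ k ≤ N := by exact_mod_cast hN1
  have hNpos : (0 : ℝ) < N := lt_of_lt_of_le (by positivity) hN0
  set R := √(2 * N * Real.log k) with hR
  have hR0 : 0 ≤ R := Real.sqrt_nonneg _
  have hk : k - s + s = k := by omega
  obtain ⟨i, hi⟩ : ∃ i, i = N / 2 ^ (k - s) := ⟨_, rfl⟩
  have hpos := Nat.two_pow_pos (k - s)
  have hi1 : i * 2 ^ (k - s) ≤ N := hi ▸ Nat.div_mul_le_self N _
  have hi2 : N < (i + 1) * 2 ^ (k - s) := by
    rw [hi, mul_comm]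
    exact Nat.lt_mul_div_succ N hpos
  have hi3 : 2 ^ s ≤ i := by
    rw [hi, Nat.le_div_iff_mul_le hpos, ← pow_add, add_comm, hk]
    exact hN1
  have hi4 : i < 2 ^ (s + 1) := by
    rw [hi, Nat.div_lt_iff_lt_mul hpos, ← pow_add, show s + 1 + (k - s) = k + 1 by omega]
    exact hN2
  have hi5 : (i + 1) * 2 ^ (k - s) ≤ 2 ^ (k + 1) := by
    rw [show k + 1 = s + 1 + (k - s) by omega, pow_add]
    exact Nat.mul_le_mul_right _ hi4
  have b1 : |bulkSum n p (k + 1) (i * 2 ^ (k - s)) x| ≤ (l2Norm f + δ / 2) * R := by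
    refine (h1 i (Finset.mem_Ico.2 ⟨hi3, hi4⟩)).le.trans ?_
    rw [Real.sqrt_mul (by positivity), Real.sqrt_sq (by positivity), mul_comm]
    refine mul_le_mul_of_nonneg_left ?_ (by positivity)
    refine Real.sqrt_le_sqrt ?_
    have : ((i * 2 ^ (k - s) : ℕ) : ℝ) ≤ N := by exact_mod_cast hi1
    calc 2 * (⌊Real.log k⌋₊ : ℝ) * (i * 2 ^ (k - s) : ℕ) ≤ 2 * Real.log k * N := by gcongr
      _ = _ := by ring
  have b2 : |bulkSum n p (k + 1) N x - bulkSum n p (k + 1) (i * 2 ^ (k - s)) x| ≤ δ / 4 * R := by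
    refine (abs_sub_le_of_dyadic (fun N ↦ bulkSum n p (k + 1) N x) _ h2 hi1 hi2 hi5).trans ?_
    rw [← Finset.mul_sum]
    have hgeo : ∀ J : ℕ, ∑ j ∈ Finset.range J, (3 / 4 : ℝ) ^ (J - j) ≤ 3 := by
      intro J
      induction J with
      | zero => simp
      | succ J ih =>
        rw [Finset.sum_range_succ]
        have : ∑ j ∈ Finset.range J, (3 / 4 : ℝ) ^ (J + 1 - j) =
            3 / 4 * ∑ j ∈ Finset.range J, (3 / 4 : ℝ) ^ (J - j) := by
          rw [Finset.mul_sum]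
          refine Finset.sum_congr rfl fun j hj ↦ ?_
          have := Finset.mem_range.1 hj
          rw [show J + 1 - j = (J - j) + 1 by omega, pow_succ]
          ring
        rw [this, Nat.add_sub_cancel_left, pow_one]
        linarith
    have hsq : √((⌊Real.log k⌋₊ : ℝ) * 2 ^ (k - s)) ≤ R / √(2 ^ s) := by
      rw [hR, ← Real.sqrt_div (by positivity)]
      refine Real.sqrt_le_sqrt ?_
      rw [le_div_iff₀ (by positivity), mul_assoc, ← pow_add, hk]
      have hl0 : 0 ≤ Real.log k := by linarith
      calc (⌊Real.log k⌋₊ : ℝ) * 2 ^ k ≤ Real.log k * N := by gcongr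
        _ ≤ _ := by nlinarith [mul_nonneg hl0 hNpos.le]
    calc 2 * B * √((⌊Real.log k⌋₊ : ℝ) * 2 ^ (k - s)) *
          ∑ j ∈ Finset.range (k - s), (3 / 4 : ℝ) ^ (k - s - j)
        ≤ 2 * B * (R / √(2 ^ s)) * 3 := by gcongr; exact hgeo _
      _ = 6 * B / √(2 ^ s) * R := by ring
      _ ≤ δ / 4 * R := by gcongr
  have b3 : |∑ i ∈ Finset.Icc 1 N, f ((n i : ℝ) * x) - bulkSum n p (k + 1) N x| ≤ δ / 4 * R := by
    refine (h.abs_sum_sub_weightedSum_le hn_inj (k + 1)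
      (Finset.Icc_subset_Icc_right hN2.le) x).trans ?_
    have : √((2 : ℝ) ^ k) ≤ R := by
      refine Real.sqrt_le_sqrt ?_
      nlinarith
    calc _ ≤ 2 ^ ((k + 1) / 8) * B + 1 := by linarith
      _ ≤ δ / 4 * √((2 : ℝ) ^ k) := h4
      _ ≤ _ := by gcongr
  have t1 := abs_sub_abs_le_abs_sub (∑ i ∈ Finset.Icc 1 N, f ((n i : ℝ) * x))
    (bulkSum n p (k + 1) N x)
  have t2 := abs_sub_abs_le_abs_sub (bulkSum n p (k + 1) N x)
    (bulkSum n p (k + 1) (i * 2 ^ (k - s)) x)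
  calc _ ≤ (l2Norm f + δ / 2) * R + δ / 4 * R + δ / 4 * R := by linarith
    _ = _ := by ring

end IsDyadicApprox

/-! ### Block sums and their joint characteristic functions -/

/-- The main indices at scale `2 s K` in the block `(2 ^ (s (k - 1)), 2 ^ (s k)]`. -/
noncomputable def blockSet (n : ℕ → ℕ) (s K k : ℕ) : Finset ℕ :=
  Finset.Ioc (2 ^ (s * (k - 1))) (2 ^ (s * k)) ∩ dyadicBulk n (2 * s * K)

/-- The normalised sum over a block. -/
noncomputable def blockVar (n : ℕ → ℕ) (p : ℕ → ℝ → ℝ) (s K k : ℕ) (x : ℝ) : ℝ :=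
  weightedSum n (blockSet n s K k)
    (fun _ ↦ (√(unitVariance (p (2 * s * K))) * √(blockSet n s K k).card)⁻¹) (p (2 * s * K)) x

lemma blockVar_eq (n : ℕ → ℕ) (p : ℕ → ℝ → ℝ) (s K k : ℕ) (x : ℝ) :
    blockVar n p s K k x = (√(unitVariance (p (2 * s * K))) * √(blockSet n s K k).card)⁻¹ *
      (bulkSum n p (2 * s * K) (2 ^ (s * k)) x - bulkSum n p (2 * s * K) (2 ^ (s * (k - 1))) x) := by
  rw [bulkSum_sub n p _ (Nat.pow_le_pow_right two_pos (Nat.mul_le_mul_left s (Nat.sub_le k 1))),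
    blockVar, blockSet, weightedSum, weightedSum, Finset.mul_sum]
  simp

lemma disjoint_blockSet (n : ℕ → ℕ) (s K : ℕ) {j k : ℕ} (hjk : j ≠ k) :
    Disjoint (blockSet n s K j) (blockSet n s K k) := by
  classical
  have key : ∀ {j k : ℕ}, j < k → Disjoint (blockSet n s K j) (blockSet n s K k) := by
    intro j k hjk
    rw [Finset.disjoint_left]
    intro i hi hi'
    simp only [blockSet, Finset.mem_inter, Finset.mem_Ioc] at hi hi'
    have : 2 ^ (s * j) ≤ 2 ^ (s * (k - 1)) :=
      Nat.pow_le_pow_right two_pos (Nat.mul_le_mul_left s (by omega))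
    omega
  rcases hjk.lt_or_gt with h | h
  · exact key h
  · exact (key h).symm

/-- The number of discarded indices is at most `2 ^ (2 s K / 8)`, hence at most `2 ^ (s (k - 1))`
since `K ≤ k - 1`; the other copy of `2 ^ (s (k - 1))` is the part before the block. -/
lemma two_pow_le_card_blockSet_add {n : ℕ → ℕ} (hn_inj : Set.InjOn n (Set.Ici 1)) {s K k : ℕ}
    (hk1 : K < k) (hk2 : k ≤ 2 * K) :
    2 ^ (s * k) ≤ (blockSet n s K k).card + 2 * 2 ^ (s * (k - 1)) := by
  have hle : 2 ^ (s * (k - 1)) ≤ 2 ^ (s * k) :=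
    Nat.pow_le_pow_right two_pos (Nat.mul_le_mul_left s (by omega))
  have h1 := IsDyadicApprox.card_le_card_inter_add hn_inj (2 * s * K)
    (J := Finset.Ioc (2 ^ (s * (k - 1))) (2 ^ (s * k))) (by
      intro i hi
      rw [Finset.mem_Ioc] at hi
      rw [Finset.mem_Icc]
      refine ⟨Nat.one_le_of_lt hi.1, hi.2.trans (Nat.pow_le_pow_right two_pos ?_)⟩
      calc s * k ≤ s * (2 * K) := Nat.mul_le_mul_left s hk2
        _ = 2 * s * K := by ring)
  rw [Nat.card_Ioc] at h1
  have h2 : 2 ^ (2 * s * K / 8) ≤ 2 ^ (s * (k - 1)) := by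
    refine Nat.pow_le_pow_right two_pos ?_
    have : s * K ≤ s * (k - 1) := Nat.mul_le_mul_left s (by omega)
    have h3 : 2 * s * K = 2 * (s * K) := by ring
    omega
  change _ ≤ (blockSet n s K k).card + _ at h1
  omega

lemma two_pow_le_two_mul_card_blockSet {n : ℕ → ℕ} (hn_inj : Set.InjOn n (Set.Ici 1)) {s K k : ℕ}
    (hs : 2 ≤ s) (hk1 : K < k) (hk2 : k ≤ 2 * K) :
    2 ^ (s * k) ≤ 2 * (blockSet n s K k).card := by
  have h1 := two_pow_le_card_blockSet_add hn_inj (s := s) hk1 hk2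
  have h2 : 4 * 2 ^ (s * (k - 1)) ≤ 2 ^ (s * k) := by
    have : s * k = s * (k - 1) + s := by
      obtain ⟨j, rfl⟩ : ∃ j, k = j + 1 := ⟨k - 1, by omega⟩
      simp [mul_add]
    rw [this, pow_add, mul_comm]
    exact Nat.mul_le_mul_left _ (Nat.pow_le_pow_right two_pos hs)
  omega

lemma tendsto_pow_div_sqrt_two_pow (c : ℝ) (j : ℕ) :
    Tendsto (fun K : ℕ ↦ c * (K : ℝ) ^ j / √(2 ^ K)) atTop (𝓝 0) := by
  have h1 := (tendsto_pow_const_mul_const_pow_of_abs_lt_one j (r := (√2)⁻¹) (by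
    rw [abs_of_pos (by positivity)]
    exact inv_lt_one_of_one_lt₀ (by rw [Real.lt_sqrt] <;> norm_num))).const_mul c
  rw [mul_zero] at h1
  refine h1.congr fun K ↦ ?_
  have : √((2 : ℝ) ^ K) = √2 ^ K := by
    rw [Real.sqrt_eq_iff_mul_self_eq (by positivity) (by positivity), ← mul_pow,
      Real.mul_self_sqrt (by norm_num)]
  rw [this, inv_pow]
  ring

namespace IsDyadicApprox

variable {f : ℝ → ℝ} {p : ℕ → ℝ → ℝ} {B C : ℝ} {n : ℕ → ℕ}

lemma tendsto_mul_atTop {s : ℕ} (hs : 2 ≤ s) : Tendsto (fun K : ℕ ↦ 2 * s * K) atTop atTop := by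
  refine tendsto_atTop_mono (fun K ↦ ?_) tendsto_id
  simp only [id]
  nlinarith [Nat.zero_le K]

-- A combination of two block sums is one weighted sum over a disjoint union, so the characteristic
-- function estimate applies directly. With order `2 ⌊A log K⌋` the truncation error is a power of
-- `K` even for frequencies of size `√(a log K)`, and the cubic error is exponentially small because
-- blocks have at least `2 ^ K` elements.
set_option maxHeartbeats 800000 in
lemma eventually_norm_integral_cexp_sub_le (h : IsDyadicApprox f p B C) (hn : LogDissociated n)
    (hn_inj : Set.InjOn n (Set.Ici 1)) (hσ : 0 < l2Norm f) {s : ℕ} (hs : 2 ≤ s) {a : ℝ}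
    (ha : 0 < a) :
    ∀ᶠ K : ℕ in atTop, ∀ j ∈ Finset.Ioc K (2 * K), ∀ k ∈ Finset.Ioc K (2 * K), j ≠ k →
      ∀ t u : ℝ, t ^ 2 ≤ a * Real.log K → u ^ 2 ≤ a * Real.log K →
      ‖∫ x, Complex.exp ((t * blockVar n p s K j x + u * blockVar n p s K k x : ℝ) * Complex.I)
          ∂unitMeasure - (Real.exp (-(t ^ 2 + u ^ 2) / 2) : ℂ)‖ ≤ ((K : ℝ) ^ 3)⁻¹ := by
  classical
  have hB := h.bound_pos
  have hκ := tendsto_mul_atTop hs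
  set σ := l2Norm f
  set a' := Real.exp 1 ^ 2 * B ^ 2 * (2 * a) / σ ^ 2 with ha'
  -- With `z = exp 1` the exponential factor is at most `K ^ a'`, while `z ^ (2 m) ≥ exp (-2) * K ^
  -- (a' + 4)`. The quotient is `O(K ^ (-4))`, and `K ≥ 8 * exp 2` turns it into half of `K ^ (-3)`.
  set A := (a' + 4) / 2 with hA
  have ha'0 : 0 < a' := by positivity
  have hA0 : 0 < A := by positivity
  have hvar : ∀ᶠ K : ℕ in atTop, σ ^ 2 / 2 < unitVariance (p (2 * s * K)) :=
    (h.tendsto_unitVariance.comp hκ).eventually (lt_mem_nhds (by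
      have : 0 < σ ^ 2 := by positivity
      linarith))
  have hdis := hκ.eventually (hn (2 * A) (by positivity))
  have hAlog : ∀ᶠ K : ℕ in atTop, A * Real.log K ≤ K := by
    have h1 := Real.isLittleO_log_id_atTop.bound (c := A⁻¹) (by positivity)
    filter_upwards [tendsto_natCast_atTop_atTop.eventually h1] with K hK
    simp only [id, Real.norm_eq_abs, Nat.abs_cast] at hK
    rw [abs_of_nonneg (Real.log_natCast_nonneg K), inv_mul_eq_div, le_div_iff₀ hA0] at hK
    linarith
  have hsmall1 := (tendsto_pow_div_sqrt_two_pow ((a + 1) * B * (2 / σ)) 1).eventually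
    (gt_mem_nhds one_pos)
  have hsmall2 := (tendsto_pow_div_sqrt_two_pow (4 * ((a + 1) * B * (2 / σ)) ^ 3) 6).eventually
    (gt_mem_nhds one_pos)
  filter_upwards [hvar, hdis, hAlog, hsmall1, hsmall2, eventually_ge_atTop 2,
    tendsto_natCast_atTop_atTop.eventually_ge_atTop (8 * Real.exp 2)] with
    K h1 h2 h3 h4 h5 h6 h7 j hj k hk hjk t u ht hu
  rw [Finset.mem_Ioc] at hj hk
  have hK1 : (1 : ℝ) < K := by exact_mod_cast h6
  have hK0 : (0 : ℝ) < K := by linarith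
  have hlog0 : 0 ≤ Real.log K := Real.log_natCast_nonneg K
  set κ := 2 * s * K with hκdef
  set V := unitVariance (p κ) with hV
  have hV0 : 0 < V := lt_trans (by positivity) h1
  set S := √V with hS
  have hS0 : 0 < S := Real.sqrt_pos.2 hV0
  have hSS : S ^ 2 = V := Real.sq_sqrt hV0.le
  have hSσ : σ / 2 ≤ S := by
    refine Real.le_sqrt_of_sq_le ?_
    have : (σ / 2) ^ 2 = σ ^ 2 / 2 / 2 := by ring
    have : 0 < σ ^ 2 / 2 := by positivity
    linarith
  have hcard : ∀ k, K < k ∧ k ≤ 2 * K → (2 : ℝ) ^ K ≤ (blockSet n s K k).card := by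
    intro k hk
    have e1 := two_pow_le_two_mul_card_blockSet hn_inj hs hk.1 hk.2
    have e2 : 2 ^ (K + 1) ≤ 2 ^ (s * k) := Nat.pow_le_pow_right two_pos (by nlinarith)
    have e3 : 2 ^ K ≤ (blockSet n s K k).card := by
      rw [pow_succ] at e2
      omega
    exact_mod_cast e3
  have hIj := hcard j hj
  have hIk := hcard k hk
  set Ij := blockSet n s K j with hIjdef
  set Ik := blockSet n s K k with hIkdef
  have hdisj : Disjoint Ij Ik := disjoint_blockSet n s K hjk
  have hLj : (0 : ℝ) < Ij.card := lt_of_lt_of_le (by positivity) hIj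
  have hLk : (0 : ℝ) < Ik.card := lt_of_lt_of_le (by positivity) hIk
  set w : ℕ → ℝ := fun i ↦ if i ∈ Ij then t * (S * √Ij.card)⁻¹ else u * (S * √Ik.card)⁻¹ with hw
  have hwj : ∀ i ∈ Ij, w i = t * (S * √Ij.card)⁻¹ := fun i hi ↦ by simp [hw, hi]
  have hwk : ∀ i ∈ Ik, w i = u * (S * √Ik.card)⁻¹ := fun i hi ↦ by
    simp [hw, Finset.disjoint_right.1 hdisj hi]
  have hsum : ∀ x, t * blockVar n p s K j x + u * blockVar n p s K k x =
      weightedSum n (Ij ∪ Ik) w (p κ) x := by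
    intro x
    rw [weightedSum, Finset.sum_union hdisj, blockVar, blockVar, weightedSum, weightedSum,
      Finset.mul_sum, Finset.mul_sum]
    congr 1
    · exact Finset.sum_congr rfl fun i hi ↦ by
        rw [hwj i hi]
        exact (mul_assoc _ _ _).symm
    · exact Finset.sum_congr rfl fun i hi ↦ by
        rw [hwk i hi]
        exact (mul_assoc _ _ _).symm
  have hw2 : ∑ i ∈ Ij ∪ Ik, w i ^ 2 = (t ^ 2 + u ^ 2) / V := by
    rw [Finset.sum_union hdisj, Finset.sum_congr rfl fun i hi ↦ by rw [hwj i hi],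
      Finset.sum_congr (s₁ := Ik) rfl fun i hi ↦ by rw [hwk i hi], Finset.sum_const,
      Finset.sum_const, nsmul_eq_mul, nsmul_eq_mul, mul_pow, mul_pow, inv_pow, inv_pow, mul_pow,
      mul_pow, hSS, Real.sq_sqrt hLj.le, Real.sq_sqrt hLk.le]
    field_simp
  have habs : ∀ t : ℝ, t ^ 2 ≤ a * Real.log K → |t| ≤ (a + 1) * K := by
    intro t ht
    have e1 : Real.log K ≤ K := Real.log_le_self hK0.le
    refine abs_le_of_sq_le_sq (ht.trans ?_) (by positivity)
    have : a * Real.log K ≤ a * K := by gcongr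
    nlinarith [mul_pos ha hK0, mul_pos (mul_pos ha hK0) hK0]
  set b := (a + 1) * B * (2 / σ) * K / √(2 ^ K) with hb
  have hb0 : 0 ≤ b := by positivity
  have hb1 : b < 1 := by simpa [hb] using h4
  have hbd : ∀ (t : ℝ) (L : ℝ), t ^ 2 ≤ a * Real.log K → (2 : ℝ) ^ K ≤ L →
      |t * (S * √L)⁻¹| * B ≤ (a + 1) * B * (2 / σ) * K / √L := by
    intro t L ht hL
    have hL0 : 0 < √L := Real.sqrt_pos.2 (lt_of_lt_of_le (by positivity) hL)
    rw [abs_mul, abs_of_pos (inv_pos.2 (mul_pos hS0 hL0)), mul_inv]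
    have e1 : S⁻¹ ≤ 2 / σ := by
      rw [← inv_div]
      exact inv_anti₀ (by positivity) hSσ
    calc |t| * (S⁻¹ * (√L)⁻¹) * B ≤ (a + 1) * K * (2 / σ * (√L)⁻¹) * B := by
          gcongr
          exact habs t ht
      _ = _ := by ring
  have hbd' : ∀ (t : ℝ) (L : ℝ), t ^ 2 ≤ a * Real.log K → (2 : ℝ) ^ K ≤ L →
      |t * (S * √L)⁻¹| * B ≤ b := by
    intro t L ht hL
    refine (hbd t L ht hL).trans ?_
    rw [hb]
    gcongr
  have hcube : ∀ (t : ℝ) (L : ℝ), t ^ 2 ≤ a * Real.log K → (2 : ℝ) ^ K ≤ L →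
      L * (|t * (S * √L)⁻¹| * B) ^ 3 ≤ ((K : ℝ) ^ 3)⁻¹ / 4 := by
    intro t L ht hL
    have hL1 : 0 < L := lt_of_lt_of_le (by positivity) hL
    have hL0 : 0 < √L := Real.sqrt_pos.2 hL1
    set q := (a + 1) * B * (2 / σ) with hq
    have hq0 : 0 ≤ q := by positivity
    calc L * (|t * (S * √L)⁻¹| * B) ^ 3 ≤ L * (q * K / √L) ^ 3 := by
          gcongr
          exact hbd t L ht hL
      _ = q ^ 3 * K ^ 3 / √L := by
          rw [div_pow, mul_pow, pow_succ √L 2, Real.sq_sqrt hL1.le]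
          field_simp
      _ ≤ q ^ 3 * K ^ 3 / √(2 ^ K) := by gcongr
      _ = (4 * q ^ 3 * K ^ 6 / √(2 ^ K)) * (((K : ℝ) ^ 3)⁻¹ / 4) := by
          field_simp
      _ ≤ 1 * (((K : ℝ) ^ 3)⁻¹ / 4) := by gcongr
      _ = _ := one_mul _
  set m := ⌊A * Real.log K⌋₊ with hm
  have hm1 : (m : ℝ) ≤ A * Real.log K := Nat.floor_le (by positivity)
  have hKκ : K ≤ κ := Nat.le_mul_of_pos_left K (by omega)
  have hmr : 2 * m ≤ ⌊2 * A * Real.log κ⌋₊ := by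
    refine Nat.le_floor ?_
    have : Real.log K ≤ Real.log κ := Real.log_le_log hK0 (by exact_mod_cast hKκ)
    have := mul_le_mul_of_nonneg_left this hA0.le
    push_cast
    linarith
  have hmκ : m ≤ κ := by
    have : (m : ℝ) ≤ K := hm1.trans h3
    have : m ≤ K := by exact_mod_cast this
    omega
  have hsub : Ij ∪ Ik ⊆ dyadicBulk n κ :=
    Finset.union_subset Finset.inter_subset_right Finset.inter_subset_right
  have key := (h2.mono hsub le_rfl le_rfl).norm_charFun_sub_le w (h.trig κ) hmr
    (two_mul_mul_two_pow_le hmκ) (z := Real.exp 1) (Real.exp_pos 1) (fun i hi ↦ by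
      rcases Finset.mem_union.1 hi with hi | hi
      · rw [hwj i hi]
        exact (hbd' t _ ht hIj).trans hb1.le
      · rw [hwk i hi]
        exact (hbd' u _ hu hIk).trans hb1.le)
  rw [hw2] at key
  have e0 : -(V * ((t ^ 2 + u ^ 2) / V) / 2) = -(t ^ 2 + u ^ 2) / 2 := by
    field_simp
  rw [e0] at key
  simp_rw [hsum]
  refine key.trans ?_
  have e1 : ∑ i ∈ Ij ∪ Ik, (|w i| * B) ^ 3 ≤ ((K : ℝ) ^ 3)⁻¹ / 2 := by
    rw [Finset.sum_union hdisj, Finset.sum_congr rfl fun i hi ↦ by rw [hwj i hi],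
      Finset.sum_congr (s₁ := Ik) rfl fun i hi ↦ by rw [hwk i hi], Finset.sum_const,
      Finset.sum_const, nsmul_eq_mul, nsmul_eq_mul]
    have c1 := hcube t _ ht hIj
    have c2 := hcube u _ hu hIk
    linarith
  have e2 : 4 / Real.exp 1 ^ (2 * m) * Real.exp (Real.exp 1 ^ 2 * B ^ 2 * ((t ^ 2 + u ^ 2) / V) / 2)
      ≤ ((K : ℝ) ^ 3)⁻¹ / 2 := by
    have c1 : Real.exp 1 ^ 2 * B ^ 2 * ((t ^ 2 + u ^ 2) / V) / 2 ≤ a' * Real.log K := by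
      have : (t ^ 2 + u ^ 2) / V ≤ (2 * a * Real.log K) / (σ ^ 2 / 2) := by
        gcongr
        linarith
      calc _ ≤ Real.exp 1 ^ 2 * B ^ 2 * ((2 * a * Real.log K) / (σ ^ 2 / 2)) / 2 := by gcongr
        _ = _ := by rw [ha']; field_simp
    have c2 : 2 * A * Real.log K - 2 ≤ 2 * m := by
      have := Nat.lt_floor_add_one (A * Real.log K)
      linarith
    have c3 : Real.exp 1 ^ (2 * m) = Real.exp (2 * m) := by
      rw [← Real.exp_nat_mul]
      push_cast
      ring_nf
    rw [c3, div_mul_eq_mul_div, mul_div_assoc, ← Real.exp_sub]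
    have c4 : Real.exp (Real.exp 1 ^ 2 * B ^ 2 * ((t ^ 2 + u ^ 2) / V) / 2 - 2 * m) ≤
        Real.exp 2 * ((K : ℝ) ^ 4)⁻¹ := by
      have : ((K : ℝ) ^ 4)⁻¹ = Real.exp (-(4 * Real.log K)) := by
        rw [Real.exp_neg, show (4 : ℝ) * Real.log K = (4 : ℕ) * Real.log K by norm_num,
          Real.exp_nat_mul, Real.exp_log hK0]
      rw [this, ← Real.exp_add, Real.exp_le_exp]
      have : 2 * A = a' + 4 := by rw [hA]; ring
      rw [this] at c2
      linarith
    calc 4 * Real.exp (Real.exp 1 ^ 2 * B ^ 2 * ((t ^ 2 + u ^ 2) / V) / 2 - 2 * m)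
        ≤ 4 * (Real.exp 2 * ((K : ℝ) ^ 4)⁻¹) := by gcongr
      _ = (8 * Real.exp 2) * ((K : ℝ) ^ 4)⁻¹ / 2 := by ring
      _ ≤ K * ((K : ℝ) ^ 4)⁻¹ / 2 := by gcongr
      _ = _ := by field_simp
  linarith

end IsDyadicApprox

/-! ### Trigonometric bumps and comparison with the Gaussian -/

/-- A trigonometric bump function centred at `a`. -/
noncomputable def bump (c a : ℝ) (l : ℕ) (y : ℝ) : ℝ := ((1 + Real.cos (c * (y - a))) / 2) ^ l

/-- The Fourier coefficients of `bump`. -/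
noncomputable def bumpCoeff (c a : ℝ) (l q : ℕ) : ℂ :=
  ((2 * l).choose q / 4 ^ l : ℝ) * Complex.exp ((-(((q : ℝ) - l) * c * a) : ℝ) * Complex.I)

lemma continuous_bump (c a : ℝ) (l : ℕ) : Continuous (bump c a l) := by
  unfold bump
  fun_prop

lemma bump_nonneg (c a : ℝ) (l : ℕ) (y : ℝ) : 0 ≤ bump c a l y :=
  pow_nonneg (by linarith [Real.neg_one_le_cos (c * (y - a))]) l

lemma bump_le_one (c a : ℝ) (l : ℕ) (y : ℝ) : bump c a l y ≤ 1 :=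
  pow_le_one₀ (by linarith [Real.neg_one_le_cos (c * (y - a))])
    (by linarith [Real.cos_le_one (c * (y - a))])

/-- `(1 + cos θ) / 2 = cos (θ / 2) ^ 2`, so the bump is the power `2 l` of a cosine, expanded by the
binomial theorem. Its frequencies are bounded by `l * c`. -/
lemma bump_eq_sum (c a : ℝ) (l : ℕ) (y : ℝ) : (bump c a l y : ℂ) =
    ∑ q ∈ Finset.range (2 * l + 1), bumpCoeff c a l q *
      Complex.exp (((((q : ℝ) - l) * c) * y : ℝ) * Complex.I) := by
  set θ := c * (y - a) with hθ
  have h1 : (((1 + Real.cos θ) / 2 : ℝ) : ℂ) =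
      ((Complex.exp (θ / 2 * Complex.I) + Complex.exp (-(θ / 2) * Complex.I)) / 2) ^ 2 := by
    have : (1 + Real.cos θ) / 2 = Real.cos (θ / 2) ^ 2 := by
      rw [Real.cos_sq]
      ring_nf
    rw [this]
    push_cast
    rw [Complex.cos]
  rw [bump, Complex.ofReal_pow, h1, ← pow_mul, div_pow, add_pow, Finset.sum_div]
  refine Finset.sum_congr rfl fun q hq ↦ ?_
  have hq' : q ≤ 2 * l := Nat.lt_succ_iff.1 (Finset.mem_range.1 hq)
  rw [bumpCoeff, ← Complex.exp_nat_mul, ← Complex.exp_nat_mul, ← Complex.exp_add, mul_assoc,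
    ← Complex.exp_add, pow_mul]
  have h2 : (q : ℂ) * (θ / 2 * Complex.I) + ((2 * l - q : ℕ) : ℂ) * (-(θ / 2) * Complex.I) =
      (-(((q : ℝ) - l) * c * a) : ℝ) * Complex.I + ((((q : ℝ) - l) * c) * y : ℝ) * Complex.I := by
    rw [Nat.cast_sub hq', hθ]
    push_cast
    ring
  rw [h2]
  push_cast
  norm_num
  ring

/-- Absolute Fourier coefficients summing to one mean that errors in characteristic functions pass
to expectations of bumps without amplification. -/
lemma sum_norm_bumpCoeff (c a : ℝ) (l : ℕ) :
    ∑ q ∈ Finset.range (2 * l + 1), ‖bumpCoeff c a l q‖ = 1 := by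
  have h1 : ∀ q, ‖bumpCoeff c a l q‖ = (2 * l).choose q / 4 ^ l := fun q ↦ by
    rw [bumpCoeff, norm_mul, Complex.norm_exp_ofReal_mul_I, mul_one, Complex.norm_real,
      Real.norm_of_nonneg (by positivity)]
  simp_rw [h1]
  rw [← Finset.sum_div, ← Nat.cast_sum, Nat.sum_range_choose, pow_mul]
  norm_num

lemma abs_freq_le {c : ℝ} (hc : 0 ≤ c) {l q : ℕ} (hq : q ∈ Finset.range (2 * l + 1)) :
    |((q : ℝ) - l) * c| ≤ l * c := by
  have hq' : q ≤ 2 * l := Nat.lt_succ_iff.1 (Finset.mem_range.1 hq)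
  have : (q : ℝ) ≤ 2 * l := by exact_mod_cast hq'
  rw [abs_mul, abs_of_nonneg hc]
  refine mul_le_mul_of_nonneg_right (abs_le.2 ⟨?_, ?_⟩) hc
  · linarith [Nat.cast_nonneg (α := ℝ) q]
  · linarith

/-- The mean of `bump` under the standard normal law. -/
noncomputable def gaussianBump (c a : ℝ) (l : ℕ) : ℝ := ∫ y, bump c a l y ∂gaussianReal 0 1

lemma gaussianBump_eq_sum (c a : ℝ) (l : ℕ) : (gaussianBump c a l : ℂ) =
    ∑ q ∈ Finset.range (2 * l + 1), bumpCoeff c a l q *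
      (Real.exp (-(((q : ℝ) - l) * c) ^ 2 / 2) : ℂ) := by
  rw [gaussianBump, ← integral_complex_ofReal]
  simp_rw [bump_eq_sum]
  rw [integral_finsetSum]
  · refine Finset.sum_congr rfl fun q _ ↦ ?_
    rw [integral_const_mul]
    congr 1
    have := charFun_gaussianReal (μ := 0) (v := 1) (((q : ℝ) - l) * c)
    rw [charFun_apply_real] at this
    push_cast at this ⊢
    rw [this]
    congr 1
    ring
  · intro q _
    refine (Integrable.of_bound (Continuous.aestronglyMeasurable (by fun_prop)) 1
      (Eventually.of_forall fun y ↦ ?_)).const_mul _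
    rw [Complex.norm_exp_ofReal_mul_I]

lemma gaussianBump_le_one (c a : ℝ) (l : ℕ) : gaussianBump c a l ≤ 1 := by
  have := integral_mono (μ := gaussianReal 0 1) (f := bump c a l) (g := fun _ ↦ 1)
    (Integrable.of_bound (continuous_bump c a l).aestronglyMeasurable 1
      (Eventually.of_forall fun y ↦ by
        rw [Real.norm_of_nonneg (bump_nonneg _ _ _ _)]; exact bump_le_one _ _ _ _))
    (integrable_const _) (bump_le_one c a l)
  simpa [gaussianBump] using this

section Comparison

variable {α : Type*} [MeasurableSpace α] {μ : Measure α} [IsProbabilityMeasure μ]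

lemma integrable_cexp_mul_I {X : α → ℝ} (hX : Measurable X) :
    Integrable (fun x ↦ Complex.exp ((X x : ℝ) * Complex.I)) μ := by
  refine Integrable.of_bound (Measurable.aestronglyMeasurable (by fun_prop)) 1
    (Eventually.of_forall fun y ↦ ?_)
  rw [Complex.norm_exp_ofReal_mul_I]

lemma abs_integral_bump_mul_sub_le {X Y : α → ℝ} (hX : Measurable X) (hY : Measurable Y) {c a e : ℝ}
    (hc : 0 ≤ c) {l : ℕ} (h : ∀ t u : ℝ, |t| ≤ l * c → |u| ≤ l * c →
      ‖∫ x, Complex.exp ((t * X x + u * Y x : ℝ) * Complex.I) ∂μ -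
        (Real.exp (-(t ^ 2 + u ^ 2) / 2) : ℂ)‖ ≤ e) :
    |∫ x, bump c a l (X x) * bump c a l (Y x) ∂μ - gaussianBump c a l ^ 2| ≤ e := by
  set τ : ℕ → ℝ := fun q ↦ ((q : ℝ) - l) * c with hτ
  set b := bumpCoeff c a l with hb
  set R := Finset.range (2 * l + 1) with hR
  have h1 : ((∫ x, bump c a l (X x) * bump c a l (Y x) ∂μ : ℝ) : ℂ) =
      ∑ q ∈ R, ∑ r ∈ R, b q * b r *
        ∫ x, Complex.exp ((τ q * X x + τ r * Y x : ℝ) * Complex.I) ∂μ := by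
    have : ∀ x, ((bump c a l (X x) * bump c a l (Y x) : ℝ) : ℂ) = ∑ q ∈ R, ∑ r ∈ R, b q * b r *
        Complex.exp ((τ q * X x + τ r * Y x : ℝ) * Complex.I) := by
      intro x
      rw [Complex.ofReal_mul, bump_eq_sum, bump_eq_sum, Finset.sum_mul_sum]
      refine Finset.sum_congr rfl fun q _ ↦ Finset.sum_congr rfl fun r _ ↦ ?_
      rw [Complex.ofReal_add, add_mul, Complex.exp_add]
      ring
    rw [← integral_complex_ofReal]
    simp_rw [this]
    have hint : ∀ q r, Integrable (fun x ↦ b q * b r *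
        Complex.exp ((τ q * X x + τ r * Y x : ℝ) * Complex.I)) μ := fun q r ↦
      (integrable_cexp_mul_I (by fun_prop)).const_mul _
    rw [integral_finsetSum _ fun q _ ↦ integrable_finsetSum _ fun r _ ↦ hint q r]
    refine Finset.sum_congr rfl fun q _ ↦ ?_
    rw [integral_finsetSum _ fun r _ ↦ hint q r]
    simp_rw [integral_const_mul]
  have h2 : ((gaussianBump c a l ^ 2 : ℝ) : ℂ) =
      ∑ q ∈ R, ∑ r ∈ R, b q * b r * (Real.exp (-(τ q ^ 2 + τ r ^ 2) / 2) : ℂ) := by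
    have hG : (gaussianBump c a l : ℂ) = ∑ q ∈ R, b q * (Real.exp (-τ q ^ 2 / 2) : ℂ) :=
      gaussianBump_eq_sum c a l
    rw [sq, Complex.ofReal_mul, hG, Finset.sum_mul_sum]
    refine Finset.sum_congr rfl fun q _ ↦ Finset.sum_congr rfl fun r _ ↦ ?_
    rw [show -(τ q ^ 2 + τ r ^ 2) / 2 = -τ q ^ 2 / 2 + -τ r ^ 2 / 2 by ring, Real.exp_add,
      Complex.ofReal_mul]
    ring
  rw [← Real.norm_eq_abs, ← Complex.norm_real, Complex.ofReal_sub, h1, h2,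
    ← Finset.sum_sub_distrib]
  simp_rw [← Finset.sum_sub_distrib, ← mul_sub]
  calc _ ≤ ∑ q ∈ R, ∑ r ∈ R, ‖b q‖ * ‖b r‖ * e := by
        refine (norm_sum_le _ _).trans (Finset.sum_le_sum fun q hq ↦
          (norm_sum_le _ _).trans (Finset.sum_le_sum fun r hr ↦ ?_))
        rw [norm_mul, norm_mul]
        exact mul_le_mul_of_nonneg_left (h _ _ (abs_freq_le hc hq) (abs_freq_le hc hr))
          (by positivity)
    _ = (∑ q ∈ R, ‖b q‖) * (∑ r ∈ R, ‖b r‖) * e := by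
        rw [Finset.sum_mul_sum, Finset.sum_mul]
        simp_rw [Finset.sum_mul]
    _ = e := by rw [hR, hb, sum_norm_bumpCoeff, one_mul, one_mul]

lemma abs_integral_bump_sub_le {X : α → ℝ} (hX : Measurable X) {c a e : ℝ}
    (hc : 0 ≤ c) {l : ℕ} (h : ∀ t : ℝ, |t| ≤ l * c →
      ‖∫ x, Complex.exp ((t * X x : ℝ) * Complex.I) ∂μ - (Real.exp (-t ^ 2 / 2) : ℂ)‖ ≤ e) :
    |∫ x, bump c a l (X x) ∂μ - gaussianBump c a l| ≤ e := by
  rw [← Real.norm_eq_abs, ← Complex.norm_real, Complex.ofReal_sub, gaussianBump_eq_sum,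
    ← integral_complex_ofReal]
  simp_rw [bump_eq_sum]
  rw [integral_finsetSum _ fun q _ ↦ (integrable_cexp_mul_I (by fun_prop)).const_mul _,
    ← Finset.sum_sub_distrib]
  simp_rw [integral_const_mul, ← mul_sub]
  calc _ ≤ ∑ q ∈ Finset.range (2 * l + 1), ‖bumpCoeff c a l q‖ * e := by
        refine (norm_sum_le _ _).trans (Finset.sum_le_sum fun q hq ↦ ?_)
        rw [norm_mul]
        exact mul_le_mul_of_nonneg_left (h _ (abs_freq_le hc hq)) (norm_nonneg _)
    _ = e := by rw [← Finset.sum_mul, sum_norm_bumpCoeff, one_mul]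

/-- Chebyshev's inequality for nearly pairwise uncorrelated variables with values in `[0, 1]`. -/
lemma measureReal_sum_lt_one_le {S : Finset ℕ} {W : ℕ → α → ℝ} (hW : ∀ k, Measurable (W k))
    (hW0 : ∀ k x, 0 ≤ W k x) (hW1 : ∀ k x, W k x ≤ 1) {g e : ℝ} (hg0 : 0 < g) (hg1 : g ≤ 1)
    (he : 0 ≤ e) (h1 : ∀ k ∈ S, |∫ x, W k x ∂μ - g| ≤ e)
    (h2 : ∀ j ∈ S, ∀ k ∈ S, j ≠ k → |∫ x, W j x * W k x ∂μ - g ^ 2| ≤ e)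
    (hS : 2 ≤ S.card * g) :
    μ.real {x | ∑ k ∈ S, W k x < 1} ≤ 4 / (S.card * g) + 12 * e / g ^ 2 := by
  classical
  have hint : ∀ j k, Integrable (fun x ↦ W j x * W k x) μ := fun j k ↦ by
    refine Integrable.of_bound ((hW j).mul (hW k)).aestronglyMeasurable 1
      (Eventually.of_forall fun x ↦ ?_)
    rw [Real.norm_of_nonneg (mul_nonneg (hW0 j x) (hW0 k x))]
    exact mul_le_one₀ (hW1 j x) (hW0 k x) (hW1 k x)
  have hint1 : ∀ k, Integrable (W k) μ := fun k ↦ by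
    refine Integrable.of_bound (hW k).aestronglyMeasurable 1 (Eventually.of_forall fun x ↦ ?_)
    rw [Real.norm_of_nonneg (hW0 k x)]
    exact hW1 k x
  have hcov : ∀ j k, ∫ x, (W j x - g) * (W k x - g) ∂μ =
      ∫ x, W j x * W k x ∂μ - g * ∫ x, W j x ∂μ - g * ∫ x, W k x ∂μ + g ^ 2 := by
    intro j k
    have : ∀ x, (W j x - g) * (W k x - g) = W j x * W k x - g * W j x - g * W k x + g ^ 2 :=
      fun x ↦ by ring
    simp_rw [this]
    have i1 : Integrable (fun x ↦ W j x * W k x - g * W j x) μ :=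
      (hint j k).sub ((hint1 j).const_mul g)
    have i2 : Integrable (fun x ↦ W j x * W k x - g * W j x - g * W k x) μ :=
      i1.sub ((hint1 k).const_mul g)
    rw [integral_add i2 (integrable_const _), integral_sub i1 ((hint1 k).const_mul g),
      integral_sub (hint j k) ((hint1 j).const_mul g), integral_const_mul, integral_const_mul]
    simp
  have hcov_int : ∀ j k, Integrable (fun x ↦ (W j x - g) * (W k x - g)) μ := fun j k ↦ by
    have : ∀ x, (W j x - g) * (W k x - g) = W j x * W k x - g * W j x - g * W k x + g ^ 2 :=
      fun x ↦ by ring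
    simp_rw [this]
    exact (((hint j k).sub ((hint1 j).const_mul g)).sub ((hint1 k).const_mul g)).add
      (integrable_const _)
  -- Off the diagonal the error is `e + 2 g e ≤ 3 e`; on it, `W ^ 2 ≤ W` gives the additional `g`.
  have hcov_le : ∀ j ∈ S, ∀ k ∈ S, ∫ x, (W j x - g) * (W k x - g) ∂μ ≤
      3 * e + if j = k then g else 0 := by
    intro j hj k hk
    rw [hcov]
    have a1 := abs_le.1 (h1 j hj)
    have a2 := abs_le.1 (h1 k hk)
    split_ifs with hjk
    · subst hjk
      have : ∫ x, W j x * W j x ∂μ ≤ ∫ x, W j x ∂μ :=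
        integral_mono (hint j j) (hint1 j) fun x ↦ mul_le_of_le_one_left (hW0 j x) (hW1 j x)
      nlinarith
    · have a3 := abs_le.1 (h2 j hj k hk hjk)
      nlinarith
  have hsq : ∫ x, (∑ k ∈ S, W k x - S.card * g) ^ 2 ∂μ ≤ S.card ^ 2 * (3 * e) + S.card * g := by
    have : ∀ x, (∑ k ∈ S, W k x - S.card * g) ^ 2 =
        ∑ j ∈ S, ∑ k ∈ S, (W j x - g) * (W k x - g) := by
      intro x
      rw [← Finset.sum_mul_sum, Finset.sum_sub_distrib, Finset.sum_const, nsmul_eq_mul, sq]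
    simp_rw [this]
    rw [integral_finsetSum _ fun j _ ↦ integrable_finsetSum _ fun k _ ↦ hcov_int j k]
    calc ∑ j ∈ S, ∫ x, ∑ k ∈ S, (W j x - g) * (W k x - g) ∂μ
        ≤ ∑ j ∈ S, ∑ k ∈ S, (3 * e + if j = k then g else 0) := by
          refine Finset.sum_le_sum fun j hj ↦ ?_
          rw [integral_finsetSum _ fun k _ ↦ hcov_int j k]
          exact Finset.sum_le_sum fun k hk ↦ hcov_le j hj k hk
      _ = _ := by
          simp_rw [Finset.sum_add_distrib, Finset.sum_const, Finset.sum_ite_eq]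
          rw [Finset.sum_congr rfl fun j hj ↦ if_pos hj, Finset.sum_const]
          simp only [nsmul_eq_mul]
          ring
  set M := (S.card : ℝ) * g with hM
  have hM0 : 0 < M := by linarith
  have hint2 : Integrable (fun x ↦ (∑ k ∈ S, W k x - M) ^ 2) μ := by
    have : ∀ x, (∑ k ∈ S, W k x - M) ^ 2 = ∑ j ∈ S, ∑ k ∈ S, (W j x - g) * (W k x - g) := by
      intro x
      rw [← Finset.sum_mul_sum, Finset.sum_sub_distrib, Finset.sum_const, nsmul_eq_mul, sq]
    simp_rw [this]
    exact integrable_finsetSum _ fun j _ ↦ integrable_finsetSum _ fun k _ ↦ hcov_int j k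
  have hcheb := mul_meas_ge_le_integral_of_nonneg (μ := μ)
    (f := fun x ↦ (∑ k ∈ S, W k x - M) ^ 2) (Eventually.of_forall fun x ↦ sq_nonneg _) hint2
    ((M / 2) ^ 2)
  -- Since `M ≥ 2`, a sum below `1` lies at least `M / 2` below `M`.
  have hmono : μ.real {x | ∑ k ∈ S, W k x < 1} ≤
      μ.real {x | (M / 2) ^ 2 ≤ (∑ k ∈ S, W k x - M) ^ 2} := by
    refine measureReal_mono fun x hx ↦ ?_
    have hx' : ∑ k ∈ S, W k x < 1 := hx
    change (M / 2) ^ 2 ≤ (∑ k ∈ S, W k x - M) ^ 2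
    nlinarith
  have h3 : (M / 2) ^ 2 * μ.real {x | ∑ k ∈ S, W k x < 1} ≤ S.card ^ 2 * (3 * e) + M :=
    (mul_le_mul_of_nonneg_left hmono (sq_nonneg _)).trans (hcheb.trans hsq)
  rw [← le_div_iff₀' (by positivity)] at h3
  refine h3.trans (le_of_eq ?_)
  have hS0 : (S.card : ℝ) ≠ 0 := by
    intro h0
    rw [hM, h0, zero_mul] at hM0
    exact lt_irrefl _ hM0
  rw [hM]
  field_simp
  ring

end Comparison

/-! ### Size and concentration of the bumps -/

/-- On `[a - ρ, a + ρ]` the bump is at least `1 / 2`, by `cos θ ≥ 1 - θ ^ 2 / 2` and Bernoulli's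
inequality, and the Gaussian density is at least its value at `a + ρ`. -/
lemma le_gaussianBump {c a ρ : ℝ} {l : ℕ} (hρ : 0 < ρ) (ha : 0 ≤ a)
    (hl : l * (c * ρ) ^ 2 ≤ 2) :
    ρ / √(2 * Real.pi) * Real.exp (-(a + ρ) ^ 2 / 2) ≤ gaussianBump c a l := by
  rw [gaussianBump, integral_gaussianReal_eq_integral_smul (by norm_num)]
  have hpdf : ∀ y, gaussianPDFReal 0 1 y = (√(2 * Real.pi))⁻¹ * Real.exp (-y ^ 2 / 2) := fun y ↦ by
    simp [gaussianPDFReal]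
  have hcont : Continuous fun y ↦ gaussianPDFReal 0 1 y • bump c a l y := by
    have := continuous_bump c a l
    simp_rw [hpdf, smul_eq_mul]
    fun_prop
  have hnn : ∀ y, 0 ≤ gaussianPDFReal 0 1 y • bump c a l y := fun y ↦
    mul_nonneg (gaussianPDFReal_nonneg _ _ _) (bump_nonneg _ _ _ _)
  have hint : Integrable fun y ↦ gaussianPDFReal 0 1 y • bump c a l y := by
    refine (integrable_gaussianPDFReal 0 1).mono' hcont.aestronglyMeasurable
      (Eventually.of_forall fun y ↦ ?_)
    rw [Real.norm_of_nonneg (hnn y)]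
    exact mul_le_of_le_one_right (gaussianPDFReal_nonneg _ _ _) (bump_le_one _ _ _ _)
  have h1 : ∀ y ∈ Icc (a - ρ) (a + ρ),
      (√(2 * Real.pi))⁻¹ * Real.exp (-(a + ρ) ^ 2 / 2) * (1 / 2) ≤
        gaussianPDFReal 0 1 y • bump c a l y := by
    intro y hy
    have habs : |y - a| ≤ ρ := abs_le.2 ⟨by linarith [hy.1], by linarith [hy.2]⟩
    have hy2 : y ^ 2 ≤ (a + ρ) ^ 2 := by
      refine sq_le_sq' ?_ hy.2
      linarith [hy.1]
    rw [hpdf, smul_eq_mul]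
    have hb : 1 / 2 ≤ bump c a l y := by
      have e1 : 1 - (c * (y - a)) ^ 2 / 4 ≤ (1 + Real.cos (c * (y - a))) / 2 := by
        have := Real.one_sub_sq_div_two_le_cos (x := c * (y - a))
        linarith
      have e2 : (c * (y - a)) ^ 2 ≤ (c * ρ) ^ 2 := by
        rw [mul_pow, mul_pow, ← sq_abs (y - a)]
        gcongr
      rcases Nat.eq_zero_or_pos l with rfl | hl0
      · simp [bump]
        norm_num
      have hl1 : (1 : ℝ) ≤ l := by exact_mod_cast hl0
      have e3 : (c * ρ) ^ 2 ≤ 2 := by nlinarith [sq_nonneg (c * ρ)]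
      have e4 := one_add_mul_le_pow (a := -((c * (y - a)) ^ 2 / 4)) (by linarith) l
      calc (1 / 2 : ℝ) ≤ 1 + l * -((c * (y - a)) ^ 2 / 4) := by nlinarith
        _ ≤ (1 + -((c * (y - a)) ^ 2 / 4)) ^ l := e4
        _ ≤ bump c a l y := by
            refine pow_le_pow_left₀ (by linarith) ?_ l
            linarith
    gcongr
  calc ρ / √(2 * Real.pi) * Real.exp (-(a + ρ) ^ 2 / 2)
      = ∫ _ in Icc (a - ρ) (a + ρ),
        (√(2 * Real.pi))⁻¹ * Real.exp (-(a + ρ) ^ 2 / 2) * (1 / 2) := by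
        rw [setIntegral_const, Real.volume_real_Icc_of_le (by linarith), smul_eq_mul]
        ring
    _ ≤ ∫ y in Icc (a - ρ) (a + ρ), gaussianPDFReal 0 1 y • bump c a l y :=
        setIntegral_mono_on (integrableOn_const (by simp)) hint.integrableOn
          measurableSet_Icc h1
    _ ≤ ∫ y, gaussianPDFReal 0 1 y • bump c a l y :=
        setIntegral_le_integral hint (Eventually.of_forall hnn)

/-- Away from its centre, but within the range `|c * (y - a)| ≤ 1`, the bump decays exponentially in
`l`. The restriction is needed because a bump is periodic and returns to one. -/
lemma bump_le_exp {c a y η : ℝ} {l : ℕ} (hη : 0 ≤ η) (h1 : η ≤ |c * (y - a)|)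
    (h2 : |c * (y - a)| ≤ 1) : bump c a l y ≤ Real.exp (-(l * (η ^ 2 / 10))) := by
  have e1 := (abs_le.1 (Real.cos_bound h2)).2
  have e2 : η ^ 2 ≤ (c * (y - a)) ^ 2 := by
    rw [← sq_abs (c * (y - a))]
    exact pow_le_pow_left₀ hη h1 2
  have e3 : |c * (y - a)| ^ 4 ≤ (c * (y - a)) ^ 2 := by
    rw [← sq_abs (c * (y - a))]
    exact pow_le_pow_of_le_one (abs_nonneg _) h2 (by norm_num)
  have e4 : (1 + Real.cos (c * (y - a))) / 2 ≤ Real.exp (-(η ^ 2 / 10)) := by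
    have := Real.add_one_le_exp (-(η ^ 2 / 10))
    nlinarith [sq_nonneg (c * (y - a))]
  calc bump c a l y ≤ Real.exp (-(η ^ 2 / 10)) ^ l :=
        pow_le_pow_left₀ (by linarith [Real.neg_one_le_cos (c * (y - a))]) e4 l
    _ = _ := by rw [← Real.exp_nat_mul]; congr 1; ring

lemma ceil_mul_le {A l : ℝ} (hA : 0 ≤ A) (hl : 1 ≤ l) : (⌈A * l⌉₊ : ℝ) ≤ (A + 1) * l := by
  have := (Nat.ceil_lt_add_one (mul_nonneg hA (by linarith : 0 ≤ l))).le
  linarith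

/-- Frequency `1 / (H √l)` and degree of order `l` make the bump live at a constant width `ρ`,
uniformly in `l`. With `a = (1 - ε) √(2 l)`, the inequality `(a + ρ) ^ 2 ≤ (1 + ε) a ^ 2 + (1 + 1 /
ε) ρ ^ 2` costs only a constant, and `(1 + ε) (1 - ε) ^ 2 ≤ 1 - ε`. -/
lemma exists_le_gaussianBump {ε H : ℝ} (hε0 : 0 < ε) (hε1 : ε < 1) (hH : 0 < H) :
    ∃ b : ℝ, 0 < b ∧ ∀ l : ℝ, 1 ≤ l → b * Real.exp (-((1 - ε) * l)) ≤
      gaussianBump (H * √l)⁻¹ ((1 - ε) * √(2 * l)) ⌈20 * H ^ 2 / ε ^ 2 * l⌉₊ := by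
  set A := 20 * H ^ 2 / ε ^ 2 with hA
  have hA0 : 0 < A := by positivity
  set ρ := H / √(A + 1) with hρ
  have hρ0 : 0 < ρ := by positivity
  refine ⟨ρ / √(2 * Real.pi) * Real.exp (-((1 + 1 / ε) * ρ ^ 2 / 2)), by positivity,
    fun l hl ↦ ?_⟩
  have hl0 : 0 < l := by linarith
  have hsq : √l ^ 2 = l := Real.sq_sqrt hl0.le
  refine le_trans ?_ (le_gaussianBump hρ0 (mul_nonneg (by linarith) (Real.sqrt_nonneg _)) ?_)
  · rw [mul_assoc, ← Real.exp_add]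
    refine mul_le_mul_of_nonneg_left (Real.exp_le_exp.2 ?_) (by positivity)
    have h2 : √(2 * l) ^ 2 = 2 * l := Real.sq_sqrt (by positivity)
    set y := √(2 * l)
    have h3 : ((1 - ε) * y + ρ) ^ 2 ≤ (1 + ε) * ((1 - ε) * y) ^ 2 + (1 + 1 / ε) * ρ ^ 2 := by
      have : (1 + ε) * ((1 - ε) * y) ^ 2 + (1 + 1 / ε) * ρ ^ 2 - ((1 - ε) * y + ρ) ^ 2 =
          (ε * ((1 - ε) * y) - ρ) ^ 2 / ε := by
        field_simp
        ring
      have h4 : 0 ≤ (ε * ((1 - ε) * y) - ρ) ^ 2 / ε := by positivity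
      linarith
    have h5 : (1 + ε) * ((1 - ε) * y) ^ 2 ≤ 2 * ((1 - ε) * l) := by
      rw [mul_pow, h2]
      have : 0 ≤ (1 - ε) * l * ε ^ 2 :=
        mul_nonneg (mul_nonneg (by linarith) hl0.le) (sq_nonneg _)
      nlinarith
    linarith
  · have h1 : (H * √l)⁻¹ * ρ = (√(A + 1) * √l)⁻¹ := by
      rw [hρ]
      field_simp
    rw [h1, inv_pow, mul_pow, Real.sq_sqrt (by positivity), hsq, ← div_eq_mul_inv]
    have h2 := ceil_mul_le hA0.le hl
    have h3 : (⌈A * l⌉₊ : ℝ) / ((A + 1) * l) ≤ 1 := div_le_one_of_le₀ h2 (by positivity)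
    linarith

/-- The degree is chosen so that a bump evaluated at distance at least `ε √l` is at most `exp (-2
l)`, since `20 H² / ε² * (ε / H)² / 10 = 2`. If every `X k` were that far, the whole sum would be
below one. -/
lemma exists_abs_sub_lt_of_one_le_sum_bump {ε H a l : ℝ} (hε0 : 0 < ε) (hH : 0 < H) (hl : 0 < l)
    {S : Finset ℕ} (hS : S.card * Real.exp (-(2 * l)) < 1) {X : ℕ → ℝ}
    (hX : ∀ k ∈ S, |X k - a| ≤ H * √l)
    (h : 1 ≤ ∑ k ∈ S, bump (H * √l)⁻¹ a ⌈20 * H ^ 2 / ε ^ 2 * l⌉₊ (X k)) :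
    ∃ k ∈ S, |X k - a| < ε * √l := by
  by_contra! hcon
  refine (h.trans (Finset.sum_le_card_nsmul S _ (Real.exp (-(2 * l))) fun k hk ↦ ?_)).not_gt
    (by rwa [nsmul_eq_mul])
  have hl' : 0 < √l := Real.sqrt_pos.2 hl
  have habs : |(H * √l)⁻¹ * (X k - a)| = |X k - a| / (H * √l) := by
    rw [abs_mul, abs_of_pos (by positivity), inv_mul_eq_div]
  refine (bump_le_exp (η := ε / H) (by positivity) ?_ ?_).trans (Real.exp_le_exp.2 ?_)
  · rw [habs, div_le_div_iff₀ hH (by positivity)]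
    have := mul_le_mul_of_nonneg_right (hcon k hk) hH.le
    linarith
  · rw [habs]
    exact div_le_one_of_le₀ (hX k hk) (by positivity)
  · have h1 := Nat.le_ceil (20 * H ^ 2 / ε ^ 2 * l)
    have h2 : 20 * H ^ 2 / ε ^ 2 * l * ((ε / H) ^ 2 / 10) = 2 * l := by
      field_simp
      norm_num
    have h3 := mul_le_mul_of_nonneg_right h1 (by positivity : 0 ≤ (ε / H) ^ 2 / 10)
    linarith

/-! ### Lower half of the law of the iterated logarithm -/

namespace IsDyadicApprox

variable {f : ℝ → ℝ} {p : ℕ → ℝ → ℝ} {B C : ℝ} {n : ℕ → ℕ}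

lemma measurable_blockVar (h : IsDyadicApprox f p B C) (s K k : ℕ) :
    Measurable (blockVar n p s K k) := by
  have := (h.trig (2 * s * K)).continuous.measurable
  unfold blockVar weightedSum
  fun_prop

/-- The second moment method applied to `K` bumps of Gaussian mean `g` with `K * g ≥ b * K ^ ε`. The
bump frequencies are at most `(A + 1) / H * √(log K)`, within the range where the characteristic
functions are controlled. -/
lemma eventually_measureReal_sum_bump_lt_one_le (h : IsDyadicApprox f p B C)
    (hn : LogDissociated n) (hn_inj : Set.InjOn n (Set.Ici 1)) (hσ : 0 < l2Norm f) {s : ℕ}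
    (hs : 2 ≤ s) {ε H : ℝ} (hε0 : 0 < ε) (hε1 : ε < 1) (hH : 0 < H) :
    ∃ M : ℝ, ∀ᶠ K : ℕ in atTop, unitMeasure.real {x | ∑ k ∈ Finset.Ioc K (2 * K),
        bump (H * √(Real.log K))⁻¹ ((1 - ε) * √(2 * Real.log K))
          ⌈20 * H ^ 2 / ε ^ 2 * Real.log K⌉₊ (blockVar n p s K k x) < 1} ≤
      M * Real.exp (-(ε * Real.log K)) := by
  obtain ⟨b, hb0, hb⟩ := exists_le_gaussianBump hε0 hε1 hH
  set A := 20 * H ^ 2 / ε ^ 2 with hA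
  have hA0 : 0 < A := by positivity
  have hlog : Tendsto (fun K : ℕ ↦ Real.log K) atTop atTop :=
    Real.tendsto_log_atTop.comp tendsto_natCast_atTop_atTop
  have hbig : Tendsto (fun K : ℕ ↦ b * Real.exp (ε * Real.log K)) atTop atTop :=
    (Real.tendsto_exp_atTop.comp (hlog.const_mul_atTop hε0)).const_mul_atTop hb0
  refine ⟨4 / b + 12 / b ^ 2, ?_⟩
  filter_upwards [h.eventually_norm_integral_cexp_sub_le hn hn_inj hσ hs
    (a := ((A + 1) / H) ^ 2) (by positivity), hlog.eventually_ge_atTop 1,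
    hbig.eventually_ge_atTop 2, eventually_ge_atTop 2] with K hK hl hK2 hK3
  set l := Real.log K with hldef
  have hl0 : 0 < l := by linarith
  have hK0 : (0 : ℝ) < K := by
    have : 0 < K := by omega
    exact_mod_cast this
  have hexp : Real.exp l = K := Real.exp_log hK0
  set c := (H * √l)⁻¹ with hc
  have hc0 : 0 ≤ c := by positivity
  set m := ⌈A * l⌉₊ with hm
  set a := (1 - ε) * √(2 * l) with ha
  set g := gaussianBump c a m with hg
  have hgb : b * Real.exp (-((1 - ε) * l)) ≤ g := hb l hl
  have hg0 : 0 < g := lt_of_lt_of_le (by positivity) hgb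
  have hfreq : ∀ t : ℝ, |t| ≤ m * c → t ^ 2 ≤ ((A + 1) / H) ^ 2 * l := by
    intro t ht
    have h1 : (m : ℝ) * c ≤ (A + 1) / H * √l := by
      calc (m : ℝ) * c ≤ (A + 1) * l * c :=
            mul_le_mul_of_nonneg_right (ceil_mul_le hA0.le hl) hc0
        _ = (A + 1) * √l ^ 2 * c := by rw [Real.sq_sqrt hl0.le]
        _ = (A + 1) / H * √l := by
          rw [hc]
          field_simp
    rw [← sq_abs, ← Real.sq_sqrt hl0.le, ← mul_pow]
    exact pow_le_pow_left₀ (abs_nonneg t) (ht.trans h1) 2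
  have hcard : ((Finset.Ioc K (2 * K)).card : ℝ) = K := by
    rw [Nat.card_Ioc]
    congr 1
    omega
  have hKg : b * Real.exp (ε * l) ≤ K * g := by
    calc b * Real.exp (ε * l) = K * (b * Real.exp (-((1 - ε) * l))) := by
          rw [← hexp, show ε * l = l + -((1 - ε) * l) by ring, Real.exp_add]
          ring
      _ ≤ K * g := mul_le_mul_of_nonneg_left hgb hK0.le
  have key := measureReal_sum_lt_one_le (μ := unitMeasure) (S := Finset.Ioc K (2 * K))
    (W := fun k x ↦ bump c a m (blockVar n p s K k x)) (g := g) (e := ((K : ℝ) ^ 3)⁻¹)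
    (fun k ↦ (continuous_bump c a m).measurable.comp (h.measurable_blockVar s K k))
    (fun k x ↦ bump_nonneg _ _ _ _) (fun k x ↦ bump_le_one _ _ _ _) hg0
    (gaussianBump_le_one _ _ _) (by positivity)
    -- The one-variable estimate is the two-variable one with second frequency zero, paired with any
    -- other block.
    (fun k hk ↦ abs_integral_bump_sub_le (h.measurable_blockVar s K k) hc0 fun t ht ↦ by
      obtain ⟨j, hj, hjk⟩ : ∃ j ∈ Finset.Ioc K (2 * K), k ≠ j := by
        rw [Finset.mem_Ioc] at hk
        by_cases hk' : k = K + 1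
        · exact ⟨K + 2, Finset.mem_Ioc.2 ⟨by omega, by omega⟩, by omega⟩
        · exact ⟨K + 1, Finset.mem_Ioc.2 ⟨by omega, by omega⟩, hk'⟩
      have := hK k hk j hj hjk t 0 (hfreq t ht) (by
        rw [zero_pow two_ne_zero]
        positivity)
      simpa using this)
    (fun j hj k hk hjk ↦ abs_integral_bump_mul_sub_le (h.measurable_blockVar s K j)
      (h.measurable_blockVar s K k) hc0 fun t u ht hu ↦
        hK j hj k hk hjk t u (hfreq t ht) (hfreq u hu))
    (by rw [hcard]; linarith)
  refine key.trans ?_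
  rw [hcard, add_mul]
  refine add_le_add ?_ ?_
  · calc 4 / (K * g) ≤ 4 / (b * Real.exp (ε * l)) := by gcongr
      _ = 4 / b * Real.exp (-(ε * l)) := by
        rw [Real.exp_neg]
        field_simp
  -- The error `K ^ (-3)` leaves a factor `1 / K` after two powers of `K` are spent on `(K * g) ^
  -- 2`.
  · calc 12 * ((K : ℝ) ^ 3)⁻¹ / g ^ 2 = 12 * (K : ℝ)⁻¹ / (K * g) ^ 2 := by field_simp
      _ ≤ 12 * (K : ℝ)⁻¹ / (b * Real.exp (ε * l)) ^ 2 := by gcongr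
      _ = 12 / b ^ 2 * ((K : ℝ)⁻¹ * Real.exp (-(ε * l)) * Real.exp (-(ε * l))) := by
        rw [Real.exp_neg]
        field_simp
      _ ≤ 12 / b ^ 2 * (1 * 1 * Real.exp (-(ε * l))) := by
        have h1 : (K : ℝ)⁻¹ ≤ 1 := inv_le_one_of_one_le₀ (by exact_mod_cast (by omega : 1 ≤ K))
        have h2 : Real.exp (-(ε * l)) ≤ 1 := Real.exp_le_one_iff.2 (by nlinarith)
        gcongr
      _ = _ := by ring

/-- Along `K = 2 ^ i` the failure probabilities `O(K ^ (-ε))` form a geometric series. -/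
lemma ae_eventually_one_le_sum_bump (h : IsDyadicApprox f p B C)
    (hn : LogDissociated n) (hn_inj : Set.InjOn n (Set.Ici 1)) (hσ : 0 < l2Norm f) {s : ℕ}
    (hs : 2 ≤ s) {ε H : ℝ} (hε0 : 0 < ε) (hε1 : ε < 1) (hH : 0 < H) :
    ∀ᵐ x ∂unitMeasure, ∀ᶠ i : ℕ in atTop, 1 ≤ ∑ k ∈ Finset.Ioc (2 ^ i) (2 * 2 ^ i),
        bump (H * √(Real.log (2 ^ i : ℕ)))⁻¹ ((1 - ε) * √(2 * Real.log (2 ^ i : ℕ)))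
          ⌈20 * H ^ 2 / ε ^ 2 * Real.log (2 ^ i : ℕ)⌉₊ (blockVar n p s (2 ^ i) k x) := by
  obtain ⟨M, hM⟩ :=
    h.eventually_measureReal_sum_bump_lt_one_le hn hn_inj hσ hs hε0 hε1 hH
  have hsum : Summable fun i : ℕ ↦ M * Real.exp (-(ε * Real.log (2 ^ i : ℕ))) := by
    refine Summable.mul_left M ?_
    have h1 : ∀ i : ℕ, Real.exp (-(ε * Real.log (2 ^ i : ℕ))) =
        Real.exp (-(ε * Real.log 2)) ^ i := fun i ↦ by
      rw [← Real.exp_nat_mul]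
      push_cast
      rw [Real.log_pow]
      ring_nf
    simp_rw [h1]
    refine summable_geometric_of_lt_one (Real.exp_pos _).le (Real.exp_lt_one_iff.2 ?_)
    have := mul_pos hε0 (Real.log_pos one_lt_two)
    linarith
  have := ae_eventually_notMem_of_summable hsum
    ((tendsto_pow_atTop_atTop_of_one_lt (one_lt_two (α := ℕ))).eventually hM)
  filter_upwards [this] with x hx
  filter_upwards [hx] with i hi
  exact not_lt.1 hi

/-- The upper half of the law, used with `δ = 1`, bounds all partial sums at block ends. It controls
what precedes a block and also confines the normalised block sums. The factor `2` allows for `log (s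
* k) ≤ 2 * log K`, and the summand `√N` for the passage to the bulk. -/
lemma ae_eventually_abs_bulkSum_le (h : IsDyadicApprox f p B C)
    (hn : LogDissociated n) (hn_pos : ∀ k, 1 ≤ k → 0 < n k) (hn_inj : Set.InjOn n (Set.Ici 1))
    {s : ℕ} (hs : 2 ≤ s) :
    ∀ᵐ x ∂unitMeasure, ∀ᶠ K : ℕ in atTop, ∀ k, K ≤ k → k ≤ 2 * K →
      |∑ i ∈ Finset.Icc 1 (2 ^ (s * k)), f ((n i : ℝ) * x) -
        bulkSum n p (2 * s * K) (2 ^ (s * k)) x| ≤ √(2 ^ (s * K)) ∧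
      |bulkSum n p (2 * s * K) (2 ^ (s * k)) x| ≤
        (2 * l2Norm f + 3) * (√(2 ^ (s * k)) * √(Real.log K)) := by
  have hσ := l2Norm_nonneg f
  have hB := h.bound_pos
  have hlog : Tendsto (fun K : ℕ ↦ Real.log K) atTop atTop :=
    Real.tendsto_log_atTop.comp tendsto_natCast_atTop_atTop
  have hsmall : ∀ᶠ K : ℕ in atTop, B + 1 ≤ 2 ^ (K / 4 : ℕ) := by
    have : Tendsto (fun K : ℕ ↦ (2 : ℝ) ^ (K / 4 : ℕ)) atTop atTop :=
      (tendsto_pow_atTop_atTop_of_one_lt one_lt_two).comp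
        (Nat.tendsto_div_const_atTop (by norm_num))
    exact this.eventually_ge_atTop _
  filter_upwards [h.ae_eventually_abs_sum_le hn hn_pos hn_inj one_pos,
    h.ae_eventually_approxError_lt hn_pos] with x h1 h2
  obtain ⟨k₀, hk₀⟩ := eventually_atTop.1 h1
  filter_upwards [(tendsto_mul_atTop hs).eventually h2, hsmall, eventually_ge_atTop k₀,
    hlog.eventually_ge_atTop (Real.log (2 * s)), hlog.eventually_ge_atTop 1] with
    K h2 h3 h4 h5 h6 k hk1 hk2
  have hsk : k ≤ s * k := Nat.le_mul_of_pos_left k (by omega)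
  have hK0 : K ≠ 0 := by
    rintro rfl
    norm_num at h6
  set N := (2 : ℝ) ^ (s * k) with hN
  have hN0 : 0 < N := by positivity
  have hsmall : 2 ^ (2 * s * K / 8) * B + approxError f p n (2 * s * K) x ≤ √(2 ^ (s * K)) := by
    refine Real.le_sqrt_of_sq_le ?_
    have e1 : 2 ^ (2 * s * K / 8) * B + approxError f p n (2 * s * K) x ≤
        2 ^ (2 * s * K / 8) * 2 ^ (K / 4) := by
      have : (1 : ℝ) ≤ 2 ^ (2 * s * K / 8) := one_le_pow₀ one_le_two
      calc _ ≤ 2 ^ (2 * s * K / 8) * B + 2 ^ (2 * s * K / 8) * 1 := by linarith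
        _ = 2 ^ (2 * s * K / 8) * (B + 1) := by ring
        _ ≤ _ := by gcongr
    refine (pow_le_pow_left₀ ?_ e1 2).trans ?_
    · have := approxError_nonneg f p n (2 * s * K) x
      positivity
    · rw [← pow_add, ← pow_mul]
      refine pow_le_pow_right₀ one_le_two ?_
      have e3 : 2 * s * K = 2 * (s * K) := by ring
      have e4 : 2 * K ≤ s * K := Nat.mul_le_mul_right K hs
      omega
  have hsub : Finset.Icc 1 (2 ^ (s * k)) ⊆ Finset.Icc 1 (2 ^ (2 * s * K)) := by
    refine Finset.Icc_subset_Icc_right (Nat.pow_le_pow_right two_pos ?_)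
    calc s * k ≤ s * (2 * K) := Nat.mul_le_mul_left s hk2
      _ = 2 * s * K := by ring
  have hdiff := (h.abs_sum_sub_weightedSum_le hn_inj (2 * s * K) hsub x).trans hsmall
  refine ⟨hdiff, ?_⟩
  have hS := hk₀ (s * k) (h4.trans (hk1.trans hsk)) (2 ^ (s * k)) le_rfl
    (Nat.pow_lt_pow_right one_lt_two (Nat.lt_succ_self _))
  have hlog2 : Real.log (s * k : ℕ) ≤ 2 * Real.log K := by
    have e1 : ((s * k : ℕ) : ℝ) ≤ 2 * s * K := by
      have : s * k ≤ 2 * s * K := by nlinarith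
      exact_mod_cast this
    have hs0 : (0 : ℝ) < s := by
      have : 0 < s := by omega
      exact_mod_cast this
    have hK0' : (0 : ℝ) < K := by
      have : 0 < K := by omega
      exact_mod_cast this
    have hk0' : 0 < s * k := by omega
    calc Real.log (s * k : ℕ) ≤ Real.log (2 * s * K) :=
          Real.log_le_log (by exact_mod_cast hk0') e1
      _ = Real.log (2 * s) + Real.log K := Real.log_mul (by positivity) hK0'.ne'
      _ ≤ _ := by linarith
  have hsqrt : √(2 * (2 ^ (s * k) : ℕ) * Real.log (s * k : ℕ)) ≤ 2 * (√N * √(Real.log K)) := by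
    refine Real.sqrt_le_iff.2 ⟨by positivity, ?_⟩
    rw [mul_pow, mul_pow, Real.sq_sqrt hN0.le, Real.sq_sqrt (by linarith)]
    have e1 : ((2 ^ (s * k) : ℕ) : ℝ) = N := by
      rw [hN, Nat.cast_pow, Nat.cast_ofNat]
    rw [e1]
    nlinarith
  have hone : √N ≤ √N * √(Real.log K) :=
    le_mul_of_one_le_right (Real.sqrt_nonneg _) (Real.one_le_sqrt.2 h6)
  have e1 : |bulkSum n p (2 * s * K) (2 ^ (s * k)) x| ≤
      |∑ i ∈ Finset.Icc 1 (2 ^ (s * k)), f ((n i : ℝ) * x)| +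
      |∑ i ∈ Finset.Icc 1 (2 ^ (s * k)), f ((n i : ℝ) * x) -
        bulkSum n p (2 * s * K) (2 ^ (s * k)) x| := by
    rw [← abs_sub_comm (bulkSum n p (2 * s * K) (2 ^ (s * k)) x)]
    have := abs_add_le (∑ i ∈ Finset.Icc 1 (2 ^ (s * k)), f ((n i : ℝ) * x))
      (bulkSum n p (2 * s * K) (2 ^ (s * k)) x -
        ∑ i ∈ Finset.Icc 1 (2 ^ (s * k)), f ((n i : ℝ) * x))
    rwa [add_sub_cancel] at this
  have e2 := mul_le_mul_of_nonneg_left hsqrt (by linarith : 0 ≤ l2Norm f + 1)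
  have hdiff' : |∑ i ∈ Finset.Icc 1 (2 ^ (s * k)), f ((n i : ℝ) * x) -
        bulkSum n p (2 * s * K) (2 ^ (s * k)) x| ≤ √N :=
    hdiff.trans (Real.sqrt_le_sqrt (pow_le_pow_right₀ one_le_two (Nat.mul_le_mul_left s hk1)))
  linarith

end IsDyadicApprox

/-- The relative losses are `5 σ ε` from variance, block length and the size of `X`, `(2 σ + 3) ε`
from the part before the block, and `ε` from the passage to the bulk: in total `(7 σ + 4) ε`. -/
lemma le_sum_of_le_normalized {σ ε N N' V L l X T T' S : ℝ} (hσ : 0 ≤ σ) (hε0 : 0 < ε)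
    (hε1 : ε ≤ 1 / 8) (hN : 0 < N) (hL : N - 2 * N' ≤ L) (hL0 : 0 < L) (hl : 1 ≤ l)
    (hN' : √N' ≤ ε * √N) (hN0' : 0 ≤ N') (hV : σ * (1 - ε) ≤ √V) (hV0 : 0 < V)
    (hX : X = (√V * √L)⁻¹ * (T - T')) (hX' : (1 - 2 * ε) * √(2 * l) ≤ X)
    (hT' : |T'| ≤ (2 * σ + 3) * (√N' * √l)) (hS : |S - T| ≤ √N') :
    (σ - (7 * σ + 4) * ε) * √(2 * N * l) ≤ S := by
  have hsl : 1 ≤ √l := Real.one_le_sqrt.2 hl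
  have hsN : 0 < √N := Real.sqrt_pos.2 hN
  have hsL : 0 < √L := Real.sqrt_pos.2 hL0
  have hsV : 0 < √V := Real.sqrt_pos.2 hV0
  have hs2 : √l ≤ √(2 * l) := Real.sqrt_le_sqrt (by linarith)
  have h1 : √(2 * N * l) = √N * √(2 * l) := by
    rw [← Real.sqrt_mul hN.le]
    ring_nf
  have hLN : (1 - 2 * ε) * √N ≤ √L := by
    refine Real.le_sqrt_of_sq_le (le_trans ?_ hL)
    have e1 : N' ≤ ε ^ 2 * N := by
      have := pow_le_pow_left₀ (Real.sqrt_nonneg _) hN' 2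
      rwa [mul_pow, Real.sq_sqrt hN0', Real.sq_sqrt hN.le] at this
    rw [mul_pow, Real.sq_sqrt hN.le]
    nlinarith [mul_pos hε0 hN]
  have hT : T = √V * √L * X + T' := by
    rw [hX]
    field_simp
    ring
  have h2 : σ * (1 - 5 * ε) * (√N * √(2 * l)) ≤ √V * √L * X := by
    calc σ * (1 - 5 * ε) * (√N * √(2 * l))
        ≤ σ * ((1 - ε) * (1 - 2 * ε) * (1 - 2 * ε)) * (√N * √(2 * l)) := by
          gcongr
          nlinarith [sq_nonneg ε]
      _ = σ * (1 - ε) * ((1 - 2 * ε) * √N) * ((1 - 2 * ε) * √(2 * l)) := by ring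
      _ ≤ √V * √L * X := by
          have : 0 ≤ 1 - 2 * ε := by linarith
          gcongr
  have h3 : √N' * √l ≤ ε * (√N * √(2 * l)) := by
    calc √N' * √l ≤ (ε * √N) * √(2 * l) := by gcongr
      _ = _ := by ring
  have h4 : √N' ≤ √N' * √l := le_mul_of_one_le_right (Real.sqrt_nonneg _) hsl
  have h5 := mul_le_mul_of_nonneg_left h3 (by linarith : 0 ≤ 2 * σ + 3)
  have h6 := (abs_le.1 hT').1
  have h7 := (abs_le.1 hS).1
  rw [h1]
  nlinarith

/-- The bump was placed according to `log K`, whereas the law is normalised by `log (log N)` with `N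
= 2 ^ (s * k)`; since `k ≤ 2 * K` they differ by at most `log (2 * s)`. -/
lemma mul_log_log_two_pow_le {ε : ℝ} {s k K : ℕ} (hε1 : ε ≤ 1) (hs : 0 < s)
    (hk : 0 < k) (hkK : k ≤ 2 * K) (hK : 0 ≤ Real.log K)
    (h : Real.log (2 * s) ≤ ε * Real.log K) :
    (1 - ε) * Real.log (Real.log (2 ^ (s * k) : ℕ)) ≤ Real.log K := by
  have hK0 : (0 : ℝ) < K := by
    have : 0 < K := by omega
    exact_mod_cast this
  have hs0 : (0 : ℝ) < s := by exact_mod_cast hs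
  have hsk : s * k ≠ 0 := (Nat.mul_pos hs hk).ne'
  have h1 : Real.log ((2 : ℝ) ^ (s * k)) ≤ 2 * s * K := by
    rw [Real.log_pow, Nat.cast_mul]
    have a1 : (k : ℝ) ≤ 2 * K := by exact_mod_cast hkK
    have a2 : Real.log 2 ≤ 1 := by linarith [Real.log_two_lt_d9]
    calc (s : ℝ) * k * Real.log 2 ≤ (s : ℝ) * (2 * K) * 1 := by gcongr
      _ = _ := by ring
  have h2 : Real.log (Real.log ((2 : ℝ) ^ (s * k))) ≤ Real.log (2 * s) + Real.log K := by
    rw [← Real.log_mul (by positivity) hK0.ne']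
    exact Real.log_le_log (Real.log_pos (one_lt_pow₀ one_lt_two hsk)) h1
  rw [Nat.cast_pow, Nat.cast_ofNat]
  calc (1 - ε) * Real.log (Real.log ((2 : ℝ) ^ (s * k)))
      ≤ (1 - ε) * (ε * Real.log K + Real.log K) :=
        mul_le_mul_of_nonneg_left (by linarith) (by linarith)
    _ = Real.log K - ε ^ 2 * Real.log K := by ring
    _ ≤ Real.log K := by nlinarith [sq_nonneg ε]

namespace IsDyadicApprox

variable {f : ℝ → ℝ} {p : ℕ → ℝ → ℝ} {B C : ℝ} {n : ℕ → ℕ}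

-- For large `i` some block with `2 ^ i < k ≤ 2 ^ (i + 1)` has normalised sum close to `(1 - ε) √(2
-- log K)`. Its length dominates everything before it when `s` is large, so the partial sum at its
-- right end is nearly extremal.
set_option maxHeartbeats 1000000 in
theorem ae_frequently_le_sum (h : IsDyadicApprox f p B C) (hn : LogDissociated n)
    (hn_pos : ∀ k, 1 ≤ k → 0 < n k) (hn_inj : Set.InjOn n (Set.Ici 1)) (hσ : 0 < l2Norm f)
    {δ : ℝ} (hδ : 0 < δ) :
    ∀ᵐ x ∂unitMeasure, ∃ᶠ N : ℕ in atTop,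
      (l2Norm f - δ) * √(2 * N * Real.log (Real.log N)) ≤
        ∑ i ∈ Finset.Icc 1 N, f ((n i : ℝ) * x) := by
  set σ := l2Norm f with hσdef
  -- Chosen so that the total loss `(7 σ + 4) ε`, together with `σ ε` from replacing `log K` by `log
  -- (log N)`, is at most `δ`; the minimum with `σ` keeps `ε ≤ 1 / 8` and the final factor
  -- nonnegative.
  set ε := min δ σ / (8 * σ + 4) with hε
  have hmin : 0 < min δ σ := lt_min hδ hσ
  have hε0 : 0 < ε := by positivity
  have hεmul : (8 * σ + 4) * ε = min δ σ := by
    rw [hε]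
    field_simp
  have hε1 : ε ≤ 1 / 8 := by
    have := min_le_right δ σ
    nlinarith
  obtain ⟨s, hs, hsε⟩ : ∃ s : ℕ, 2 ≤ s ∧ (√((2 : ℝ) ^ s))⁻¹ < ε := by
    have h1 : Tendsto (fun s : ℕ ↦ (√((2 : ℝ) ^ s))⁻¹) atTop (𝓝 0) :=
      tendsto_inv_atTop_zero.comp (Real.tendsto_sqrt_atTop.comp
        (tendsto_pow_atTop_atTop_of_one_lt one_lt_two))
    exact ((eventually_ge_atTop 2).and (h1.eventually (gt_mem_nhds hε0))).exists
  -- The first summand bounds the normalised block sums in units of `√(log K)`, and `2` bounds the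
  -- centre of the bump: the difference then stays inside the range `|c * (y - a)| ≤ 1`.
  set H := 6 * (2 * σ + 3) / σ + 2 with hH
  have hH0 : 0 < H := by positivity
  have hlog : Tendsto (fun K : ℕ ↦ Real.log K) atTop atTop :=
    Real.tendsto_log_atTop.comp tendsto_natCast_atTop_atTop
  have hpow : Tendsto (fun i : ℕ ↦ 2 ^ i) atTop atTop :=
    tendsto_pow_atTop_atTop_of_one_lt (one_lt_two (α := ℕ))
  have hvar : ∀ᶠ K : ℕ in atTop, (σ * (1 - ε)) ^ 2 < unitVariance (p (2 * s * K)) :=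
    (h.tendsto_unitVariance.comp (tendsto_mul_atTop hs)).eventually (lt_mem_nhds (by
      refine pow_lt_pow_left₀ ?_ (mul_nonneg hσ.le (by linarith)) two_ne_zero
      nlinarith))
  filter_upwards [h.ae_eventually_one_le_sum_bump hn hn_inj hσ hs hε0 (by linarith) hH0,
    h.ae_eventually_abs_bulkSum_le hn hn_pos hn_inj hs] with x hx1 hx2
  rw [frequently_atTop]
  intro N₀
  obtain ⟨i, hi1, hi2, hi3, hi4, hi5, hi6, hi7⟩ := (hx1.and ((hpow.eventually hx2).and
    ((hpow.eventually hvar).and ((hpow.eventually (hlog.eventually_ge_atTop 1)).and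
    ((hpow.eventually (hlog.eventually_ge_atTop (Real.log (2 * s) / ε))).and
    ((eventually_ge_atTop N₀).and (eventually_ge_atTop 1))))))).exists
  set K := 2 ^ i with hK
  have hiK : i < K := Nat.lt_two_pow_self
  have hK2 : 2 ≤ K := by
    rw [hK]
    calc 2 = 2 ^ 1 := rfl
      _ ≤ 2 ^ i := Nat.pow_le_pow_right two_pos hi7
  have hK0 : (0 : ℝ) < K := by
    have : 0 < K := by omega
    exact_mod_cast this
  have hs0 : (0 : ℝ) < s := by
    have : 0 < s := by omega
    exact_mod_cast this
  set l := Real.log K with hl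
  have hl0 : 0 < l := by linarith
  set V := unitVariance (p (2 * s * K)) with hV
  have hσε : 0 < σ * (1 - ε) := mul_pos hσ (by linarith)
  have hV0 : 0 < V := lt_of_le_of_lt (sq_nonneg _) hi3
  have hVs : σ * (1 - ε) ≤ √V := Real.le_sqrt_of_sq_le hi3.le
  have hVs' : σ / 2 ≤ √V := le_trans (by nlinarith) hVs
  have hprev : ∀ k ∈ Finset.Ioc K (2 * K),
      |bulkSum n p (2 * s * K) (2 ^ (s * (k - 1))) x| ≤
        (2 * σ + 3) * (√(2 ^ (s * (k - 1))) * √l) := fun k hk ↦ by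
    rw [Finset.mem_Ioc] at hk
    exact (hi2 (k - 1) (by omega) (by omega)).2
  have hXle : ∀ k ∈ Finset.Ioc K (2 * K),
      |blockVar n p s K k x - (1 - ε) * √(2 * l)| ≤ H * √l := by
    intro k hk
    have hk' := Finset.mem_Ioc.1 hk
    have e1 := (hi2 k (by omega) hk'.2).2
    have e2 := hprev k hk
    have e3 : (2 : ℝ) ^ (s * k) ≤ 2 * (blockSet n s K k).card := by
      exact_mod_cast two_pow_le_two_mul_card_blockSet hn_inj hs hk'.1 hk'.2
    set N := (2 : ℝ) ^ (s * k)
    set L := ((blockSet n s K k).card : ℝ)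
    have hN0 : 0 < N := by positivity
    have hL0 : 0 < L := by linarith
    have e4 : √(2 ^ (s * (k - 1))) ≤ √N := Real.sqrt_le_sqrt
      (pow_le_pow_right₀ one_le_two (Nat.mul_le_mul_left s (Nat.sub_le k 1)))
    have e5 : √N ≤ 3 / 2 * √L := by
      refine Real.sqrt_le_iff.2 ⟨by positivity, ?_⟩
      rw [mul_pow, Real.sq_sqrt hL0.le]
      linarith
    have e6 : |blockVar n p s K k x| ≤ 6 * (2 * σ + 3) / σ * √l := by
      rw [blockVar_eq, abs_mul, abs_of_nonneg (by positivity), inv_mul_le_iff₀ (by positivity)]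
      calc |bulkSum n p (2 * s * K) (2 ^ (s * k)) x -
              bulkSum n p (2 * s * K) (2 ^ (s * (k - 1))) x|
          ≤ (2 * σ + 3) * (√N * √l) + (2 * σ + 3) * (√N * √l) := by
            refine (abs_sub _ _).trans (add_le_add e1 (e2.trans ?_))
            gcongr
        _ ≤ (2 * σ + 3) * (3 / 2 * √L * √l) + (2 * σ + 3) * (3 / 2 * √L * √l) := by gcongr
        _ = σ / 2 * √L * (6 * (2 * σ + 3) / σ * √l) := by
            field_simp
            ring
        _ ≤ √V * √L * (6 * (2 * σ + 3) / σ * √l) := by gcongr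
    have e7 : |(1 - ε) * √(2 * l)| ≤ 2 * √l := by
      rw [abs_of_nonneg (mul_nonneg (by linarith) (Real.sqrt_nonneg _))]
      have : √(2 * l) ≤ 2 * √l := by
        refine Real.sqrt_le_iff.2 ⟨by positivity, ?_⟩
        rw [mul_pow, Real.sq_sqrt hl0.le]
        linarith
      nlinarith [Real.sqrt_nonneg (2 * l)]
    calc _ ≤ |blockVar n p s K k x| + |(1 - ε) * √(2 * l)| := abs_sub _ _
      _ ≤ 6 * (2 * σ + 3) / σ * √l + 2 * √l := add_le_add e6 e7
      _ = H * √l := by rw [hH]; ring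
  obtain ⟨k, hk, hkX⟩ := exists_abs_sub_lt_of_one_le_sum_bump hε0 hH0 hl0 (by
    have e1 : Real.exp (-(2 * l)) = (K : ℝ)⁻¹ * (K : ℝ)⁻¹ := by
      rw [show -(2 * l) = -l + -l by ring, Real.exp_add, Real.exp_neg, hl, Real.exp_log hK0]
    have e2 : ((Finset.Ioc K (2 * K)).card : ℝ) = K := by
      rw [Nat.card_Ioc]
      congr 1
      omega
    rw [e1, e2, mul_inv_cancel_left₀ hK0.ne']
    exact inv_lt_one_of_one_lt₀ (by exact_mod_cast hK2)) hXle hi1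
  have hk' := Finset.mem_Ioc.1 hk
  have hks : s * k = s * (k - 1) + s := by
    obtain ⟨j, rfl⟩ : ∃ j, k = j + 1 := ⟨k - 1, by omega⟩
    simp [mul_add]
  have hsk : k ≤ s * k := Nat.le_mul_of_pos_left k (by omega)
  refine ⟨2 ^ (s * k), ?_, ?_⟩
  -- The chosen length exceeds `N₀` because `2 ^ (s * k) > s * k ≥ k > K = 2 ^ i > i ≥ N₀`.
  · have : s * k < 2 ^ (s * k) := Nat.lt_two_pow_self
    omega
  have hcast : ((2 ^ (s * k) : ℕ) : ℝ) = 2 ^ (s * k) := by rw [Nat.cast_pow, Nat.cast_ofNat]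
  have hmain := le_sum_of_le_normalized (σ := σ) (ε := ε) (N := 2 ^ (s * k))
    (N' := 2 ^ (s * (k - 1))) (V := V) (L := (blockSet n s K k).card) (l := l)
    (S := ∑ i ∈ Finset.Icc 1 (2 ^ (s * k)), f ((n i : ℝ) * x))
    hσ.le hε0 hε1 (by positivity) (by
      have : (2 : ℝ) ^ (s * k) ≤ (blockSet n s K k).card + 2 * 2 ^ (s * (k - 1)) := by
        exact_mod_cast two_pow_le_card_blockSet_add hn_inj hk'.1 hk'.2
      linarith) (by
      have : (2 : ℝ) ^ (s * k) ≤ 2 * (blockSet n s K k).card := by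
        exact_mod_cast two_pow_le_two_mul_card_blockSet hn_inj hs hk'.1 hk'.2
      have : (0 : ℝ) < 2 ^ (s * k) := by positivity
      linarith) hi4 (by
      rw [hks, pow_add, Real.sqrt_mul (by positivity)]
      have e1 : (0 : ℝ) < √(2 ^ s) := by positivity
      have e2 : 1 ≤ ε * √(2 ^ s) := by
        rw [inv_lt_iff_one_lt_mul₀ e1] at hsε
        linarith
      calc √((2 : ℝ) ^ (s * (k - 1))) = √((2 : ℝ) ^ (s * (k - 1))) * 1 := (mul_one _).symm
        _ ≤ √((2 : ℝ) ^ (s * (k - 1))) * (ε * √(2 ^ s)) := by gcongr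
        _ = _ := by ring) (by positivity) hVs hV0 (blockVar_eq n p s K k x) (by
      have e1 := (abs_lt.1 hkX).1
      have e2 : √l ≤ √(2 * l) := Real.sqrt_le_sqrt (by linarith)
      nlinarith) (hprev k hk) ((hi2 k (by omega) hk'.2).1.trans
        (Real.sqrt_le_sqrt (pow_le_pow_right₀ one_le_two (Nat.mul_le_mul_left s (by omega)))))
  refine le_trans ?_ hmain
  have hloglog : (1 - ε) * Real.log (Real.log (2 ^ (s * k) : ℕ)) ≤ l :=
    mul_log_log_two_pow_le (by linarith) (by omega) (by omega) hk'.2 hl0.le (by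
      rw [div_le_iff₀ hε0] at hi5
      linarith)
  have hpos : 0 ≤ σ - (7 * σ + 4) * ε := by
    have := min_le_right δ σ
    nlinarith
  set R := √(2 * (2 ^ (s * k) : ℕ) * Real.log (Real.log (2 ^ (s * k) : ℕ))) with hR
  have hR0 : 0 ≤ R := Real.sqrt_nonneg _
  have hRle : (1 - ε) * R ≤ √(2 * 2 ^ (s * k) * l) := by
    have e1 : 0 ≤ 1 - ε := by linarith
    rw [hR, ← Real.sqrt_sq e1, ← Real.sqrt_mul (sq_nonneg _)]
    refine Real.sqrt_le_sqrt ?_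
    rw [hcast] at hloglog ⊢
    have e2 := mul_le_mul_of_nonneg_left hloglog e1
    have e3 : (1 - ε) * l ≤ l := by nlinarith
    have e4 : (0 : ℝ) < 2 * 2 ^ (s * k) := by positivity
    have e5 := mul_le_mul_of_nonneg_left (e2.trans e3) e4.le
    linarith
  have h8 := mul_le_mul_of_nonneg_left hRle hpos
  refine le_trans ?_ h8
  have e1 := min_le_left δ σ
  have e2 : σ - δ ≤ (σ - (7 * σ + 4) * ε) * (1 - ε) := by
    nlinarith [sq_nonneg ε]
  calc (σ - δ) * R ≤ ((σ - (7 * σ + 4) * ε) * (1 - ε)) * R := by gcongr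
    _ = _ := by ring

end IsDyadicApprox

/-! ### From the unit interval to the line, and conclusion -/

/-- The exceptional set is invariant under integer translations, and `Ioc 0 1` is a fundamental
domain for them. -/
lemma ae_of_ae_unitMeasure {P : ℝ → Prop} (hP : ∀ x (m : ℤ), P (x + m) ↔ P x)
    (h : ∀ᵐ x ∂unitMeasure, P x) : ∀ᵐ x : ℝ, P x := by
  have hfund := isAddFundamentalDomain_Ioc (T := (1 : ℝ)) one_pos 0
  rw [zero_add] at hfund
  rw [ae_iff]
  refine hfund.measure_zero_of_invariant _ (fun g ↦ ?_) ?_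
  · obtain ⟨m, hm⟩ := AddSubgroup.mem_zmultiples_iff.1 g.2
    have hg : (g : ℝ) = m := by simpa using hm.symm
    ext x
    rw [Set.mem_vadd_set_iff_neg_vadd_mem]
    have : -g +ᵥ x = x + ((-m : ℤ) : ℝ) := by
      change -(g : ℝ) + x = _
      rw [hg]
      push_cast
      ring
    rw [this]
    simp only [Set.mem_ofPred_eq, hP]
  · rw [unitMeasure, ae_iff, Measure.restrict_apply' measurableSet_Ioc] at h
    exact h

lemma sum_comp_add_intCast {f : ℝ → ℝ} (hf : Function.Periodic f 1) (n : ℕ → ℕ) (N : ℕ) (x : ℝ)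
    (m : ℤ) : ∑ i ∈ Finset.Icc 1 N, f ((n i : ℝ) * (x + m)) =
      ∑ i ∈ Finset.Icc 1 N, f ((n i : ℝ) * x) := by
  refine Finset.sum_congr rfl fun i _ ↦ ?_
  have := hf.int_mul (n i * m) ((n i : ℝ) * x)
  push_cast at this
  rw [mul_add, ← this, mul_one]

lemma tendsto_log_log_natCast :
    Tendsto (fun N : ℕ ↦ Real.log (Real.log N)) atTop atTop :=
  Real.tendsto_log_atTop.comp (Real.tendsto_log_atTop.comp tendsto_natCast_atTop_atTop)

lemma tendsto_natLog_two : Tendsto (Nat.log 2) atTop atTop :=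
  tendsto_atTop.2 fun b ↦ (eventually_ge_atTop (2 ^ b)).mono fun _ hN ↦
    Nat.le_log_of_pow_le one_lt_two hN

lemma log_natLog_le {N : ℕ} (hN : 2 ≤ N) :
    Real.log (Nat.log 2 N) ≤ Real.log (Real.log N) + 1 := by
  have hk : 0 < Nat.log 2 N := Nat.log_pos one_lt_two hN
  have hk0 : (0 : ℝ) < Nat.log 2 N := by exact_mod_cast hk
  have hN0 : (0 : ℝ) < N := by
    have : 0 < N := by omega
    exact_mod_cast this
  have h1 : (Nat.log 2 N : ℝ) * Real.log 2 ≤ Real.log N := by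
    rw [← Real.log_pow]
    refine Real.log_le_log (by positivity) ?_
    exact_mod_cast Nat.pow_log_le_self 2 (by omega : N ≠ 0)
  have h2 : (Nat.log 2 N : ℝ) ≤ Real.exp 1 * Real.log N := by
    have e1 : (2 : ℝ) ≤ Real.exp 1 := by linarith [Real.exp_one_gt_d9]
    have e2 : (1 / 2 : ℝ) ≤ Real.log 2 := by linarith [Real.log_two_gt_d9]
    have e3 : 0 ≤ Real.log N := Real.log_natCast_nonneg N
    nlinarith
  have hlog : 0 < Real.log N := Real.log_pos (by exact_mod_cast hN)
  calc Real.log (Nat.log 2 N) ≤ Real.log (Real.exp 1 * Real.log N) := Real.log_le_log hk0 h2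
    _ = _ := by
      rw [Real.log_mul (Real.exp_pos 1).ne' hlog.ne', Real.log_exp]
      ring

lemma limsup_div_eq_of_bounds {S R : ℕ → ℝ} {σ : ℝ} (hR : ∀ᶠ N in atTop, 0 < R N)
    (hup : ∀ j : ℕ, ∀ᶠ N in atTop, S N ≤ (σ + 1 / (j + 1)) * R N)
    (hlow : ∀ j : ℕ, ∃ᶠ N in atTop, (σ - 1 / (j + 1)) * R N ≤ S N) :
    limsup (fun N ↦ ((S N / R N : ℝ) : EReal)) atTop = σ := by
  refine le_antisymm ?_ ?_
  · rw [← EReal.le_of_forall_lt_iff_le]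
    intro z hz
    obtain ⟨j, hj⟩ := exists_nat_one_div_lt (sub_pos.2 (EReal.coe_lt_coe_iff.1 hz))
    refine limsup_le_of_le (by isBoundedDefault) ?_
    filter_upwards [hR, hup j] with N h1 h2
    rw [EReal.coe_le_coe_iff, div_le_iff₀ h1]
    exact h2.trans (mul_le_mul_of_nonneg_right (by linarith) h1.le)
  · rw [← EReal.ge_of_forall_gt_iff_ge]
    intro z hz
    obtain ⟨j, hj⟩ := exists_nat_one_div_lt (sub_pos.2 (EReal.coe_lt_coe_iff.1 hz))
    refine le_limsup_of_frequently_le ?_ (by isBoundedDefault)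
    refine ((hlow j).and_eventually hR).mono fun N hN ↦ ?_
    rw [EReal.coe_le_coe_iff, le_div_iff₀ hN.2]
    exact (mul_le_mul_of_nonneg_right (by linarith) hN.2.le).trans hN.1

/-- For `k = Nat.log 2 N` one has `log k ≤ log (log N) + 1`, and the additive `1` is negligible
against `log (log N)`. -/
lemma IsDyadicApprox.ae_eventually_abs_sum_le_log_log {f : ℝ → ℝ} {p : ℕ → ℝ → ℝ} {B C : ℝ}
    {n : ℕ → ℕ} (h : IsDyadicApprox f p B C) (hn : LogDissociated n)
    (hn_pos : ∀ k, 1 ≤ k → 0 < n k) (hn_inj : Set.InjOn n (Set.Ici 1)) {δ : ℝ} (hδ : 0 < δ) :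
    ∀ᵐ x ∂unitMeasure, ∀ᶠ N : ℕ in atTop, |∑ i ∈ Finset.Icc 1 N, f ((n i : ℝ) * x)| ≤
      (l2Norm f + δ) * √(2 * N * Real.log (Real.log N)) := by
  have hσ := l2Norm_nonneg f
  -- This value solves `(l2Norm f + δ / 2) * (1 + η) = l2Norm f + δ`.
  set η := (δ / 2) / (l2Norm f + δ / 2) with hη
  have hη0 : 0 < η := by positivity
  filter_upwards [h.ae_eventually_abs_sum_le hn hn_pos hn_inj (half_pos hδ)] with x hx
  filter_upwards [tendsto_natLog_two.eventually hx, eventually_ge_atTop 2,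
    tendsto_log_log_natCast.eventually_ge_atTop (1 / η)] with N h1 h2 h3
  refine (h1 N (Nat.pow_log_le_self 2 (by omega)) (Nat.lt_pow_succ_log_self one_lt_two N)).trans ?_
  have h4 := log_natLog_le h2
  set l := Real.log (Real.log N)
  have h5 : 1 ≤ η * l := by
    rw [div_le_iff₀ hη0] at h3
    linarith
  have hl0 : 0 < l := lt_of_lt_of_le (by positivity) h3
  have h6 : √(2 * N * Real.log (Nat.log 2 N)) ≤ (1 + η) * √(2 * N * l) := by
    refine Real.sqrt_le_iff.2 ⟨by positivity, ?_⟩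
    rw [mul_pow, Real.sq_sqrt (by positivity)]
    have e1 : Real.log (Nat.log 2 N) ≤ (1 + η) ^ 2 * l := by
      nlinarith [mul_pos hη0 hl0, mul_pos (mul_pos hη0 hη0) hl0]
    calc 2 * N * Real.log (Nat.log 2 N) ≤ 2 * N * ((1 + η) ^ 2 * l) := by gcongr
      _ = _ := by ring
  calc _ ≤ (l2Norm f + δ / 2) * ((1 + η) * √(2 * N * l)) := by gcongr
    _ = (l2Norm f + δ) * √(2 * N * l) := by
      have : (l2Norm f + δ / 2) * (1 + η) = l2Norm f + δ := by
        rw [hη]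
        field_simp
        ring
      rw [← this]
      ring

theorem IsAdmissible.satisfiesLIL {f : ℝ → ℝ} (hf : IsAdmissible f) {n : ℕ → ℕ}
    (hn : LogDissociated n) (hn_pos : ∀ k, 1 ≤ k → 0 < n k)
    (hn_inj : Set.InjOn n (Set.Ici 1)) : SatisfiesLIL f n := by
  obtain ⟨p, B, C, h⟩ := hf.exists_dyadicApprox
  refine ae_of_ae_unitMeasure (fun x m ↦ ?_) ?_
  · simp_rw [sum_comp_add_intCast hf.periodic_one]
  have hup : ∀ᵐ x ∂unitMeasure, ∀ j : ℕ, ∀ᶠ N : ℕ in atTop,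
      |∑ i ∈ Finset.Icc 1 N, f ((n i : ℝ) * x)| ≤
        (l2Norm f + 1 / (j + 1)) * √(2 * N * Real.log (Real.log N)) :=
    ae_all_iff.2 fun j ↦
      h.ae_eventually_abs_sum_le_log_log hn hn_pos hn_inj Nat.one_div_pos_of_nat
  have hlow : ∀ᵐ x ∂unitMeasure, ∀ j : ℕ, ∃ᶠ N : ℕ in atTop,
      (l2Norm f - 1 / (j + 1)) * √(2 * N * Real.log (Real.log N)) ≤
        ∑ i ∈ Finset.Icc 1 N, f ((n i : ℝ) * x) := by
    rcases (l2Norm_nonneg f).eq_or_lt with h0 | h0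
    -- When `‖f‖ = 0` there is no variance to normalise by; the lower bound is then the negative
    -- side of the upper bound for the absolute value.
    · filter_upwards [hup] with x hx j
      refine ((hx j).mono fun N hN ↦ ?_).frequently
      rw [← h0] at hN ⊢
      have := (abs_le.1 hN).1
      linarith
    · exact ae_all_iff.2 fun j ↦
        h.ae_frequently_le_sum hn hn_pos hn_inj h0 Nat.one_div_pos_of_nat
  filter_upwards [hup, hlow] with x h1 h2
  refine limsup_div_eq_of_bounds ?_ (fun j ↦ ?_) h2
  · filter_upwards [tendsto_log_log_natCast.eventually_gt_atTop 0, eventually_ge_atTop 1] with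
      N h3 h4
    have : (0 : ℝ) < N := by exact_mod_cast h4
    positivity
  · filter_upwards [h1 j] with N hN
    exact (le_abs_self _).trans hN

theorem theorem2 (ω : ℕ → ℝ) (n : ℕ → ℕ)
    (hω_pos : ∀ k, 1 ≤ k → 0 < ω k)
    (hω_mono : MonotoneOn ω (Set.Ici 1))
    (hω_lim : Filter.Tendsto ω Filter.atTop Filter.atTop)
    (hn_pos : ∀ k, 1 ≤ k → 0 < n k)
    (hn_inj : Set.InjOn n (Set.Ici 1))
    (hA : ConditionA ω n) :
    (∀ f : ℝ → ℝ, IsAdmissible f →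
      SatisfiesCLT f n ∧
      ∀ σ : ℕ → ℕ, Set.BijOn σ (Set.Ici 1) (Set.Ici 1) → SatisfiesCLT f (n ∘ σ)) ∧
    ((∃ α : ℝ, 0 < α ∧ ∃ k₀ : ℕ, ∀ k : ℕ, 1 ≤ k → k₀ ≤ k → Real.log (k : ℝ) ^ α ≤ ω k) →
      ∀ f : ℝ → ℝ, IsAdmissible f →
        SatisfiesLIL f n ∧
        ∀ σ : ℕ → ℕ, Set.BijOn σ (Set.Ici 1) (Set.Ici 1) → SatisfiesLIL f (n ∘ σ)) := by
  have hpos : ∀ σ : ℕ → ℕ, Set.BijOn σ (Set.Ici 1) (Set.Ici 1) → ∀ k, 1 ≤ k → 0 < (n ∘ σ) k :=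
    fun σ hσ k hk ↦ hn_pos _ (hσ.mapsTo hk)
  have hinj : ∀ σ : ℕ → ℕ, Set.BijOn σ (Set.Ici 1) (Set.Ici 1) →
      Set.InjOn (n ∘ σ) (Set.Ici 1) := fun σ hσ ↦ hn_inj.comp hσ.injOn hσ.mapsTo
  refine ⟨fun f hf ↦ ⟨hf.satisfiesCLT hω_lim hn_pos hn_inj hA, fun σ hσ ↦
    hf.satisfiesCLT hω_lim (hpos σ hσ) (hinj σ hσ) (hA.comp hσ)⟩, fun hω f hf ↦
    ⟨hf.satisfiesLIL (hA.logDissociated hn_pos hω_lim hω) hn_pos hn_inj, fun σ hσ ↦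
      hf.satisfiesLIL ((hA.comp hσ).logDissociated (hpos σ hσ) hω_lim hω) (hpos σ hσ)
        (hinj σ hσ)⟩⟩
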